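/- Let $T>0$ and $\lambda>0$, write $v(p)=p(1+|p|^2)^{-1/2}$ for $p\in\mathbb R^3$, and let $L^1_{kin}(\mathbb R^6)$ be the set of $g\in L^1(\mathbb R^6)$ with $g\ge 0$ and $\iint\sqrt{1+|p|^2}\,g(x,p)\,dx\,dp<\infty$. Let $f_0\in L^1_{kin}\cap L^\infty(\mathbb R^6)$ and $E_0,B_0\in[L^2(\mathbb R^3)]^3$, and let $(f,E,B)$ be a weak solution on $[0,T[$ with initial data $(f_0,E_0,B_0)$ of the relativistic Vlasov–Maxwell system $$\partial_t f+v\cdot\nabla_x f+(E+v\times B)\cdot\nabla_p f=0,\quad \partial_tE-\nabla\times B=-4\pi j,\quad \partial_tB+\nabla\times E=0,\quad \nabla\cdot E=4\pi\rho,\quad \nabla\cdot B=0,$$ $\rho=\int f\,dp$, $j=\int vf\,dp$; that is, $f\in L^\infty([0,T[;L^1_{kin}\cap L^\infty(\mathbb R^6))$, $E,B\in[L^\infty([0,T[;L^2(\mathbb R^3))]^3$, and the equations, with the initial values, hold in the sense of distributions, tested against smooth functions with compact support in $[0,T[\times\mathbb R^6$ (respectively $[0,T[\times\mathbb R^3$).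 Suppose that $E,B\in[L^1_{loc}(]0,T[;BV_{loc}(\mathbb R^3))]^3$ and that $\rho_\lambda(t,x)=\int|p|^\lambda f(t,x,p)\,dp$ belongs to $L^\infty_{loc}(]0,T[;L^2(\mathbb R^3))$. Put $$\mathcal E(t)=\iint\sqrt{1+|p|^2}\,f(t,x,p)\,dx\,dp+\frac1{8\pi}\int\big(|E(t,x)|^2+|B(t,x)|^2\big)dx ,$$ and let $\mathcal E(0)$ be the same expression for $(f_0,E_0,B_0)$. 1. There is a constant $c\ge\mathcal E(0)$ such that $\mathcal E(t)=c$ for almost every $t\in[0,T[$. 2. If moreover the bound on $\rho_\lambda$ holds up to the initial time, i.e. $\rho_\lambda\in L^\infty_{loc}([0,T[;L^2(\mathbb R^3))$, or if the solution satisfies the energy bound $\mathcal E(t)\le\mathcal E(0)$ for almost every $t\in[0,T[$, then $\mathcal E(t)=\mathcal E(0)$ for almost every $t\in[0,T[$. -/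

import Mathlib

open MeasureTheory Set
open scoped ENNReal NNReal ContDiff

noncomputable section

namespace RVM

/-- Euclidean three-space, used for positions, momenta and field vectors. -/
abbrev R3 := EuclideanSpace ℝ (Fin 3)

/-- The cross product of `ℝ³`. -/
def cross (a b : R3) : R3 :=
  WithLp.toLp 2 (crossProduct (WithLp.ofLp a) (WithLp.ofLp b))

/-- `∂ᵢ gⱼ (x)`. -/
def partialDeriv (g : R3 → R3) (i j : Fin 3) (x : R3) : ℝ :=
  (fderiv ℝ g x (EuclideanSpace.single i 1)) j

/-- `∇ · g`. -/
def divergence (g : R3 → R3) (x : R3) : ℝ := ∑ i, partialDeriv g i i x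

/-- `∇ × g`. -/
def curl (g : R3 → R3) (x : R3) : R3 :=
  !₂[partialDeriv g 1 2 x - partialDeriv g 2 1 x,
     partialDeriv g 2 0 x - partialDeriv g 0 2 x,
     partialDeriv g 0 1 x - partialDeriv g 1 0 x]

/-- The relativistic energy `√(1 + |p|²)` of a particle of momentum `p`. -/
def kin (p : R3) : ℝ := Real.sqrt (1 + ‖p‖ ^ 2)

/-- The relativistic velocity `v = p / √(1 + |p|²)`. -/
def velocity (p : R3) : R3 := (kin p)⁻¹ • p

/-- The Lorentz force `K = E + v × B` at momentum `p`, for field values `e`, `b`. -/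
def lorentz (e b p : R3) : R3 := e + cross (velocity p) b

/-- The charge density `ρ = ∫ f dp`. -/
def chargeDensity (f : ℝ → R3 × R3 → ℝ) (t : ℝ) (x : R3) : ℝ := ∫ p, f t (x, p)

/-- The current density `j = ∫ v f dp`. -/
def currentDensity (f : ℝ → R3 × R3 → ℝ) (t : ℝ) (x : R3) : R3 :=
  ∫ p, f t (x, p) • velocity p

/-- The moment `ρ_l (t, x) = ∫ |p| ^ l f(t, x, p) dp` with values in `[0, ∞]`, for `f ≥ 0`. -/
def moment (l : ℝ) (f : ℝ → R3 × R3 → ℝ) (t : ℝ) (x : R3) : ℝ≥0∞ :=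
  ∫⁻ p, ENNReal.ofReal (‖p‖ ^ l * f t (x, p))

/-- The total energy of a state: kinetic energy plus electromagnetic energy. -/
def totalEnergy (g : R3 × R3 → ℝ) (e b : R3 → R3) : ℝ :=
  (∫ z, kin z.2 * g z) + 1 / (8 * Real.pi) * ∫ x, (‖e x‖ ^ 2 + ‖b x‖ ^ 2)

/-- The class `L¹_kin ∩ L^∞ (ℝ⁶)`. -/
structure MemL1kinLinfty (g : R3 × R3 → ℝ) : Prop where
  nonneg : ∀ᵐ z, 0 ≤ g z
  integrable : Integrable g
  integrable_kin : Integrable fun z => kin z.2 * g z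
  memLp_top : MemLp g (⊤ : ℝ≥0∞)

/-- `u ∈ L^∞ (I; L^q (X))`. -/
def MemLinftyLp {X F : Type*} [MeasureSpace X] [TopologicalSpace F] [ENorm F]
    (I : Set ℝ) (q : ℝ≥0∞) (u : ℝ → X → F) : Prop :=
  AEStronglyMeasurable (Function.uncurry u) ((volume.restrict I).prod volume) ∧
  ∃ C : ℝ≥0, ∀ᵐ t ∂(volume.restrict I), eLpNorm (u t) q volume ≤ C

/-- `u ∈ L^∞_loc (]0, T[; L^q (X))`. -/
def MemLinftylocLp {X F : Type*} [MeasureSpace X] [TopologicalSpace F] [ENorm F]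
    (T : ℝ) (q : ℝ≥0∞) (u : ℝ → X → F) : Prop :=
  ∀ a b : ℝ, 0 < a → b < T → MemLinftyLp (Icc a b) q u

/-- `u ∈ L^∞_loc ([0, T[; L^q (X))`. -/
def MemLinftylocLpFromZero {X F : Type*} [MeasureSpace X] [TopologicalSpace F] [ENorm F]
    (T : ℝ) (q : ℝ≥0∞) (u : ℝ → X → F) : Prop :=
  ∀ b : ℝ, b < T → MemLinftyLp (Icc 0 b) q u

/-- The variation of `u` in the open set `U`:
the supremum of `∫ u ∇·η` over `η ∈ C_c^∞ (U; ℝ³)` with `|η| ≤ 1`. -/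
def variation (u : R3 → ℝ) (U : Set R3) : ℝ≥0∞ :=
  ⨆ (η : R3 → R3) (_ : ContDiff ℝ ∞ η ∧ HasCompactSupport η ∧ tsupport η ⊆ U ∧ ∀ x, ‖η x‖ ≤ 1),
    ENNReal.ofReal (∫ x, u x * divergence η x)

/-- The norm of `BV (U)`. -/
def bvNorm (u : R3 → ℝ) (U : Set R3) : ℝ≥0∞ :=
  eLpNorm u 1 (volume.restrict U) + variation u U

/-- `u ∈ L¹_loc (]0, T[; BV_loc (ℝ³))`. -/
def MemL1locBVloc (T : ℝ) (u : ℝ → R3 → ℝ) : Prop :=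
  AEStronglyMeasurable (Function.uncurry u) ((volume.restrict (Ioo 0 T)).prod volume) ∧
  ∀ a b R : ℝ, 0 < a → b < T → ∫⁻ t in Icc a b, bvNorm (u t) (Metric.ball 0 R) < (⊤ : ℝ≥0∞)

/-- Test functions on `[0, T[ × X`: restrictions of smooth functions on `ℝ × X` whose
(compact) support lies in `]-∞, T[ × X`. They need not vanish at `t = 0`. -/
structure IsTest {X F : Type*} [NormedAddCommGroup X] [NormedSpace ℝ X]
    [NormedAddCommGroup F] [NormedSpace ℝ F] (T : ℝ) (φ : ℝ × X → F) : Prop where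
  smooth : ContDiff ℝ ∞ φ
  compact : HasCompactSupport φ
  supp : tsupport φ ⊆ {z | z.1 < T}

/-- `(f, E, B)` is a weak solution on `[0, T[` of the relativistic Vlasov-Maxwell system with
initial data `(f₀, E₀, B₀)`. -/
structure IsWeakSolution (T : ℝ) (f₀ : R3 × R3 → ℝ) (E₀ B₀ : R3 → R3)
    (f : ℝ → R3 × R3 → ℝ) (E B : ℝ → R3 → R3) : Prop where
  f_nonneg : ∀ᵐ t ∂(volume.restrict (Ico 0 T)), ∀ᵐ z, 0 ≤ f t z
  f_L1 : MemLinftyLp (Ico 0 T) 1 f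
  f_kin : MemLinftyLp (Ico 0 T) 1 fun t z => kin z.2 * f t z
  f_Linfty : MemLinftyLp (Ico 0 T) (⊤ : ℝ≥0∞) f
  E_L2 : MemLinftyLp (Ico 0 T) 2 E
  B_L2 : MemLinftyLp (Ico 0 T) 2 B
  /-- `∂ₜf + v·∇ₓf + K·∇ₚf = 0`, `f(0) = f₀`; the derivative of `φ` in the direction `(1, v, K)`
  is `∂ₜφ + v·∇ₓφ + K·∇ₚφ`. -/
  vlasov : ∀ φ : ℝ × (R3 × R3) → ℝ, IsTest T φ →
    ∫ t in Ico 0 T, ∫ z : R3 × R3,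
        f t z * fderiv ℝ φ (t, z) (1, (velocity z.2, lorentz (E t z.1) (B t z.1) z.2))
      = -∫ z : R3 × R3, f₀ z * φ (0, z)
  /-- `∂ₜE - ∇×B = -4πj`, `E(0) = E₀`. -/
  ampere : ∀ ψ : ℝ × R3 → R3, IsTest T ψ →
    ∫ t in Ico 0 T, ∫ x : R3,
        (inner ℝ (E t x) (fderiv ℝ ψ (t, x) (1, 0))
          + inner ℝ (B t x) (curl (fun y => ψ (t, y)) x)
          - 4 * Real.pi * inner ℝ (currentDensity f t x) (ψ (t, x)))
      = -∫ x : R3, inner ℝ (E₀ x) (ψ (0, x))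
  /-- `∂ₜB + ∇×E = 0`, `B(0) = B₀`. -/
  faraday : ∀ ψ : ℝ × R3 → R3, IsTest T ψ →
    ∫ t in Ico 0 T, ∫ x : R3,
        (inner ℝ (B t x) (fderiv ℝ ψ (t, x) (1, 0))
          - inner ℝ (E t x) (curl (fun y => ψ (t, y)) x))
      = -∫ x : R3, inner ℝ (B₀ x) (ψ (0, x))
  /-- `∇·E = 4πρ`. -/
  gauss_E : ∀ χ : ℝ × R3 → ℝ, IsTest T χ →
    ∫ t in Ico 0 T, ∫ x : R3,
        (fderiv ℝ χ (t, x) (0, E t x) + 4 * Real.pi * chargeDensity f t x * χ (t, x)) = 0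
  /-- `∇·B = 0`. -/
  gauss_B : ∀ χ : ℝ × R3 → ℝ, IsTest T χ →
    ∫ t in Ico 0 T, ∫ x : R3, fderiv ℝ χ (t, x) (0, B t x) = 0

end RVM

end

/-! Formally the kinetic energy grows at the rate ∫ j·E, because v is the gradient of √(1+|p|²) and
the magnetic force does no work, and the field energy decreases at the same rate, because the curl
terms cancel after integration by parts. For weak solutions both balances rest on the square
integrability of ρ in x: momenta |p| ≤ 1 contribute a bounded function that is dominated by ρ ∈ L¹,
momenta |p| > 1 at most ρ_λ (`lintegral_absDensity_sq_le`). Since |j| ≤ ρ, the current is then in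
L², and f|E|, f|B| are integrable, on any set of times where ρ_λ is bounded in L².

Product test functions reduce the system to scalar equations u' = g in time (`WeakODE`). Such a u
agrees almost everywhere with an absolutely continuous function that starts at the prescribed value,
so the chain rule holds for u². For the fields, E and B are mollified in space only. At each point
the mollified components solve scalar equations; these are squared and integrated over space, the
curls cancel, and the mollifier is removed, the source term converging because E and j are both in
L² (`integral_maxwell_energy`). For the particles, the test function is √(1+|p|²) cut off at radius
n in position and momentum. The momentum gradient of the cutoff is O(1/n) where the energy is O(n),
so the derivative along the characteristics is dominated uniformly in n
(`exists_fderiv_kinTest_bound`).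

The sum of the balances says that the energy has zero distributional derivative. Test functions
supported in ]0, T[ yield a constant c; if the moment bound reaches t = 0, test functions not
vanishing there identify c with the initial energy. In general c is at least the initial energy
(`IsWeakSolution.initial_energy_le`): the energy is a supremum of affine functionals of (f, E, B),
each of which is continuous in time up to 0 with the correct initial value, so an upper bound passes
to t = 0. An assumed bound by the initial energy gives the other inequality. -/

noncomputable section

namespace RVM

open Filter Topology Convolution

/-! ### Scalar equations tested in time -/

/-- Test functions in time on `[0, T[`. -/
structure IsTimeTest (T : ℝ) (θ : ℝ → ℝ) : Prop where
  smooth : ContDiff ℝ ∞ θ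
  compact : HasCompactSupport θ
  supp : tsupport θ ⊆ Iio T

/-- The equation `u' = g`, `u(0) = u₀`, tested against functions of time. -/
def WeakODE (T : ℝ) (u g : ℝ → ℝ) (u₀ : ℝ) : Prop :=
  ∀ θ : ℝ → ℝ, IsTimeTest T θ →
    ∫ t in Ico 0 T, (deriv θ t * u t + θ t * g t) = -(θ 0 * u₀)

theorem IsTimeTest.apply_end {T : ℝ} {θ : ℝ → ℝ} (hθ : IsTimeTest T θ) : θ T = 0 := by
  by_contra h
  exact lt_irrefl T (hθ.supp (subset_tsupport _ h))

theorem IsTimeTest.continuous {T : ℝ} {θ : ℝ → ℝ} (hθ : IsTimeTest T θ) : Continuous θ :=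
  hθ.smooth.continuous

theorem IsTimeTest.continuous_deriv {T : ℝ} {θ : ℝ → ℝ} (hθ : IsTimeTest T θ) :
    Continuous (deriv θ) :=
  hθ.smooth.continuous_deriv (by simp)

theorem IsTimeTest.exists_bound {T : ℝ} {θ : ℝ → ℝ} (hθ : IsTimeTest T θ) :
    ∃ C, ∀ t, ‖θ t‖ ≤ C :=
  hθ.compact.exists_bound_of_continuous hθ.continuous

theorem IsTimeTest.exists_bound_deriv {T : ℝ} {θ : ℝ → ℝ} (hθ : IsTimeTest T θ) :
    ∃ C, ∀ t, ‖deriv θ t‖ ≤ C :=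
  hθ.compact.deriv.exists_bound_of_continuous hθ.continuous_deriv

theorem exists_lt_forall_mem_le {T : ℝ} {K : Set ℝ} (hK : IsCompact K) (h : K ⊆ Iio T) :
    ∃ b < T, ∀ x ∈ K, x ≤ b := by
  rcases K.eq_empty_or_nonempty with rfl | hne
  · exact ⟨T - 1, by linarith, by simp⟩
  · obtain ⟨b, hb, hb'⟩ := hK.exists_isGreatest hne
    exact ⟨b, h hb, fun x hx => hb' hx⟩

theorem exists_gt_forall_mem_ge {T : ℝ} {K : Set ℝ} (hK : IsCompact K) (h : K ⊆ Ioi T) :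
    ∃ b > T, ∀ x ∈ K, b ≤ x := by
  rcases K.eq_empty_or_nonempty with rfl | hne
  · exact ⟨T + 1, by linarith, by simp⟩
  · obtain ⟨b, hb, hb'⟩ := hK.exists_isLeast hne
    exact ⟨b, h hb, fun x hx => hb' hx⟩

theorem contDiff_primitive {ψ : ℝ → ℝ} (hψ : ContDiff ℝ ∞ ψ) (c : ℝ) :
    ContDiff ℝ ∞ (fun t => ∫ s in c..t, ψ s) := by
  have hd : ∀ t, HasDerivAt (fun t => ∫ s in c..t, ψ s) (ψ t) t := fun t =>
    intervalIntegral.integral_hasDerivAt_right (hψ.continuous.intervalIntegrable _ _)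
      (hψ.continuous.stronglyMeasurableAtFilter _ _) hψ.continuous.continuousAt
  rw [contDiff_infty_iff_deriv]
  refine ⟨fun t => (hd t).differentiableAt, ?_⟩
  have : deriv (fun t => ∫ s in c..t, ψ s) = ψ := funext fun t => (hd t).deriv
  rwa [this]

theorem deriv_primitive {ψ : ℝ → ℝ} (hψ : Continuous ψ) (c t : ℝ) :
    deriv (fun t => ∫ s in c..t, ψ s) t = ψ t :=
  (intervalIntegral.integral_hasDerivAt_right (hψ.intervalIntegrable _ _)
      (hψ.stronglyMeasurableAtFilter _ _) hψ.continuousAt).deriv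

/-- Every smooth function with compact support in `]0, T[` is the derivative on `[0, T[`
of a time test function. -/
theorem exists_isTimeTest_deriv_eq {T : ℝ} {ψ : ℝ → ℝ} (hψ : ContDiff ℝ ∞ ψ)
    (hc : HasCompactSupport ψ) (hs : tsupport ψ ⊆ Ioo 0 T) :
    ∃ θ, IsTimeTest T θ ∧ ∀ t, 0 ≤ t → deriv θ t = ψ t := by
  obtain ⟨b, hbT, hb⟩ := exists_lt_forall_mem_le hc.isCompact (fun x hx => (hs hx).2)
  -- The primitive is based at `T`, beyond the support of `ψ`, so it vanishes near `T` but need not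
  -- vanish at 0.
  set F : ℝ → ℝ := fun t => ∫ s in T..t, ψ s with hF
  have hFs : ContDiff ℝ ∞ F := contDiff_primitive hψ T
  -- This factor is 0 for t ≤ -2 and 1 for t ≥ -1: it makes the support compact without changing the
  -- primitive on a neighbourhood of [0, ∞[.
  have hcut : ContDiff ℝ ∞ (fun t : ℝ => Real.smoothTransition (t + 2)) :=
    Real.smoothTransition.contDiff.comp (contDiff_id.add contDiff_const)
  have hF0 : ∀ t, b < t → F t = 0 := by
    intro t ht
    refine (intervalIntegral.integral_congr (g := fun _ => (0 : ℝ)) ?_).trans (by simp)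
    intro s hs'
    by_contra hne
    have := hb s (subset_tsupport _ hne)
    rcases mem_uIcc.1 hs' with h | h <;> linarith [h.1]
  have hsub : tsupport (fun t => Real.smoothTransition (t + 2) * F t) ⊆ Icc (-2) b := by
    refine closure_minimal ?_ isClosed_Icc
    intro t ht
    rw [Function.mem_support] at ht
    refine ⟨?_, ?_⟩
    · by_contra! h
      exact ht (by rw [Real.smoothTransition.zero_of_nonpos (by linarith), zero_mul])
    · by_contra! h
      exact ht (by rw [hF0 t h, mul_zero])
  refine ⟨fun t => Real.smoothTransition (t + 2) * F t, ⟨hcut.mul hFs, ?_, ?_⟩, ?_⟩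
  · exact IsCompact.of_isClosed_subset isCompact_Icc (isClosed_tsupport _) hsub
  · exact fun t ht => lt_of_le_of_lt (hsub ht).2 hbT
  · intro t ht
    have : (fun t => Real.smoothTransition (t + 2) * F t) =ᶠ[𝓝 t] F := by
      filter_upwards [Ioi_mem_nhds (show (-1 : ℝ) < t by linarith)] with s hs'
      rw [Real.smoothTransition.one_of_one_le (by linarith [mem_Ioi.1 hs']), one_mul]
    rw [this.deriv_eq]
    exact deriv_primitive hψ.continuous T t

theorem ae_restrict_Ico_iff_Ioo {T : ℝ} {P : ℝ → Prop} :
    (∀ᵐ t ∂(volume.restrict (Ico 0 T)), P t) ↔ ∀ᵐ t, t ∈ Ioo 0 T → P t := by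
  rw [Measure.restrict_congr_set Ioo_ae_eq_Ico.symm, ae_restrict_iff' measurableSet_Ioo]

theorem setIntegral_mul_eq_integral_of_tsupport {T : ℝ} {ψ h : ℝ → ℝ}
    (hs : tsupport ψ ⊆ Ioo 0 T) :
    ∫ t in Ico 0 T, ψ t * h t = ∫ t, ψ t * h t := by
  apply setIntegral_eq_integral_of_forall_compl_eq_zero
  intro t ht
  have : ψ t = 0 := by
    by_contra hne
    exact ht (Ioo_subset_Ico_self (hs (subset_tsupport _ hne)))
  rw [this, zero_mul]

/-- The fundamental lemma of the calculus of variations on ]0, T[; the endpoint 0 is a null set. -/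
theorem ae_eq_zero_of_integral_test {T : ℝ} {h : ℝ → ℝ} (hh : IntegrableOn h (Ico 0 T))
    (H : ∀ ψ : ℝ → ℝ, ContDiff ℝ ∞ ψ → HasCompactSupport ψ → tsupport ψ ⊆ Ioo 0 T →
      ∫ t in Ico 0 T, ψ t * h t = 0) :
    ∀ᵐ t ∂(volume.restrict (Ico 0 T)), h t = 0 := by
  rw [ae_restrict_Ico_iff_Ioo]
  refine isOpen_Ioo.ae_eq_zero_of_integral_contDiff_smul_eq_zero
    (hh.mono_set Ioo_subset_Ico_self).locallyIntegrableOn ?_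
  intro ψ h1 h2 h3
  rw [← H ψ h1 h2 h3, setIntegral_mul_eq_integral_of_tsupport h3]
  rfl

/-- A function whose distributional derivative vanishes, with initial value `c`. -/
theorem ae_eq_of_integral_deriv_mul {T : ℝ} (hT : 0 < T) {h : ℝ → ℝ} {c : ℝ}
    (hh : IntegrableOn h (Ico 0 T))
    (H : ∀ θ, IsTimeTest T θ → ∫ t in Ico 0 T, deriv θ t * h t = -(θ 0 * c)) :
    ∀ᵐ t ∂(volume.restrict (Ico 0 T)), h t = c := by
  have hconst : IntegrableOn (fun _ : ℝ => c) (Ico 0 T) := by simp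
  have key : ∀ᵐ t ∂(volume.restrict (Ico 0 T)), h t - c = 0 := by
    refine ae_eq_zero_of_integral_test (hh.sub hconst) ?_
    intro ψ h1 h2 h3
    obtain ⟨θ, hθ, hd⟩ := exists_isTimeTest_deriv_eq h1 h2 h3
    obtain ⟨C, hC⟩ := hθ.exists_bound_deriv
    have e1 : ∫ t in Ico 0 T, ψ t * (h t - c)
        = ∫ t in Ico 0 T, (deriv θ t * h t - deriv θ t * c) := by
      refine setIntegral_congr_fun measurableSet_Ico fun t ht => ?_
      simp only [hd t ht.1, mul_sub]
    have i1 : IntegrableOn (fun t => deriv θ t * h t) (Ico 0 T) :=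
      hh.bdd_mul hθ.continuous_deriv.aestronglyMeasurable (ae_of_all _ hC)
    have i2 : IntegrableOn (fun t => deriv θ t * c) (Ico 0 T) :=
      hconst.bdd_mul hθ.continuous_deriv.aestronglyMeasurable (ae_of_all _ hC)
    -- The constant `c` satisfies the same identity as `h`, because `θ T = 0`.
    rw [e1, integral_sub i1 i2, H θ hθ, integral_mul_const, integral_Ico_eq_integral_Ioc,
      ← intervalIntegral.integral_of_le hT.le, intervalIntegral.integral_deriv_eq_sub,
      hθ.apply_end]
    · ring
    · exact fun t _ => (hθ.smooth.differentiable (by simp)).differentiableAt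
    · exact hθ.continuous_deriv.intervalIntegrable _ _
  filter_upwards [key] with t ht using by linarith

/-- A function whose distributional derivative on `]0, T[` vanishes is constant. -/
theorem exists_ae_eq_const_of_integral_deriv_mul {T : ℝ} (hT : 0 < T) {h : ℝ → ℝ}
    (hh : IntegrableOn h (Ico 0 T))
    (H : ∀ θ, IsTimeTest T θ → tsupport θ ⊆ Ioo 0 T → ∫ t in Ico 0 T, deriv θ t * h t = 0) :
    ∃ c, ∀ᵐ t ∂(volume.restrict (Ico 0 T)), h t = c := by
  -- The du Bois-Reymond argument: a fixed bump of mass one inside ]0, T[ will absorb the mean of an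
  -- arbitrary test function, and its pairing with `h` is the constant.
  let β : ContDiffBump (T / 2) := ⟨T / 8, T / 4, by positivity, by linarith⟩
  set ψ₀ : ℝ → ℝ := β.normed volume with hψ₀
  have s0 : ContDiff ℝ ∞ ψ₀ := β.contDiff_normed
  have c0 : HasCompactSupport ψ₀ := β.hasCompactSupport_normed
  have t0 : tsupport ψ₀ ⊆ Ioo 0 T := by
    rw [hψ₀, β.tsupport_normed_eq, Real.closedBall_eq_Icc]
    intro x hx
    have h1 : T / 2 - T / 4 ≤ x := hx.1
    have h2 : x ≤ T / 2 + T / 4 := hx.2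
    exact ⟨by linarith, by linarith⟩
  have int0 : ∫ t, ψ₀ t = 1 := β.integral_normed
  have hbdd : ∀ ψ : ℝ → ℝ, Continuous ψ → HasCompactSupport ψ →
      IntegrableOn (fun t => ψ t * h t) (Ico 0 T) := by
    intro ψ h1 h2
    obtain ⟨C, hC⟩ := h2.exists_bound_of_continuous h1
    exact hh.bdd_mul h1.aestronglyMeasurable (ae_of_all _ hC)
  set c := ∫ t in Ico 0 T, ψ₀ t * h t with hc
  refine ⟨c, ?_⟩
  have hconst : IntegrableOn (fun _ : ℝ => c) (Ico 0 T) := by simp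
  have key : ∀ᵐ t ∂(volume.restrict (Ico 0 T)), h t - c = 0 := by
    refine ae_eq_zero_of_integral_test (hh.sub hconst) ?_
    intro ψ h1 h2 h3
    set m := ∫ t, ψ t with hm
    -- With the mean removed, the primitive from 0 vanishes on both sides of the support, so it is
    -- itself an admissible test function supported in ]0, T[.
    set ψ₁ : ℝ → ℝ := fun t => ψ t - m * ψ₀ t with hψ₁
    have s1 : ContDiff ℝ ∞ ψ₁ := h1.sub (contDiff_const.mul s0)
    have c1 : HasCompactSupport ψ₁ := h2.sub c0.mul_left
    have t1 : tsupport ψ₁ ⊆ Ioo 0 T := by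
      have hsub : tsupport ψ₁ ⊆ tsupport ψ ∪ tsupport ψ₀ := by
        refine closure_minimal ?_ ((isClosed_tsupport _).union (isClosed_tsupport _))
        intro t ht
        by_contra hne
        rw [mem_union, not_or] at hne
        refine ht ?_
        simp [hψ₁, image_eq_zero_of_notMem_tsupport hne.1, image_eq_zero_of_notMem_tsupport hne.2]
      exact hsub.trans (union_subset h3 t0)
    have iψ : Integrable ψ := h1.continuous.integrable_of_hasCompactSupport h2
    have iψ₀ : Integrable ψ₀ := s0.continuous.integrable_of_hasCompactSupport c0
    have int1 : ∫ t, ψ₁ t = 0 := by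
      rw [hψ₁, integral_sub iψ (iψ₀.const_mul m), integral_const_mul, int0]; simp [hm]
    obtain ⟨b, hbT, hb⟩ := exists_lt_forall_mem_le c1.isCompact (fun x hx => (t1 hx).2)
    obtain ⟨a, ha0, ha⟩ := exists_gt_forall_mem_ge c1.isCompact (fun x hx => (t1 hx).1)
    set F : ℝ → ℝ := fun t => ∫ s in (0 : ℝ)..t, ψ₁ s with hF
    have hz : ∀ s, s < a → ψ₁ s = 0 := fun s hs => by
      by_contra hne
      linarith [ha s (subset_tsupport _ hne)]
    have hz' : ∀ s, b < s → ψ₁ s = 0 := fun s hs => by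
      by_contra hne
      linarith [hb s (subset_tsupport _ hne)]
    have hFa : ∀ t, t < a → F t = 0 := by
      intro t ht
      refine (intervalIntegral.integral_congr (g := fun _ => (0 : ℝ)) ?_).trans (by simp)
      intro s hs'
      apply hz
      rcases mem_uIcc.1 hs' with h | h <;> linarith [h.2]
    have hFb : ∀ t, b < t → F t = 0 := by
      intro t ht
      rcases lt_or_ge t a with h | h
      · exact hFa t h
      · rw [hF]
        simp only
        rw [intervalIntegral.integral_of_le (by linarith), ← int1]
        apply setIntegral_eq_integral_of_forall_compl_eq_zero
        intro s hs
        rw [mem_Ioc, not_and_or, not_lt, not_le] at hs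
        rcases hs with h | h
        · exact hz s (by linarith)
        · exact hz' s (by linarith)
    have hsub : tsupport F ⊆ Icc a b := by
      refine closure_minimal ?_ isClosed_Icc
      intro t ht
      refine ⟨?_, ?_⟩
      · by_contra! h
        exact ht (hFa t h)
      · by_contra! h
        exact ht (hFb t h)
    have hFt : IsTimeTest T F := ⟨contDiff_primitive s1 0,
      IsCompact.of_isClosed_subset isCompact_Icc (isClosed_tsupport _) hsub,
      fun t ht => lt_of_le_of_lt (hsub ht).2 hbT⟩
    have e := H F hFt (hsub.trans fun t ht => ⟨lt_of_lt_of_le ha0 ht.1, lt_of_le_of_lt ht.2 hbT⟩)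
    have e2 : ∫ t in Ico 0 T, deriv F t * h t
        = ∫ t in Ico 0 T, (ψ t * h t - m * (ψ₀ t * h t)) := by
      refine setIntegral_congr_fun measurableSet_Ico fun t ht => ?_
      have : deriv F t = ψ₁ t := deriv_primitive s1.continuous 0 t
      simp only [this, hψ₁]; ring
    rw [e2, integral_sub (hbdd ψ h1.continuous h2) ((hbdd ψ₀ s0.continuous c0).const_mul m),
      integral_const_mul, ← hc] at e
    have e3 : ∫ t in Ico 0 T, ψ t * (h t - c) = ∫ t in Ico 0 T, (ψ t * h t - ψ t * c) := by
      simp only [mul_sub]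
    have e4 : ∫ t in Ico 0 T, ψ t * c = m * c := by
      rw [setIntegral_mul_eq_integral_of_tsupport h3, integral_mul_const]
    rw [e3, integral_sub (hbdd ψ h1.continuous h2) (iψ.integrableOn.mul_const c), e4]
    exact e
  filter_upwards [key] with t ht using by linarith

/-! ### Absolutely continuous representatives of scalar weak equations -/

section Primitive

variable {T : ℝ} {g : ℝ → ℝ}

theorem absolutelyContinuous_primitive (hT : 0 < T) (hg : IntegrableOn g (Ico 0 T)) (u₀ : ℝ) :
    AbsolutelyContinuousOnInterval (fun t => u₀ + ∫ s in (0 : ℝ)..t, g s) 0 T := by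
  have hgi : IntervalIntegrable g volume 0 T :=
    (intervalIntegrable_iff_integrableOn_Ico_of_le hT.le).2 hg
  have h1 := hgi.absolutelyContinuousOnInterval_intervalIntegral (c := 0) (by simp)
  have h2 : AbsolutelyContinuousOnInterval (fun _ : ℝ => u₀) 0 T :=
    (contDiff_const (n := 1)).contDiffOn.absolutelyContinuousOnInterval
  exact h2.add h1

theorem ae_deriv_primitive (hT : 0 < T) (hg : IntegrableOn g (Ico 0 T)) (u₀ : ℝ) :
    ∀ᵐ t, t ∈ Ioo 0 T → HasDerivAt (fun t => u₀ + ∫ s in (0 : ℝ)..t, g s) (g t) t := by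
  have hgi : IntervalIntegrable g volume 0 T :=
    (intervalIntegrable_iff_integrableOn_Ico_of_le hT.le).2 hg
  filter_upwards [hgi.ae_hasDerivAt_integral] with t ht htT
  exact (ht (by rw [uIcc_of_le hT.le]; exact Ioo_subset_Icc_self htT) 0 (by simp)).const_add u₀

/-- Integration by parts of a time test function against an absolutely continuous function. -/
theorem IsTimeTest.integral_deriv_mul_add (hT : 0 < T) {θ w w' : ℝ → ℝ} (hθ : IsTimeTest T θ)
    (hw : AbsolutelyContinuousOnInterval w 0 T)
    (hd : ∀ᵐ t, t ∈ Ioo 0 T → HasDerivAt w (w' t) t) :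
    ∫ t in Ico 0 T, (deriv θ t * w t + θ t * w' t) = -(θ 0 * w 0) := by
  have hθa : AbsolutelyContinuousOnInterval θ 0 T :=
    (hθ.smooth.of_le (by simp)).contDiffOn.absolutelyContinuousOnInterval
  have e := hθa.integral_deriv_mul_eq_sub hw
  rw [hθ.apply_end, intervalIntegral.integral_of_le hT.le, ← integral_Ico_eq_integral_Ioc] at e
  rw [zero_mul, zero_sub] at e
  rw [← e]
  apply integral_congr_ae
  rw [Filter.EventuallyEq, ae_restrict_Ico_iff_Ioo]
  filter_upwards [hd] with t ht htT
  rw [(ht htT).deriv]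

/-- The primitive solves the same weak equation with the same initial value, so its difference from
`u` has zero weak derivative and zero initial value. -/
theorem WeakODE.ae_eq_primitive (hT : 0 < T) {u : ℝ → ℝ} {u₀ : ℝ}
    (hu : IntegrableOn u (Ico 0 T)) (hg : IntegrableOn g (Ico 0 T)) (H : WeakODE T u g u₀) :
    ∀ᵐ t ∂(volume.restrict (Ico 0 T)), u t = u₀ + ∫ s in (0 : ℝ)..t, g s := by
  set w : ℝ → ℝ := fun t => u₀ + ∫ s in (0 : ℝ)..t, g s with hw
  have hac := absolutelyContinuous_primitive hT hg u₀
  have hwi : IntegrableOn w (Ico 0 T) := by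
    have := hac.continuousOn
    rw [uIcc_of_le hT.le] at this
    exact (this.integrableOn_Icc).mono_set Ico_subset_Icc_self
  have key : ∀ᵐ t ∂(volume.restrict (Ico 0 T)), u t - w t = 0 := by
    refine ae_eq_of_integral_deriv_mul hT (hu.sub hwi) fun θ hθ => ?_
    obtain ⟨C, hC⟩ := hθ.exists_bound
    obtain ⟨C', hC'⟩ := hθ.exists_bound_deriv
    have e1 := H θ hθ
    have e2 := hθ.integral_deriv_mul_add hT hac (ae_deriv_primitive hT hg u₀)
    have i1 : IntegrableOn (fun t => deriv θ t * u t + θ t * g t) (Ico 0 T) :=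
      (hu.bdd_mul hθ.continuous_deriv.aestronglyMeasurable (ae_of_all _ hC')).add
        (hg.bdd_mul hθ.continuous.aestronglyMeasurable (ae_of_all _ hC))
    have i2 : IntegrableOn (fun t => deriv θ t * w t + θ t * g t) (Ico 0 T) :=
      (hwi.bdd_mul hθ.continuous_deriv.aestronglyMeasurable (ae_of_all _ hC')).add
        (hg.bdd_mul hθ.continuous.aestronglyMeasurable (ae_of_all _ hC))
    have e3 : ∫ t in Ico 0 T, ((deriv θ t * u t + θ t * g t) - (deriv θ t * w t + θ t * g t))
        = (∫ t in Ico 0 T, (deriv θ t * u t + θ t * g t))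
          - ∫ t in Ico 0 T, (deriv θ t * w t + θ t * g t) := integral_sub i1 i2
    rw [e1, e2] at e3
    simp only [intervalIntegral.integral_same, add_zero, sub_self] at e3
    rw [mul_zero, neg_zero]
    refine Eq.trans ?_ e3
    congr 1 with t
    ring
  filter_upwards [key] with t ht using by linarith

/-- The square of a weak solution of `u' = g` solves `(u²)' = 2 u g`. -/
theorem WeakODE.sq (hT : 0 < T) {u : ℝ → ℝ} {u₀ : ℝ}
    (hu : IntegrableOn u (Ico 0 T)) (hg : IntegrableOn g (Ico 0 T)) (H : WeakODE T u g u₀) :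
    WeakODE T (fun t => u t ^ 2) (fun t => 2 * u t * g t) (u₀ ^ 2) := by
  intro θ hθ
  have hac := absolutelyContinuous_primitive hT hg u₀
  have hd := ae_deriv_primitive hT hg u₀
  -- The product rule is applied to the absolutely continuous representative; `u` replaces it only
  -- under the integral.
  have e := hθ.integral_deriv_mul_add hT (hac.mul hac)
    (w' := fun t => g t * (u₀ + ∫ s in (0 : ℝ)..t, g s) + (u₀ + ∫ s in (0 : ℝ)..t, g s) * g t)
    (by filter_upwards [hd] with t ht htT using (ht htT).mul (ht htT))
  simp only [Pi.mul_apply, intervalIntegral.integral_same, add_zero] at e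
  rw [← pow_two u₀] at e
  refine Eq.trans ?_ e
  apply integral_congr_ae
  filter_upwards [H.ae_eq_primitive hT hu hg] with t ht
  rw [← ht]; ring

/-- An almost everywhere upper bound of a weak solution of `u' = g` bounds its initial value. -/
theorem WeakODE.initial_le (hT : 0 < T) {u : ℝ → ℝ} {u₀ c : ℝ}
    (hu : IntegrableOn u (Ico 0 T)) (hg : IntegrableOn g (Ico 0 T)) (H : WeakODE T u g u₀)
    (hc : ∀ᵐ t ∂(volume.restrict (Ico 0 T)), u t ≤ c) : u₀ ≤ c := by
  have hac := (absolutelyContinuous_primitive hT hg u₀).continuousOn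
  rw [uIcc_of_le hT.le] at hac
  have hlim : Tendsto (fun t => u₀ + ∫ s in (0 : ℝ)..t, g s) (𝓝[Ioo 0 T] 0) (𝓝 u₀) := by
    have := (hac 0 ⟨le_rfl, hT.le⟩).mono Ioo_subset_Icc_self
    simpa [ContinuousWithinAt] using this
  by_contra! hlt
  have h1 : ∀ᶠ t in 𝓝[Ioo 0 T] (0 : ℝ), c < u₀ + ∫ s in (0 : ℝ)..t, g s :=
    hlim.eventually_const_lt hlt
  rw [nhdsWithin_Ioo_eq_nhdsGT hT, eventually_nhdsWithin_iff, Metric.eventually_nhds_iff] at h1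
  obtain ⟨ε, hε, h1⟩ := h1
  -- If `c < u₀`, continuity of the representative at 0 contradicts the almost everywhere bound on
  -- an interval of positive length.
  have h2 : ∀ᵐ t ∂(volume.restrict (Ioo 0 (min ε T))), False := by
    have hsub : Ioo 0 (min ε T) ⊆ Ico 0 T := fun t ht =>
      ⟨ht.1.le, lt_of_lt_of_le ht.2 (min_le_right _ _)⟩
    have a1 := ae_restrict_of_ae_restrict_of_subset hsub (H.ae_eq_primitive hT hu hg)
    have a2 := ae_restrict_of_ae_restrict_of_subset hsub hc
    filter_upwards [a1, a2, ae_restrict_mem measurableSet_Ioo] with t e1 e2 ht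
    have := h1 (y := t) (by
      rw [Real.dist_eq, sub_zero, abs_of_pos ht.1]
      exact lt_of_lt_of_le ht.2 (min_le_left _ _)) ht.1
    linarith
  have h3 : volume (Ioo 0 (min ε T)) = 0 := by
    have := ae_iff.1 h2
    simpa using this
  rw [Real.volume_Ioo, ENNReal.ofReal_eq_zero] at h3
  have : 0 < min ε T := lt_min hε hT
  linarith

end Primitive

/-! ### Square integrable functions -/

section SquareIntegrable

variable {X F : Type*} [MeasurableSpace X] {μ : Measure X} [NormedAddCommGroup F]

theorem eLpNorm_two_sq {F : Type*} [TopologicalSpace F] [ContinuousENorm F] (u : X → F) :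
    eLpNorm u 2 μ ^ 2 = ∫⁻ x, ‖u x‖ₑ ^ 2 ∂μ := by
  have h := eLpNorm_nnreal_pow_eq_lintegral (f := u) (μ := μ) (p := 2) two_ne_zero
  simpa using h

theorem memLp_two_of_lintegral {u : X → F} (hu : AEStronglyMeasurable u μ)
    (h : ∫⁻ x, ‖u x‖ₑ ^ 2 ∂μ < ⊤) : MemLp u 2 μ := by
  refine ⟨hu, ?_⟩
  rw [← eLpNorm_two_sq] at h
  by_contra hne
  rw [not_lt, top_le_iff] at hne
  rw [hne] at h
  simp at h

theorem lintegral_sq_lt_top {u : X → F} (hu : MemLp u 2 μ) : ∫⁻ x, ‖u x‖ₑ ^ 2 ∂μ < ⊤ := by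
  rw [← eLpNorm_two_sq]
  exact ENNReal.pow_lt_top hu.2

theorem integral_norm_sq_eq (u : X → F) (hu : AEStronglyMeasurable u μ) :
    ∫ x, ‖u x‖ ^ 2 ∂μ = (∫⁻ x, ‖u x‖ₑ ^ 2 ∂μ).toReal := by
  rw [integral_eq_lintegral_of_nonneg_ae (f := fun x => ‖u x‖ ^ 2) (ae_of_all _ fun x => by positivity)
    (hu.norm.pow 2)]
  congr 2 with x
  rw [ENNReal.ofReal_pow (norm_nonneg _), ofReal_norm]

theorem integrable_mul_of_memLp_two {a b : X → ℝ} (ha : MemLp a 2 μ) (hb : MemLp b 2 μ) :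
    Integrable (fun x => a x * b x) μ := ha.integrable_mul hb

theorem integrable_norm_sq_of_memLp_two {u : X → F} (hu : MemLp u 2 μ) :
    Integrable (fun x => ‖u x‖ ^ 2) μ :=
  hu.integrable_norm_pow (by simp)

/-- Pointwise |ab| ≤ a² + b². This cruder form suffices to dominate the mollified source term
uniformly. -/
theorem abs_integral_mul_le {a b : X → ℝ} (ha : MemLp a 2 μ) (hb : MemLp b 2 μ) :
    |∫ x, a x * b x ∂μ| ≤ (∫ x, ‖a x‖ ^ 2 ∂μ) + ∫ x, ‖b x‖ ^ 2 ∂μ := by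
  rw [← integral_add (integrable_norm_sq_of_memLp_two ha) (integrable_norm_sq_of_memLp_two hb), ← Real.norm_eq_abs]
  refine (norm_integral_le_integral_norm _).trans (integral_mono
    (integrable_mul_of_memLp_two ha hb).norm ((integrable_norm_sq_of_memLp_two ha).add (integrable_norm_sq_of_memLp_two hb)) ?_)
  intro x
  simp only [norm_mul]
  nlinarith [sq_nonneg (‖a x‖ - ‖b x‖), norm_nonneg (a x), norm_nonneg (b x)]

/-- Cauchy–Schwarz for the splitting k v = k^{1/2} · (k^{1/2} v), that is, with respect to the
measure of density k. -/
theorem lintegral_mul_sq_le {k v : X → ℝ≥0∞} (hk : AEMeasurable k μ) (hv : AEMeasurable v μ) :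
    (∫⁻ x, k x * v x ∂μ) ^ 2 ≤ (∫⁻ x, k x ∂μ) * ∫⁻ x, k x * v x ^ 2 ∂μ := by
  have h := ENNReal.lintegral_mul_le_Lp_mul_Lq μ Real.HolderConjugate.two_two
    (f := fun x => k x ^ (1 / 2 : ℝ)) (g := fun x => k x ^ (1 / 2 : ℝ) * v x)
    (hk.pow_const _) ((hk.pow_const _).mul hv)
  have hh : ∀ x : ℝ≥0∞, x ^ (1 / 2 : ℝ) * x ^ (1 / 2 : ℝ) = x := fun x => by
    rw [← ENNReal.rpow_add_of_nonneg _ _ (by norm_num) (by norm_num)]; norm_num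
  have hs : ∀ x : ℝ≥0∞, (x ^ (1 / 2 : ℝ)) ^ (2 : ℝ) = x := fun x => by
    rw [← ENNReal.rpow_mul]; norm_num
  have hs' : ∀ x : ℝ≥0∞, (x ^ (1 / 2 : ℝ)) ^ 2 = x := fun x => by
    rw [sq, hh]
  simp only [Pi.mul_apply, ← mul_assoc, hh, hs] at h
  calc _ ≤ _ := pow_le_pow_left' h 2
    _ = _ := by
      rw [mul_pow, hs', hs']
      congr 1
      refine lintegral_congr fun x => ?_
      rw [ENNReal.mul_rpow_of_nonneg _ _ (by norm_num), hs]
      simp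

end SquareIntegrable

/-! ### Convolution with a smooth kernel -/

/-- The convolution `κ * u`. -/
def conv (κ u : R3 → ℝ) (y : R3) : ℝ := ∫ x, κ (y - x) * u x

theorem conv_eq_convolution (κ u : R3 → ℝ) :
    conv κ u = u ⋆[ContinuousLinearMap.mul ℝ ℝ, volume] κ := by
  funext y
  simp only [conv, convolution_def, ContinuousLinearMap.mul_apply']
  simp_rw [mul_comm]

theorem conv_eq_lsmul (κ u : R3 → ℝ) :
    conv κ u = κ ⋆[ContinuousLinearMap.lsmul ℝ ℝ, volume] u := by
  funext y
  rw [convolution_lsmul_swap]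
  rfl

theorem conv_congr_ae {κ u u' : R3 → ℝ} (h : u =ᵐ[volume] u') (y : R3) :
    conv κ u y = conv κ u' y :=
  integral_congr_ae (by filter_upwards [h] with x hx using by rw [hx])

theorem continuous_conv {κ : R3 → ℝ} (hκ : ContDiff ℝ ∞ κ) (hc : HasCompactSupport κ)
    {u : R3 → ℝ} (hu : LocallyIntegrable u) : Continuous (conv κ u) := by
  rw [conv_eq_convolution]
  exact hc.continuous_convolution_right _ hu hκ.continuous

theorem integrable_conv_integrand {κ : R3 → ℝ} (hκ : ContDiff ℝ ∞ κ) (hc : HasCompactSupport κ)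
    {u : R3 → ℝ} (hu : LocallyIntegrable u) (y : R3) :
    Integrable fun x => κ (y - x) * u x := by
  have := hc.convolutionExists_right (ContinuousLinearMap.mul ℝ ℝ) hu hκ.continuous y
  simpa [ConvolutionExistsAt, mul_comm] using this

theorem conv_add {κ : R3 → ℝ} (hκ : ContDiff ℝ ∞ κ) (hc : HasCompactSupport κ)
    {u v : R3 → ℝ} (hu : LocallyIntegrable u) (hv : LocallyIntegrable v) (y : R3) :
    conv κ (fun x => u x + v x) y = conv κ u y + conv κ v y := by
  simp only [conv, mul_add]
  exact integral_add (integrable_conv_integrand hκ hc hu y) (integrable_conv_integrand hκ hc hv y)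

theorem conv_sub {κ : R3 → ℝ} (hκ : ContDiff ℝ ∞ κ) (hc : HasCompactSupport κ)
    {u v : R3 → ℝ} (hu : LocallyIntegrable u) (hv : LocallyIntegrable v) (y : R3) :
    conv κ (fun x => u x - v x) y = conv κ u y - conv κ v y := by
  simp only [conv, mul_sub]
  exact integral_sub (integrable_conv_integrand hκ hc hu y) (integrable_conv_integrand hκ hc hv y)

theorem hasFDerivAt_conv {κ : R3 → ℝ} (hκ : ContDiff ℝ ∞ κ) (hc : HasCompactSupport κ)
    {u : R3 → ℝ} (hu : LocallyIntegrable u) (y v : R3) :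
    DifferentiableAt ℝ (conv κ u) y ∧
      fderiv ℝ (conv κ u) y v = conv (fun x => fderiv ℝ κ x v) u y := by
  have h := hc.hasFDerivAt_convolution_right (ContinuousLinearMap.mul ℝ ℝ) hu
    (hκ.of_le (by simp)) y
  rw [← conv_eq_convolution] at h
  refine ⟨h.differentiableAt, ?_⟩
  rw [h.fderiv, convolution_precompR_apply _ hu (hc.fderiv ℝ) (hκ.continuous_fderiv (by simp)),
    conv_eq_convolution]

/-- Young's inequality L¹ * L² ⊆ L²: Cauchy–Schwarz with weight |κ(y - x)|, then Tonelli and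
translation invariance. -/
theorem lintegral_conv_sq_le {κ : R3 → ℝ} (hκ : ContDiff ℝ ∞ κ) (hc : HasCompactSupport κ)
    {u : R3 → ℝ} (hu : AEStronglyMeasurable u) :
    ∫⁻ y, ‖conv κ u y‖ₑ ^ 2 ≤ (∫⁻ x, ‖κ x‖ₑ) ^ 2 * ∫⁻ x, ‖u x‖ₑ ^ 2 := by
  have hcont := hκ.continuous
  have h1 : ∀ y, ‖conv κ u y‖ₑ ^ 2
      ≤ (∫⁻ x, ‖κ x‖ₑ) * ∫⁻ x, ‖κ (y - x)‖ₑ * ‖u x‖ₑ ^ 2 := by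
    intro y
    calc ‖conv κ u y‖ₑ ^ 2 ≤ (∫⁻ x, ‖κ (y - x)‖ₑ * ‖u x‖ₑ) ^ 2 := by
          gcongr
          refine (enorm_integral_le_lintegral_enorm _).trans_eq ?_
          simp_rw [enorm_mul]
      _ ≤ (∫⁻ x, ‖κ (y - x)‖ₑ) * ∫⁻ x, ‖κ (y - x)‖ₑ * ‖u x‖ₑ ^ 2 :=
          lintegral_mul_sq_le (by fun_prop) hu.enorm
      _ = _ := by rw [lintegral_sub_left_eq_self (fun x => ‖κ x‖ₑ) y]
  calc ∫⁻ y, ‖conv κ u y‖ₑ ^ 2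
      ≤ ∫⁻ y, (∫⁻ x, ‖κ x‖ₑ) * ∫⁻ x, ‖κ (y - x)‖ₑ * ‖u x‖ₑ ^ 2 := lintegral_mono h1
    _ = (∫⁻ x, ‖κ x‖ₑ) * ∫⁻ y, ∫⁻ x, ‖κ (y - x)‖ₑ * ‖u x‖ₑ ^ 2 := by
        rw [lintegral_const_mul']
        have := (hκ.continuous.integrable_of_hasCompactSupport hc : Integrable κ volume).2
        exact this.ne
    _ = (∫⁻ x, ‖κ x‖ₑ) * ∫⁻ x, ∫⁻ y, ‖κ (y - x)‖ₑ * ‖u x‖ₑ ^ 2 := by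
        rw [lintegral_lintegral_swap]
        refine AEMeasurable.mul (M := ℝ≥0∞) ?_ ?_
        · have : Continuous fun z : R3 × R3 => κ (z.1 - z.2) := by fun_prop
          exact this.enorm.aemeasurable
        · exact (hu.enorm.pow_const 2).comp_quasiMeasurePreserving
            Measure.quasiMeasurePreserving_snd
    _ = (∫⁻ x, ‖κ x‖ₑ) * ∫⁻ x, (∫⁻ y, ‖κ y‖ₑ) * ‖u x‖ₑ ^ 2 := by
        congr 1
        refine lintegral_congr fun x => ?_
        rw [lintegral_mul_const, lintegral_sub_right_eq_self (fun x => ‖κ x‖ₑ) x]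
        exact (hcont.comp (continuous_id.sub continuous_const)).enorm.measurable
    _ = _ := by
        rw [lintegral_const_mul'' _ (hu.enorm.pow_const 2), sq, mul_assoc]

theorem memLp_conv {κ : R3 → ℝ} (hκ : ContDiff ℝ ∞ κ) (hc : HasCompactSupport κ)
    {u : R3 → ℝ} (hu : MemLp u 2) : MemLp (conv κ u) 2 := by
  refine memLp_two_of_lintegral
    (continuous_conv hκ hc (hu.locallyIntegrable (by norm_num))).aestronglyMeasurable ?_
  refine (lintegral_conv_sq_le hκ hc hu.1).trans_lt ?_
  refine ENNReal.mul_lt_top (ENNReal.pow_lt_top ?_) (lintegral_sq_lt_top hu)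
  exact (hκ.continuous.integrable_of_hasCompactSupport hc : Integrable κ volume).2

theorem contDiff_fderiv_apply {κ : R3 → ℝ} (hκ : ContDiff ℝ ∞ κ)
    (v : R3) : ContDiff ℝ ∞ (fun x => fderiv ℝ κ x v) :=
  (hκ.fderiv_right (m := ∞) (by simp)).clm_apply contDiff_const

theorem hasCompactSupport_fderiv_apply {κ : R3 → ℝ} (hc : HasCompactSupport κ)
    (v : R3) :
    HasCompactSupport (fun x => fderiv ℝ κ x v) :=
  hc.fderiv_apply ℝ v

/-- Integration by parts for convolutions of square integrable functions. -/
theorem integral_conv_mul_conv_fderiv {κ : R3 → ℝ} (hκ : ContDiff ℝ ∞ κ) (hc : HasCompactSupport κ)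
    {a b : R3 → ℝ} (ha : MemLp a 2) (hb : MemLp b 2) (v : R3) :
    ∫ y, conv κ a y * conv (fun x => fderiv ℝ κ x v) b y
      = -∫ y, conv κ b y * conv (fun x => fderiv ℝ κ x v) a y := by
  have la := ha.locallyIntegrable (by norm_num)
  have lb := hb.locallyIntegrable (by norm_num)
  have hκ' := contDiff_fderiv_apply hκ v
  have hc' := hasCompactSupport_fderiv_apply hc v
  -- There is no boundary term at infinity: the two convolutions and their derivatives are all in
  -- L², so every product involved is integrable.
  have e := integral_mul_fderiv_eq_neg_fderiv_mul_of_integrable (μ := (volume : Measure R3))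
    (f := conv κ a) (g := conv κ b) (v := v)
    (by simp only [(hasFDerivAt_conv hκ hc la _ v).2]
        exact integrable_mul_of_memLp_two (memLp_conv hκ' hc' ha) (memLp_conv hκ hc hb))
    (by simp only [(hasFDerivAt_conv hκ hc lb _ v).2]
        exact integrable_mul_of_memLp_two (memLp_conv hκ hc ha) (memLp_conv hκ' hc' hb))
    (integrable_mul_of_memLp_two (memLp_conv hκ hc ha) (memLp_conv hκ hc hb))
    (fun x _ => (hasFDerivAt_conv hκ hc la x v).1) (fun x _ => (hasFDerivAt_conv hκ hc lb x v).1)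
  simp only [(hasFDerivAt_conv hκ hc la _ v).2, (hasFDerivAt_conv hκ hc lb _ v).2] at e
  rw [e]
  simp_rw [mul_comm]

/-- Convolution depends only on the almost everywhere class of each time slice, so `u` may be
replaced by a strongly measurable representative, for which the parameter integral is jointly
measurable. -/
theorem aestronglyMeasurable_conv {κ : R3 → ℝ} (hκ : ContDiff ℝ ∞ κ)
    {ν : Measure ℝ} [SFinite ν] {u : ℝ → R3 → ℝ}
    (hu : AEStronglyMeasurable (Function.uncurry u) (ν.prod volume)) :
    AEStronglyMeasurable (fun z : ℝ × R3 => conv κ (u z.1) z.2) (ν.prod volume) := by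
  have hm := hu.stronglyMeasurable_mk
  set u' : ℝ → R3 → ℝ := fun t x => hu.mk _ (t, x)
  have hmeas : StronglyMeasurable fun z : ℝ × R3 => conv κ (u' z.1) z.2 := by
    refine StronglyMeasurable.integral_prod_right
      (f := fun (z : ℝ × R3) (x : R3) => κ (z.2 - x) * u' z.1 x) ?_
    have h1 : Continuous fun q : (ℝ × R3) × R3 => κ (q.1.2 - q.2) := by
      have := hκ.continuous; fun_prop
    have h2 : Measurable fun q : (ℝ × R3) × R3 => (q.1.1, q.2) := by fun_prop
    exact h1.stronglyMeasurable.mul (hm.comp_measurable h2)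
  refine ⟨_, hmeas, ?_⟩
  have h1 : ∀ᵐ t ∂ν, u t =ᵐ[volume] u' t := Measure.ae_ae_of_ae_prod hu.ae_eq_mk
  filter_upwards [Measure.quasiMeasurePreserving_fst.ae h1] with z hz
  exact conv_congr_ae hz _

/-- Serves for the current, whose L¹ norm is bounded on all of [0, T[, whereas its L² norm is
controlled only on the support of the time test function. -/
theorem enorm_conv_le_L1 {κ : R3 → ℝ} (hκ : ContDiff ℝ ∞ κ) (hc : HasCompactSupport κ)
    :
    ∃ C : ℝ≥0, ∀ (u : R3 → ℝ) (y : R3), ‖conv κ u y‖ₑ ≤ C * ∫⁻ x, ‖u x‖ₑ := by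
  obtain ⟨C, hC⟩ := hc.exists_bound_of_continuous hκ.continuous
  refine ⟨C.toNNReal, fun u y => ?_⟩
  refine (enorm_integral_le_lintegral_enorm _).trans ?_
  rw [← lintegral_const_mul' _ _ (by simp)]
  refine lintegral_mono fun x => ?_
  rw [enorm_mul]
  gcongr
  rw [← ofReal_norm]
  exact ENNReal.ofReal_le_ofReal (hC _)

theorem enorm_conv_le_L2 {κ : R3 → ℝ} (hκ : ContDiff ℝ ∞ κ) (hc : HasCompactSupport κ)
    :
    ∃ C : ℝ≥0, ∀ (u : R3 → ℝ) (y : R3), AEStronglyMeasurable u →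
      ‖conv κ u y‖ₑ ≤ C + ∫⁻ x, ‖u x‖ₑ ^ 2 := by
  have hκ2 : ∫⁻ x, ‖κ x‖ₑ ^ 2 < ⊤ := lintegral_sq_lt_top
    (hκ.continuous.memLp_of_hasCompactSupport hc)
  refine ⟨(∫⁻ x, ‖κ x‖ₑ ^ 2).toNNReal, fun u y hu => ?_⟩
  rw [ENNReal.coe_toNNReal hκ2.ne, ← lintegral_sub_left_eq_self (fun x => ‖κ x‖ₑ ^ 2) y,
    ← lintegral_add_left' (by have := hκ.continuous; fun_prop)]
  refine (enorm_integral_le_lintegral_enorm _).trans (lintegral_mono fun x => ?_)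
  rw [enorm_mul]
  rcases le_total ‖κ (y - x)‖ₑ ‖u x‖ₑ with h | h
  · exact (mul_le_mul_left h _).trans (by rw [sq ‖u x‖ₑ]; exact le_add_self)
  · exact (mul_le_mul_right h _).trans (by rw [sq ‖κ (y - x)‖ₑ]; exact le_self_add)


/-! ### Mollification -/

/-- A standard mollifier, supported in the ball of radius `2 / (n + 1)`. -/
def mollifierBump (n : ℕ) : ContDiffBump (0 : R3) :=
  ⟨1 / (n + 1), 2 / (n + 1), by positivity, by gcongr; norm_num⟩

/-- A standard mollifier of integral one. -/
def mollifier (n : ℕ) : R3 → ℝ := (mollifierBump n).normed volume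

theorem contDiff_mollifier (n : ℕ) : ContDiff ℝ ∞ (mollifier n) :=
  (mollifierBump n).contDiff_normed

theorem hasCompactSupport_mollifier (n : ℕ) : HasCompactSupport (mollifier n) :=
  (mollifierBump n).hasCompactSupport_normed

theorem lintegral_mollifier (n : ℕ) : ∫⁻ x, ‖mollifier n x‖ₑ = 1 := by
  have h := (mollifierBump n).integral_normed (μ := volume)
  rw [integral_eq_lintegral_of_nonneg_ae (ae_of_all _ (mollifierBump n).nonneg_normed)
    (contDiff_mollifier n).continuous.aestronglyMeasurable] at h
  rw [← ENNReal.toReal_eq_one_iff, ← h]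
  congr 2 with x
  exact Real.enorm_eq_ofReal ((mollifierBump n).nonneg_normed x)

theorem integral_conv_mollifier_sq_le {u : R3 → ℝ} (hu : MemLp u 2) (n : ℕ) :
    ∫ y, ‖conv (mollifier n) u y‖ ^ 2 ≤ ∫ x, ‖u x‖ ^ 2 := by
  have hs := contDiff_mollifier n
  have hc := hasCompactSupport_mollifier n
  rw [integral_norm_sq_eq _ (memLp_conv hs hc hu).1, integral_norm_sq_eq _ hu.1]
  refine ENNReal.toReal_mono (lintegral_sq_lt_top hu).ne ?_
  have := lintegral_conv_sq_le hs hc hu.1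
  rwa [lintegral_mollifier, one_pow, one_mul] at this

/-- Mollifications converge almost everywhere, so Fatou's lemma bounds the limit inferior from
below; mollification contracts L², which bounds the limit superior from above. -/
theorem tendsto_integral_conv_mollifier_sq {u : R3 → ℝ} (hu : MemLp u 2) :
    Tendsto (fun n => ∫ y, ‖conv (mollifier n) u y‖ ^ 2) atTop (𝓝 (∫ x, ‖u x‖ ^ 2)) := by
  have hL := hu.locallyIntegrable (by norm_num)
  have hr : Tendsto (fun n => (mollifierBump n).rOut) atTop (𝓝 0) := by
    have : Tendsto (fun n : ℕ => 2 * (1 / ((n : ℝ) + 1))) atTop (𝓝 (2 * 0)) :=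
      tendsto_one_div_add_atTop_nhds_zero_nat.const_mul 2
    simp only [mul_zero] at this
    refine this.congr fun n => ?_
    simp [mollifierBump, div_eq_mul_inv]
  have hae : ∀ᵐ x, Tendsto (fun n => conv (mollifier n) u x) atTop (𝓝 (u x)) := by
    -- The convergence theorem needs the outer radius to be at most a fixed multiple of the inner
    -- one; here the ratio is exactly 2.
    have := ContDiffBump.ae_convolution_tendsto_right_of_locallyIntegrable (K := 2) hr
      (Eventually.of_forall fun n => by
        simp only [mollifierBump]; rw [← mul_div_assoc, mul_one]) hL
    simp only [conv_eq_lsmul]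
    exact this
  have hm : ∀ n, AEMeasurable (fun x => ‖conv (mollifier n) u x‖ₑ ^ 2) := fun n =>
    (memLp_conv (contDiff_mollifier n) (hasCompactSupport_mollifier n) hu).1.enorm.pow_const 2
  have key : Tendsto (fun n => ∫⁻ y, ‖conv (mollifier n) u y‖ₑ ^ 2) atTop
      (𝓝 (∫⁻ x, ‖u x‖ₑ ^ 2)) := by
    refine tendsto_of_le_liminf_of_limsup_le ?_ ?_
    · refine le_trans (lintegral_mono_ae ?_) (lintegral_liminf_le' hm)
      filter_upwards [hae] with x hx
      exact ((ENNReal.continuous_pow 2).tendsto _ |>.comp hx.enorm).liminf_eq.ge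
    · refine limsup_le_of_le (by isBoundedDefault) (Eventually.of_forall fun n => ?_)
      have := lintegral_conv_sq_le (contDiff_mollifier n) (hasCompactSupport_mollifier n) hu.1
      rwa [lintegral_mollifier, one_pow, one_mul] at this
  have := (ENNReal.tendsto_toReal (lintegral_sq_lt_top hu).ne).comp key
  rw [integral_norm_sq_eq _ hu.1]
  refine this.congr fun n => ?_
  rw [integral_norm_sq_eq _
    (memLp_conv (contDiff_mollifier n) (hasCompactSupport_mollifier n) hu).1]
  rfl

theorem integral_mul_eq_polarization {X : Type*} [MeasurableSpace X] {μ : Measure X}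
    {a b : X → ℝ} (ha : MemLp a 2 μ) (hb : MemLp b 2 μ) :
    ∫ x, a x * b x ∂μ
      = ((∫ x, ‖a x + b x‖ ^ 2 ∂μ) - ∫ x, ‖a x - b x‖ ^ 2 ∂μ) / 4 := by
  have h1 : Integrable (fun x => ‖a x + b x‖ ^ 2) μ := integrable_norm_sq_of_memLp_two (ha.add hb)
  have h2 : Integrable (fun x => ‖a x - b x‖ ^ 2) μ := integrable_norm_sq_of_memLp_two (ha.sub hb)
  rw [← integral_sub h1 h2, ← integral_div]
  refine integral_congr_ae (ae_of_all _ fun x => ?_)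
  simp only [Real.norm_eq_abs, sq_abs]
  ring

/-- Polarization reduces products to the convergence of L² norms, by linearity of the convolution.
-/
theorem tendsto_integral_conv_mollifier_mul {a b : R3 → ℝ} (ha : MemLp a 2) (hb : MemLp b 2) :
    Tendsto (fun n => ∫ y, conv (mollifier n) a y * conv (mollifier n) b y) atTop
      (𝓝 (∫ x, a x * b x)) := by
  have la := ha.locallyIntegrable (by norm_num)
  have lb := hb.locallyIntegrable (by norm_num)
  rw [integral_mul_eq_polarization ha hb]
  have h1 := tendsto_integral_conv_mollifier_sq (ha.add hb)
  have h2 := tendsto_integral_conv_mollifier_sq (ha.sub hb)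
  refine ((h1.sub h2).div_const 4).congr fun n => ?_
  have hs := contDiff_mollifier n
  have hc := hasCompactSupport_mollifier n
  rw [integral_mul_eq_polarization (memLp_conv hs hc ha) (memLp_conv hs hc hb)]
  simp only [← conv_add hs hc la lb, ← conv_sub hs hc la lb]
  rfl

/-! ### Time-dependent square integrable fields -/

/-- A measurable field whose spatial `L²` norm is essentially bounded on the times in `S`. -/
structure IsL2Field {X : Type*} [MeasureSpace X] (ν : Measure ℝ) (S : Set ℝ)
    (a : ℝ → X → ℝ) : Prop where
  meas : AEStronglyMeasurable (Function.uncurry a) (ν.prod volume)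
  bound : ∃ C : ℝ≥0, ∀ᵐ t ∂ν, t ∈ S → ∫⁻ x, ‖a t x‖ₑ ^ 2 ≤ C

section General

variable {X : Type*} [MeasureSpace X] {ν : Measure ℝ} {S : Set ℝ} {a b : ℝ → X → ℝ}

theorem IsL2Field.mono {S' : Set ℝ} (ha : IsL2Field ν S a) (h : S' ⊆ S) : IsL2Field ν S' a := by
  obtain ⟨C, hC⟩ := ha.bound
  exact ⟨ha.meas, C, by filter_upwards [hC] with t ht hS using ht (h hS)⟩

theorem IsL2Field.ae_memLp [SFinite (volume : Measure X)] (ha : IsL2Field ν S a) :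
    ∀ᵐ t ∂ν, t ∈ S → MemLp (a t) 2 := by
  obtain ⟨C, hC⟩ := ha.bound
  filter_upwards [hC, ha.meas.prodMk_left] with t ht hm hS
  exact memLp_two_of_lintegral hm ((ht hS).trans_lt ENNReal.coe_lt_top)

theorem IsL2Field.ae_integral_le [SFinite (volume : Measure X)] (ha : IsL2Field ν S a) :
    ∃ C : ℝ≥0, ∀ᵐ t ∂ν, t ∈ S → ∫ x, ‖a t x‖ ^ 2 ≤ C := by
  obtain ⟨C, hC⟩ := ha.bound
  refine ⟨C, ?_⟩
  filter_upwards [hC, ha.meas.prodMk_left] with t ht hm hS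
  rw [integral_norm_sq_eq (fun x => a t x) hm]
  exact ENNReal.toReal_le_coe_of_le_coe (ht hS)

/-- The weight removes the times outside `S`, at which the slices need not be square integrable.
This is the integrability behind the exchange of the time and space integrals. -/
theorem IsL2Field.integrable_weight_mul [SFinite (volume : Measure X)] [IsFiniteMeasure ν]
    (ha : IsL2Field ν S a) (hb : IsL2Field ν S b) {w : ℝ → ℝ} (hw : Continuous w) (hwb : ∃ C, ∀ t, ‖w t‖ ≤ C)
    (hwS : ∀ t, t ∉ S → w t = 0) :
    Integrable (fun z : ℝ × X => w z.1 * (a z.1 z.2 * b z.1 z.2)) (ν.prod volume) := by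
  have hm : AEStronglyMeasurable (fun z : ℝ × X => w z.1 * (a z.1 z.2 * b z.1 z.2))
      (ν.prod volume) :=
    (hw.aestronglyMeasurable.comp_fst).mul (ha.meas.mul hb.meas)
  refine ⟨hm, ?_⟩
  obtain ⟨C, hC⟩ := hwb
  obtain ⟨Ca, hCa⟩ := ha.bound
  obtain ⟨Cb, hCb⟩ := hb.bound
  have hbound : ∀ᵐ t ∂ν, ∫⁻ x, ‖w t * (a t x * b t x)‖ₑ ≤ C.toNNReal * (Ca + Cb) := by
    filter_upwards [hCa, hCb, ha.meas.prodMk_left] with t h1 h2 h3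
    replace h3 : AEStronglyMeasurable (a t) volume := h3
    by_cases hS : t ∈ S
    · have h4 : ∀ x, ‖w t * (a t x * b t x)‖ₑ
          ≤ C.toNNReal * (‖a t x‖ₑ ^ 2 + ‖b t x‖ₑ ^ 2) := by
        intro x
        rw [enorm_mul, enorm_mul]
        gcongr
        · rw [← ofReal_norm]
          exact ENNReal.ofReal_le_ofReal (hC t)
        · rcases le_total ‖a t x‖ₑ ‖b t x‖ₑ with h | h
          · exact (mul_le_mul_left h _).trans (by rw [sq ‖b t x‖ₑ]; exact le_add_self)
          · exact (mul_le_mul_right h _).trans (by rw [sq ‖a t x‖ₑ]; exact le_self_add)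
      refine (lintegral_mono h4).trans ?_
      rw [lintegral_const_mul' _ _ (by simp), lintegral_add_left' (h3.enorm.pow_const 2)]
      gcongr
      · exact h1 hS
      · exact h2 hS
    · simp [hwS t hS]
  rw [HasFiniteIntegral, lintegral_prod _ hm.enorm]
  refine (lintegral_mono_ae hbound).trans_lt ?_
  rw [lintegral_const]
  exact ENNReal.mul_lt_top (ENNReal.mul_lt_top (by simp) (by simp)) (measure_lt_top _ _)

end General

theorem IsL2Field.conv {ν : Measure ℝ} [SFinite ν] {S : Set ℝ} {a : ℝ → R3 → ℝ}
    (ha : IsL2Field ν S a)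
    {κ : R3 → ℝ} (hκ : ContDiff ℝ ∞ κ) (hc : HasCompactSupport κ) :
    IsL2Field ν S (fun t => conv κ (a t)) := by
  obtain ⟨C, hC⟩ := ha.bound
  have hκ1 : ∫⁻ x, ‖κ x‖ₑ < ⊤ :=
    (hκ.continuous.integrable_of_hasCompactSupport hc : Integrable κ volume).2
  refine ⟨aestronglyMeasurable_conv hκ ha.meas, (∫⁻ x, ‖κ x‖ₑ).toNNReal ^ 2 * C, ?_⟩
  filter_upwards [hC, ha.meas.prodMk_left] with t ht hm hS
  refine (lintegral_conv_sq_le hκ hc hm).trans ?_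
  rw [ENNReal.coe_mul, ENNReal.coe_pow, ENNReal.coe_toNNReal hκ1.ne]
  gcongr
  exact ht hS

theorem aestronglyMeasurable_conv_apply {ν : Measure ℝ} [SFinite ν] {a : ℝ → R3 → ℝ}
    (ha : AEStronglyMeasurable (Function.uncurry a) (ν.prod volume))
    {κ : R3 → ℝ} (hκ : ContDiff ℝ ∞ κ) (y : R3) :
    AEStronglyMeasurable (fun t => conv κ (a t) y) ν := by
  refine AEStronglyMeasurable.integral_prod_right'
    (f := fun z : ℝ × R3 => κ (y - z.2) * a z.1 z.2) ?_
  have : Continuous fun z : ℝ × R3 => κ (y - z.2) := by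
    have := hκ.continuous; fun_prop
  exact this.aestronglyMeasurable.mul ha

theorem integrable_of_ae_enorm_le {ν : Measure ℝ} [IsFiniteMeasure ν] {u : ℝ → ℝ}
    (hu : AEStronglyMeasurable u ν) {C : ℝ≥0} (h : ∀ᵐ t ∂ν, ‖u t‖ₑ ≤ C) : Integrable u ν := by
  refine Integrable.of_bound hu C ?_
  filter_upwards [h] with t ht
  rw [← coe_nnnorm]
  exact_mod_cast ht

theorem IsL2Field.integrable_conv_apply {ν : Measure ℝ} [IsFiniteMeasure ν] {a : ℝ → R3 → ℝ}
    (ha : IsL2Field ν univ a)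
    {κ : R3 → ℝ} (hκ : ContDiff ℝ ∞ κ) (hc : HasCompactSupport κ) (y : R3) :
    Integrable (fun t => RVM.conv κ (a t) y) ν := by
  obtain ⟨C, hC⟩ := ha.bound
  obtain ⟨D, hD⟩ := enorm_conv_le_L2 hκ hc
  refine integrable_of_ae_enorm_le (C := D + C) (aestronglyMeasurable_conv_apply ha.meas hκ y) ?_
  filter_upwards [hC, ha.meas.prodMk_left] with t ht hm
  refine (hD _ y hm).trans ?_
  rw [ENNReal.coe_add]
  gcongr
  exact ht (mem_univ t)

theorem integrable_conv_apply_of_L1 {ν : Measure ℝ} [IsFiniteMeasure ν] {a : ℝ → R3 → ℝ}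
    (ha : AEStronglyMeasurable (Function.uncurry a) (ν.prod volume))
    (hb : ∃ C : ℝ≥0, ∀ᵐ t ∂ν, ∫⁻ x, ‖a t x‖ₑ ≤ C)
    {κ : R3 → ℝ} (hκ : ContDiff ℝ ∞ κ) (hc : HasCompactSupport κ) (y : R3) :
    Integrable (fun t => conv κ (a t) y) ν := by
  obtain ⟨C, hC⟩ := hb
  obtain ⟨D, hD⟩ := enorm_conv_le_L1 hκ hc
  refine integrable_of_ae_enorm_le (C := D * C) (aestronglyMeasurable_conv_apply ha hκ y) ?_
  filter_upwards [hC] with t ht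
  refine (hD _ y).trans ?_
  rw [ENNReal.coe_mul]
  gcongr

/-! ### The energy identity for Maxwell's equations -/

/-- Energy balance of one mollified component. -/
theorem integral_energy_component {T : ℝ} (hT : 0 < T) {θ : ℝ → ℝ} (hθ : IsTimeTest T θ)
    {a b c j : ℝ → R3 → ℝ} {a₀ : R3 → ℝ}
    (ha : IsL2Field (volume.restrict (Ico 0 T)) univ a)
    (hb : IsL2Field (volume.restrict (Ico 0 T)) univ b)
    (hc : IsL2Field (volume.restrict (Ico 0 T)) univ c)
    (hj : IsL2Field (volume.restrict (Ico 0 T)) (Function.support θ) j)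
    (hj1 : ∃ C : ℝ≥0, ∀ᵐ t ∂(volume.restrict (Ico 0 T)), ∫⁻ x, ‖j t x‖ₑ ≤ C)
    {η κ₁ κ₂ : R3 → ℝ}
    (sη : ContDiff ℝ ∞ η) (cη : HasCompactSupport η)
    (sκ₁ : ContDiff ℝ ∞ κ₁) (cκ₁ : HasCompactSupport κ₁)
    (sκ₂ : ContDiff ℝ ∞ κ₂) (cκ₂ : HasCompactSupport κ₂)
    (H : ∀ y, WeakODE T (fun t => conv η (a t) y)
      (fun t => conv κ₁ (b t) y - conv κ₂ (c t) y - conv η (j t) y) (conv η a₀ y)) :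
    IntegrableOn (fun t => deriv θ t * (∫ y, ‖conv η (a t) y‖ ^ 2)
        + 2 * θ t * ((∫ y, conv η (a t) y * conv κ₁ (b t) y)
          - (∫ y, conv η (a t) y * conv κ₂ (c t) y) - ∫ y, conv η (a t) y * conv η (j t) y))
      (Ico 0 T) ∧
    ∫ t in Ico 0 T, (deriv θ t * (∫ y, ‖conv η (a t) y‖ ^ 2)
        + 2 * θ t * ((∫ y, conv η (a t) y * conv κ₁ (b t) y)
          - (∫ y, conv η (a t) y * conv κ₂ (c t) y) - ∫ y, conv η (a t) y * conv η (j t) y))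
      = -(θ 0 * ∫ y, ‖conv η a₀ y‖ ^ 2) := by
  set ν := volume.restrict (Ico 0 T) with hν
  have hS : Function.support θ ⊆ univ := subset_univ _
  have Fa := ha.conv sη cη
  have Fb := hb.conv sκ₁ cκ₁
  have Fc := hc.conv sκ₂ cκ₂
  have Fj := hj.conv sη cη
  have i1 := Fa.integrable_weight_mul Fa hθ.continuous_deriv hθ.exists_bound_deriv (by simp)
  have i2 := Fa.integrable_weight_mul Fb hθ.continuous hθ.exists_bound (by simp)
  have i3 := Fa.integrable_weight_mul Fc hθ.continuous hθ.exists_bound (by simp)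
  have i4 := (Fa.mono hS).integrable_weight_mul Fj hθ.continuous hθ.exists_bound
    (fun t ht => Function.notMem_support.1 ht)
  -- At a fixed point `y` the mollified component is a scalar function of time, so the rule for
  -- squares applies; Fubini then integrates the identity over `y`.
  have hpt : ∀ y, ∫ t in Ico 0 T, (deriv θ t * (conv η (a t) y * conv η (a t) y)
      + 2 * (θ t * (conv η (a t) y * conv κ₁ (b t) y)
        - θ t * (conv η (a t) y * conv κ₂ (c t) y)
        - θ t * (conv η (a t) y * conv η (j t) y))) = -(θ 0 * ‖conv η a₀ y‖ ^ 2) := by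
    intro y
    have h := (H y).sq hT (ha.integrable_conv_apply sη cη y)
      (((hb.integrable_conv_apply sκ₁ cκ₁ y).sub (hc.integrable_conv_apply sκ₂ cκ₂ y)).sub
        (integrable_conv_apply_of_L1 hj.meas hj1 sη cη y)) θ hθ
    rw [Real.norm_eq_abs, sq_abs, ← h]
    congr 1 with t
    simp only [Pi.sub_apply]
    ring
  have i5 := i1.add ((((i2.sub i3).sub i4).const_mul 2))
  have hsw := integral_integral_swap (μ := ν) (ν := (volume : Measure R3))
    (f := fun t y => deriv θ t * (conv η (a t) y * conv η (a t) y)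
      + 2 * (θ t * (conv η (a t) y * conv κ₁ (b t) y)
        - θ t * (conv η (a t) y * conv κ₂ (c t) y)
        - θ t * (conv η (a t) y * conv η (j t) y))) i5
  rw [integral_congr_ae (ae_of_all _ hpt), integral_neg, integral_const_mul] at hsw
  have hae : (fun t => deriv θ t * (∫ y, ‖conv η (a t) y‖ ^ 2)
        + 2 * θ t * ((∫ y, conv η (a t) y * conv κ₁ (b t) y)
          - (∫ y, conv η (a t) y * conv κ₂ (c t) y) - ∫ y, conv η (a t) y * conv η (j t) y))
      =ᵐ[ν] fun t => ∫ y, (deriv θ t * (conv η (a t) y * conv η (a t) y)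
      + 2 * (θ t * (conv η (a t) y * conv κ₁ (b t) y)
        - θ t * (conv η (a t) y * conv κ₂ (c t) y)
        - θ t * (conv η (a t) y * conv η (j t) y))) := by
    filter_upwards [i1.prod_right_ae, i2.prod_right_ae, i3.prod_right_ae, i4.prod_right_ae]
      with t h1 h2 h3 h4
    have e : ∫ y, ‖conv η (a t) y‖ ^ 2 = ∫ y, conv η (a t) y * conv η (a t) y := by
      congr 1 with y
      rw [Real.norm_eq_abs, sq_abs, sq]
    have h23 : Integrable (fun y => θ t * (conv η (a t) y * conv κ₁ (b t) y)
        - θ t * (conv η (a t) y * conv κ₂ (c t) y)) := h2.sub h3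
    have h234 : Integrable (fun y => θ t * (conv η (a t) y * conv κ₁ (b t) y)
        - θ t * (conv η (a t) y * conv κ₂ (c t) y)
        - θ t * (conv η (a t) y * conv η (j t) y)) := h23.sub h4
    rw [integral_add h1 (h234.const_mul 2), integral_const_mul 2,
      integral_sub h23 h4, integral_sub h2 h3, integral_const_mul, integral_const_mul,
      integral_const_mul, integral_const_mul, e]
    ring
  exact ⟨(integrable_congr hae).2 i5.integral_prod_left, (integral_congr_ae hae).trans hsw⟩

/-- `∂ᵢ κ`. -/
def dkernel (κ : R3 → ℝ) (i : Fin 3) (x : R3) : ℝ := fderiv ℝ κ x (EuclideanSpace.single i 1)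

/-- The electromagnetic energy balance for Maxwell's equations with a source `J`, when every
mollification of the fields solves the equations. -/
theorem integral_maxwell_energy {T : ℝ} (hT : 0 < T) {θ : ℝ → ℝ} (hθ : IsTimeTest T θ)
    {E B J : Fin 3 → ℝ → R3 → ℝ} {E₀ B₀ : Fin 3 → R3 → ℝ}
    (hE : ∀ i, IsL2Field (volume.restrict (Ico 0 T)) univ (E i))
    (hB : ∀ i, IsL2Field (volume.restrict (Ico 0 T)) univ (B i))
    (hJ : ∀ i, IsL2Field (volume.restrict (Ico 0 T)) (Function.support θ) (J i))
    (hJ1 : ∀ i, ∃ C : ℝ≥0, ∀ᵐ t ∂(volume.restrict (Ico 0 T)), ∫⁻ x, ‖J i t x‖ₑ ≤ C)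
    (hE₀ : ∀ i, MemLp (E₀ i) 2) (hB₀ : ∀ i, MemLp (B₀ i) 2)
    (HE : ∀ η : R3 → ℝ, ContDiff ℝ ∞ η → HasCompactSupport η → ∀ i y,
      WeakODE T (fun t => conv η (E i t) y)
        (fun t => conv (dkernel η (i + 1)) (B (i + 2) t) y
          - conv (dkernel η (i + 2)) (B (i + 1) t) y - conv η (J i t) y) (conv η (E₀ i) y))
    (HB : ∀ η : R3 → ℝ, ContDiff ℝ ∞ η → HasCompactSupport η → ∀ i y,
      WeakODE T (fun t => conv η (B i t) y)
        (fun t => conv (dkernel η (i + 2)) (E (i + 1) t) y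
          - conv (dkernel η (i + 1)) (E (i + 2) t) y) (conv η (B₀ i) y)) :
    ∫ t in Ico 0 T, (deriv θ t * (∑ i, ((∫ x, ‖E i t x‖ ^ 2) + ∫ x, ‖B i t x‖ ^ 2))
        - 2 * θ t * ∑ i, ∫ x, E i t x * J i t x)
      = -(θ 0 * ∑ i, ((∫ x, ‖E₀ i x‖ ^ 2) + ∫ x, ‖B₀ i x‖ ^ 2)) := by
  set ν := volume.restrict (Ico 0 T) with hν
  have hS : Function.support θ ⊆ univ := subset_univ _
  have mE : ∀ᵐ t ∂ν, ∀ i, MemLp (E i t) 2 := by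
    rw [ae_all_iff]; intro i
    filter_upwards [(hE i).ae_memLp] with t ht using ht (mem_univ t)
  have mB : ∀ᵐ t ∂ν, ∀ i, MemLp (B i t) 2 := by
    rw [ae_all_iff]; intro i
    filter_upwards [(hB i).ae_memLp] with t ht using ht (mem_univ t)
  have mJ : ∀ᵐ t ∂ν, ∀ i, t ∈ Function.support θ → MemLp (J i t) 2 := by
    rw [ae_all_iff]; intro i
    exact (hJ i).ae_memLp
  -- Faraday's law has no source, so the component balance is used for `B` with zero current.
  have hzero : IsL2Field ν (Function.support θ) (fun (_ : ℝ) (_ : R3) => (0 : ℝ)) :=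
    ⟨aestronglyMeasurable_const, 0, by simp⟩
  -- the balance for the mollified fields
  let G : ℕ → ℝ → ℝ := fun n t =>
    deriv θ t * (∑ i, ((∫ y, ‖conv (mollifier n) (E i t) y‖ ^ 2)
        + ∫ y, ‖conv (mollifier n) (B i t) y‖ ^ 2))
      - 2 * (θ t * ∑ i, ∫ y, conv (mollifier n) (E i t) y * conv (mollifier n) (J i t) y)
  have meas2 : ∀ n (a b : ℝ → R3 → ℝ), AEStronglyMeasurable (Function.uncurry a) (ν.prod volume) →
      AEStronglyMeasurable (Function.uncurry b) (ν.prod volume) →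
      AEStronglyMeasurable (fun t => ∫ y, conv (mollifier n) (a t) y * conv (mollifier n) (b t) y)
        ν := fun n a b ha hb =>
    ((aestronglyMeasurable_conv (contDiff_mollifier n) ha).mul
      (aestronglyMeasurable_conv (contDiff_mollifier n) hb)).integral_prod_right'
  have meas1 : ∀ n (a : ℝ → R3 → ℝ), AEStronglyMeasurable (Function.uncurry a) (ν.prod volume) →
      AEStronglyMeasurable (fun t => ∫ y, ‖conv (mollifier n) (a t) y‖ ^ 2) ν := fun n a ha =>
    ((aestronglyMeasurable_conv (contDiff_mollifier n) ha).norm.pow 2).integral_prod_right'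
  have hGmeas : ∀ n, AEStronglyMeasurable (G n) ν := by
    intro n
    refine AEStronglyMeasurable.sub ?_ ?_
    · refine hθ.continuous_deriv.aestronglyMeasurable.mul ?_
      refine Finset.aestronglyMeasurable_fun_sum _ fun i _ => ?_
      exact (meas1 n _ (hE i).meas).add (meas1 n _ (hB i).meas)
    · refine (hθ.continuous.aestronglyMeasurable.mul ?_).const_mul 2
      refine Finset.aestronglyMeasurable_fun_sum _ fun i _ => ?_
      exact meas2 n _ _ (hE i).meas (hJ i).meas
  have hid : ∀ n, ∫ t in Ico 0 T, G n t
      = -(θ 0 * ∑ i, ((∫ y, ‖conv (mollifier n) (E₀ i) y‖ ^ 2)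
          + ∫ y, ‖conv (mollifier n) (B₀ i) y‖ ^ 2)) := by
    intro n
    set η := mollifier n
    have sη : ContDiff ℝ ∞ η := contDiff_mollifier n
    have cη : HasCompactSupport η := hasCompactSupport_mollifier n
    have sd : ∀ i, ContDiff ℝ ∞ (dkernel η i) := fun i => contDiff_fderiv_apply sη _
    have cd : ∀ i, HasCompactSupport (dkernel η i) := fun i => hasCompactSupport_fderiv_apply cη _
    -- Indices live in `Fin 3`, so i, i + 1, i + 2 are cyclic and the i-th component of the curl is
    -- ∂_{i+1} of component i + 2 minus ∂_{i+2} of component i + 1.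
    have PE := fun i => integral_energy_component hT hθ (hE i) (hB (i + 2)) (hB (i + 1)) (hJ i)
      (hJ1 i) sη cη (sd (i + 1)) (cd (i + 1)) (sd (i + 2)) (cd (i + 2)) (HE η sη cη i)
    have PB := fun i => integral_energy_component hT hθ (hB i) (hE (i + 1)) (hE (i + 2)) hzero
      ⟨0, by simp⟩ sη cη (sd (i + 2)) (cd (i + 2)) (sd (i + 1)) (cd (i + 1)) (a₀ := B₀ i)
      (fun y => by simpa [conv] using HB η sη cη i y)
    have hsum : ∀ᵐ t ∂ν, G n t = ∑ i, ((deriv θ t * (∫ y, ‖conv η (E i t) y‖ ^ 2)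
        + 2 * θ t * ((∫ y, conv η (E i t) y * conv (dkernel η (i + 1)) (B (i + 2) t) y)
          - (∫ y, conv η (E i t) y * conv (dkernel η (i + 2)) (B (i + 1) t) y)
          - ∫ y, conv η (E i t) y * conv η (J i t) y))
        + (deriv θ t * (∫ y, ‖conv η (B i t) y‖ ^ 2)
        + 2 * θ t * ((∫ y, conv η (B i t) y * conv (dkernel η (i + 2)) (E (i + 1) t) y)
          - (∫ y, conv η (B i t) y * conv (dkernel η (i + 1)) (E (i + 2) t) y)
          - ∫ y, conv η (B i t) y * conv η (fun _ => 0) y))) := by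
      filter_upwards [mE, mB] with t h1 h2
      -- Moving the derivatives from E to B turns the terms B · curl E into the terms E · curl B, up
      -- to a cyclic relabelling, and the two cancel in the sum: the total Poynting flux is zero.
      have ibp : ∀ i k m, ∫ y, conv η (B i t) y * conv (dkernel η k) (E m t) y
          = -∫ y, conv η (E m t) y * conv (dkernel η k) (B i t) y := fun i k m =>
        integral_conv_mul_conv_fderiv sη cη (h2 i) (h1 m) _
      have hz : ∀ y, conv η (fun _ => (0 : ℝ)) y = 0 := fun y => by simp [conv]
      simp only [G, Fin.sum_univ_three, ibp, hz, mul_zero, integral_zero, Fin.isValue,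
        Fin.reduceAdd, zero_add]
      ring
    have : ∀ i, ∫ t in Ico 0 T, ((deriv θ t * (∫ y, ‖conv η (E i t) y‖ ^ 2)
        + 2 * θ t * ((∫ y, conv η (E i t) y * conv (dkernel η (i + 1)) (B (i + 2) t) y)
          - (∫ y, conv η (E i t) y * conv (dkernel η (i + 2)) (B (i + 1) t) y)
          - ∫ y, conv η (E i t) y * conv η (J i t) y))
        + (deriv θ t * (∫ y, ‖conv η (B i t) y‖ ^ 2)
        + 2 * θ t * ((∫ y, conv η (B i t) y * conv (dkernel η (i + 2)) (E (i + 1) t) y)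
          - (∫ y, conv η (B i t) y * conv (dkernel η (i + 1)) (E (i + 2) t) y)
          - ∫ y, conv η (B i t) y * conv η (fun _ => 0) y)))
        = -(θ 0 * ((∫ y, ‖conv η (E₀ i) y‖ ^ 2) + ∫ y, ‖conv η (B₀ i) y‖ ^ 2)) := by
      intro i
      rw [mul_add, neg_add, ← (PE i).2, ← (PB i).2]
      exact integral_add (PE i).1 (PB i).1
    rw [Finset.mul_sum, ← Finset.sum_neg_distrib, ← Finset.sum_congr rfl fun i _ => this i]
    exact (integral_congr_ae hsum).trans
      (integral_finsetSum _ fun i _ => (PE i).1.add (PB i).1)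
  choose CE hCE using fun i => (hE i).ae_integral_le
  choose CB hCB using fun i => (hB i).ae_integral_le
  choose CJ hCJ using fun i => (hJ i).ae_integral_le
  rw [← ae_all_iff] at hCE hCB hCJ
  obtain ⟨C, hC⟩ := hθ.exists_bound
  obtain ⟨C', hC'⟩ := hθ.exists_bound_deriv
  have hC0 : 0 ≤ C := (norm_nonneg _).trans (hC 0)
  have hC0' : 0 ≤ C' := (norm_nonneg _).trans (hC' 0)
  -- The mollifier is removed by dominated convergence in time; the contraction property makes the
  -- bound independent of `n`.
  have hlim : Tendsto (fun n => ∫ t in Ico 0 T, G n t) atTop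
      (𝓝 (∫ t in Ico 0 T, (deriv θ t * (∑ i, ((∫ x, ‖E i t x‖ ^ 2) + ∫ x, ‖B i t x‖ ^ 2))
        - 2 * (θ t * ∑ i, ∫ x, E i t x * J i t x)))) := by
    refine tendsto_integral_of_dominated_convergence
      (fun _ => C' * (∑ i, ((CE i : ℝ) + CB i)) + 2 * (C * ∑ i, ((CE i : ℝ) + CJ i))) hGmeas
      (integrable_const _) ?_ ?_
    · intro n
      filter_upwards [mE, mB, mJ, hCE, hCB, hCJ] with t m1 m2 m3 h1 h2 h3
      refine (norm_sub_le _ _).trans (add_le_add ?_ ?_)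
      · rw [norm_mul]
        refine mul_le_mul (hC' t) ?_ (norm_nonneg _) hC0'
        rw [Real.norm_of_nonneg (Finset.sum_nonneg fun i _ => by positivity)]
        refine Finset.sum_le_sum fun i _ => add_le_add ?_ ?_
        · exact (integral_conv_mollifier_sq_le (m1 i) n).trans (h1 i (mem_univ t))
        · exact (integral_conv_mollifier_sq_le (m2 i) n).trans (h2 i (mem_univ t))
      · rw [norm_mul, Real.norm_of_nonneg zero_le_two, norm_mul]
        gcongr 2 * ?_
        -- The current is known to be in L² only where `θ` does not vanish; elsewhere the term is
        -- zero.
        by_cases hθt : θ t = 0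
        · rw [hθt, norm_zero, zero_mul]
          positivity
        · refine mul_le_mul (hC t) ?_ (norm_nonneg _) hC0
          refine (norm_sum_le _ _).trans (Finset.sum_le_sum fun i _ => ?_)
          have hs := contDiff_mollifier n
          have hc := hasCompactSupport_mollifier n
          refine (abs_integral_mul_le (memLp_conv hs hc (m1 i))
            (memLp_conv hs hc (m3 i hθt))).trans (add_le_add ?_ ?_)
          · exact (integral_conv_mollifier_sq_le (m1 i) n).trans (h1 i (mem_univ t))
          · exact (integral_conv_mollifier_sq_le (m3 i hθt) n).trans (h3 i hθt)
    · filter_upwards [mE, mB, mJ] with t m1 m2 m3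
      refine Tendsto.sub (Tendsto.const_mul _ (tendsto_finsetSum _ fun i _ =>
        (tendsto_integral_conv_mollifier_sq (m1 i)).add
          (tendsto_integral_conv_mollifier_sq (m2 i)))) (Tendsto.const_mul 2 ?_)
      by_cases hθt : θ t = 0
      · simp [hθt]
      · exact Tendsto.const_mul _ (tendsto_finsetSum _ fun i _ =>
          tendsto_integral_conv_mollifier_mul (m1 i) (m3 i hθt))
  have hlim' : Tendsto (fun n => ∫ t in Ico 0 T, G n t) atTop
      (𝓝 (-(θ 0 * ∑ i, ((∫ x, ‖E₀ i x‖ ^ 2) + ∫ x, ‖B₀ i x‖ ^ 2)))) := by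
    simp only [hid]
    exact (Tendsto.const_mul _ (tendsto_finsetSum _ fun i _ =>
      (tendsto_integral_conv_mollifier_sq (hE₀ i)).add
        (tendsto_integral_conv_mollifier_sq (hB₀ i)))).neg
  rw [← tendsto_nhds_unique hlim hlim']
  simp only [mul_assoc]
  rfl

/-! ### Velocity, test functions of product form -/

theorem kin_pos (p : R3) : 0 < kin p := Real.sqrt_pos.2 (by positivity)

theorem norm_le_kin (p : R3) : ‖p‖ ≤ kin p :=
  Real.le_sqrt_of_sq_le (by linarith)

theorem kin_le (p : R3) : kin p ≤ 1 + ‖p‖ := by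
  rw [kin, Real.sqrt_le_left (by positivity)]
  nlinarith [norm_nonneg p]

theorem contDiff_kin : ContDiff ℝ ∞ kin := by
  refine ContDiff.sqrt (contDiff_const.add (contDiff_norm_sq ℝ)) fun p => ?_
  positivity

theorem norm_velocity_le (p : R3) : ‖velocity p‖ ≤ 1 := by
  rw [velocity, norm_smul, norm_inv, Real.norm_of_nonneg (kin_pos p).le, inv_mul_le_one₀ (kin_pos p)]
  exact norm_le_kin p

theorem continuous_velocity : Continuous velocity :=
  (contDiff_kin.continuous.inv₀ fun p => (kin_pos p).ne').smul continuous_id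

theorem tsupport_smul_subset_prod {X F : Type*} [TopologicalSpace X] [NormedAddCommGroup F]
    [NormedSpace ℝ F] (θ : ℝ → ℝ) (Ψ : X → F) :
    tsupport (fun z : ℝ × X => θ z.1 • Ψ z.2) ⊆ tsupport θ ×ˢ tsupport Ψ := by
  refine closure_minimal ?_ ((isClosed_tsupport _).prod (isClosed_tsupport _))
  intro z hz
  rw [Function.mem_support] at hz
  exact ⟨subset_tsupport _ fun h => hz (by simp [h]), subset_tsupport _ fun h => hz (by simp [h])⟩

/-- The product of a time test function and a smooth compactly supported function. -/
theorem IsTimeTest.isTest_smul {X F : Type*} [NormedAddCommGroup X] [NormedSpace ℝ X]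
    [NormedAddCommGroup F] [NormedSpace ℝ F] {T : ℝ} {θ : ℝ → ℝ} (hθ : IsTimeTest T θ)
    {Ψ : X → F} (hΨ : ContDiff ℝ ∞ Ψ) (hc : HasCompactSupport Ψ) :
    IsTest T (fun z : ℝ × X => θ z.1 • Ψ z.2) where
  smooth := (hθ.smooth.comp contDiff_fst).smul (hΨ.comp contDiff_snd)
  compact := (hθ.compact.isCompact.prod hc.isCompact).of_isClosed_subset (isClosed_tsupport _)
    (tsupport_smul_subset_prod θ Ψ)
  supp := fun _ hz => hθ.supp (tsupport_smul_subset_prod θ Ψ hz).1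

theorem fderiv_smul_prod {X F : Type*} [NormedAddCommGroup X] [NormedSpace ℝ X]
    [NormedAddCommGroup F] [NormedSpace ℝ F] {θ : ℝ → ℝ} {Ψ : X → F} {t : ℝ} {x : X}
    (hθ : DifferentiableAt ℝ θ t) (hΨ : DifferentiableAt ℝ Ψ x) (s : ℝ) (v : X) :
    fderiv ℝ (fun z : ℝ × X => θ z.1 • Ψ z.2) (t, x) (s, v)
      = (s * deriv θ t) • Ψ x + θ t • fderiv ℝ Ψ x v := by
  have h1 : HasFDerivAt (fun z : ℝ × X => θ z.1)
      ((fderiv ℝ θ t).comp (ContinuousLinearMap.fst ℝ ℝ X)) (t, x) :=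
    HasFDerivAt.comp (t, x) hθ.hasFDerivAt hasFDerivAt_fst
  have h2 : HasFDerivAt (fun z : ℝ × X => Ψ z.2)
      ((fderiv ℝ Ψ x).comp (ContinuousLinearMap.snd ℝ ℝ X)) (t, x) :=
    HasFDerivAt.comp (t, x) hΨ.hasFDerivAt hasFDerivAt_snd
  have h3 : fderiv ℝ (fun z : ℝ × X => θ z.1 • Ψ z.2) (t, x) = _ := (h1.smul h2).fderiv
  rw [h3]
  simp [add_comm, fderiv_eq_smul_deriv]

/-! ### Bounds and measurability of the solution -/

theorem MemLinftyLp.lintegral_sq_bound {X F : Type*} [MeasureSpace X] [TopologicalSpace F]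
    [ContinuousENorm F] {I : Set ℝ} {u : ℝ → X → F} (hu : MemLinftyLp I 2 u) :
    ∃ C : ℝ≥0, ∀ᵐ t ∂(volume.restrict I), ∫⁻ x, ‖u t x‖ₑ ^ 2 ≤ C := by
  obtain ⟨C, hC⟩ := hu.2
  refine ⟨C ^ 2, ?_⟩
  filter_upwards [hC] with t ht
  rw [← eLpNorm_two_sq, ENNReal.coe_pow]
  gcongr

theorem MemLinftyLp.lintegral_bound {X F : Type*} [MeasureSpace X] [TopologicalSpace F]
    [ContinuousENorm F] {I : Set ℝ} {u : ℝ → X → F} (hu : MemLinftyLp I 1 u) :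
    ∃ C : ℝ≥0, ∀ᵐ t ∂(volume.restrict I), ∫⁻ x, ‖u t x‖ₑ ≤ C := by
  obtain ⟨C, hC⟩ := hu.2
  refine ⟨C, ?_⟩
  filter_upwards [hC] with t ht
  rwa [← eLpNorm_one_eq_lintegral_enorm]

theorem MemLinftyLp.ae_memLp {X F : Type*} [MeasureSpace X] [SFinite (volume : Measure X)]
    [NormedAddCommGroup F] {I : Set ℝ} {q : ℝ≥0∞} {u : ℝ → X → F} (hu : MemLinftyLp I q u) :
    ∀ᵐ t ∂(volume.restrict I), MemLp (u t) q := by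
  obtain ⟨C, hC⟩ := hu.2
  filter_upwards [hC, hu.1.prodMk_left] with t h1 h2
  exact ⟨h2, h1.trans_lt ENNReal.coe_lt_top⟩

theorem continuous_coord (i : Fin 3) : Continuous fun x : R3 => x i :=
  (EuclideanSpace.proj (𝕜 := ℝ) i).continuous

theorem enorm_coord_le (x : R3) (i : Fin 3) : ‖x i‖ₑ ≤ ‖x‖ₑ := by
  rw [← ofReal_norm, ← ofReal_norm]
  exact ENNReal.ofReal_le_ofReal (PiLp.norm_apply_le x i)

theorem isL2Field_coord {T : ℝ} {E : ℝ → R3 → R3} (hE : MemLinftyLp (Ico 0 T) 2 E) (i : Fin 3) :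
    IsL2Field (volume.restrict (Ico 0 T)) univ (fun t x => E t x i) := by
  obtain ⟨C, hC⟩ := hE.lintegral_sq_bound
  refine ⟨(continuous_coord i).comp_aestronglyMeasurable hE.1, C, ?_⟩
  filter_upwards [hC] with t ht _
  refine (lintegral_mono fun x => ?_).trans ht
  gcongr
  exact enorm_coord_le _ i

theorem aestronglyMeasurable_phase {ν : Measure ℝ} [SFinite ν] {f : ℝ → R3 × R3 → ℝ}
    (hf : AEStronglyMeasurable (Function.uncurry f) (ν.prod volume)) :
    AEStronglyMeasurable (fun q : (ℝ × R3) × R3 => f q.1.1 (q.1.2, q.2))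
      ((ν.prod volume).prod volume) := by
  rw [Measure.volume_eq_prod] at hf
  exact hf.comp_measurePreserving (measurePreserving_prodAssoc ν volume volume)

theorem aestronglyMeasurable_currentDensity {ν : Measure ℝ} [SFinite ν] {f : ℝ → R3 × R3 → ℝ}
    (hf : AEStronglyMeasurable (Function.uncurry f) (ν.prod volume)) :
    AEStronglyMeasurable (Function.uncurry (currentDensity f)) (ν.prod volume) := by
  refine AEStronglyMeasurable.integral_prod_right'
    (f := fun q : (ℝ × R3) × R3 => f q.1.1 (q.1.2, q.2) • velocity q.2) ?_
  exact (aestronglyMeasurable_phase hf).smul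
    (continuous_velocity.comp continuous_snd).aestronglyMeasurable

theorem enorm_currentDensity_le (f : ℝ → R3 × R3 → ℝ) (t : ℝ) (x : R3) :
    ‖currentDensity f t x‖ₑ ≤ ∫⁻ p, ‖f t (x, p)‖ₑ := by
  refine (enorm_integral_le_lintegral_enorm _).trans (lintegral_mono fun p => ?_)
  rw [enorm_smul]
  refine mul_le_of_le_one_right zero_le ?_
  rw [← ofReal_norm]
  exact ENNReal.ofReal_le_one.2 (norm_velocity_le p)

theorem lintegral_lintegral_phase {ν : Measure ℝ} [SFinite ν] {f : ℝ → R3 × R3 → ℝ}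
    (hf : AEStronglyMeasurable (Function.uncurry f) (ν.prod volume)) :
    ∀ᵐ t ∂ν, ∫⁻ x, ∫⁻ p, ‖f t (x, p)‖ₑ = ∫⁻ z, ‖f t z‖ₑ := by
  filter_upwards [hf.prodMk_left] with t ht
  rw [Measure.volume_eq_prod] at ht ⊢
  exact (lintegral_prod _ ht.enorm).symm

theorem MemLinftyLp.currentDensity {T : ℝ} {f : ℝ → R3 × R3 → ℝ}
    (hf : MemLinftyLp (Ico 0 T) 1 f) : MemLinftyLp (Ico 0 T) 1 (currentDensity f) := by
  refine ⟨aestronglyMeasurable_currentDensity hf.1, ?_⟩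
  obtain ⟨C, hC⟩ := hf.lintegral_bound
  refine ⟨C, ?_⟩
  filter_upwards [hC, lintegral_lintegral_phase hf.1] with t h1 h2
  rw [eLpNorm_one_eq_lintegral_enorm]
  exact (lintegral_mono fun x => enorm_currentDensity_le f t x).trans (h2.trans_le h1)

/-! ### Maxwell's equations tested against functions of space -/

theorem integrable_inner_of_memLp_two {X F : Type*} [MeasurableSpace X] {μ : Measure X}
    [NormedAddCommGroup F] [InnerProductSpace ℝ F] {a b : X → F} (ha : MemLp a 2 μ)
    (hb : MemLp b 2 μ) : Integrable (fun x => inner ℝ (a x) (b x)) μ := by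
  refine ((integrable_norm_sq_of_memLp_two ha).add (integrable_norm_sq_of_memLp_two hb)).mono'
    (ha.1.inner hb.1) (ae_of_all _ fun x => ?_)
  refine (norm_inner_le_norm _ _).trans ?_
  simp only [Pi.add_apply]
  nlinarith [sq_nonneg (‖a x‖ - ‖b x‖), norm_nonneg (a x), norm_nonneg (b x)]

theorem integrable_inner_of_bounded {X F : Type*} [MeasurableSpace X] {μ : Measure X}
    [NormedAddCommGroup F] [InnerProductSpace ℝ F] {a b : X → F} (ha : Integrable a μ)
    (hb : AEStronglyMeasurable b μ) {C : ℝ} (hC : ∀ x, ‖b x‖ ≤ C) :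
    Integrable (fun x => inner ℝ (a x) (b x)) μ := by
  refine (ha.norm.mul_const C).mono' (ha.1.inner hb) (ae_of_all _ fun x => ?_)
  refine (norm_inner_le_norm _ _).trans ?_
  gcongr
  exact hC x

theorem curl_apply (g : R3 → R3) (x : R3) (i : Fin 3) :
    curl g x i = partialDeriv g (i + 1) (i + 2) x - partialDeriv g (i + 2) (i + 1) x := by
  fin_cases i <;> rfl

theorem contDiff_curl {Ψ : R3 → R3} (hΨ : ContDiff ℝ ∞ Ψ) : ContDiff ℝ ∞ (curl Ψ) := by
  have hp : ∀ i j, ContDiff ℝ ∞ (partialDeriv Ψ i j) := fun i j =>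
    (EuclideanSpace.proj (𝕜 := ℝ) j).contDiff.comp
      ((hΨ.fderiv_right (m := ∞) (by simp)).clm_apply contDiff_const)
  rw [contDiff_euclidean]
  intro i
  simp only [curl_apply]
  exact (hp _ _).sub (hp _ _)

theorem hasCompactSupport_curl {Ψ : R3 → R3} (hc : HasCompactSupport Ψ) :
    HasCompactSupport (curl Ψ) := by
  refine (hc.fderiv ℝ).mono ?_
  intro x hx h0
  apply hx
  ext i
  simp [curl_apply, partialDeriv, h0]

theorem curl_const_smul {Ψ : R3 → R3} {x : R3} (hΨ : DifferentiableAt ℝ Ψ x) (c : ℝ) :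
    curl (fun y => c • Ψ y) x = c • curl Ψ x := by
  ext i
  simp only [curl_apply, partialDeriv, PiLp.smul_apply]
  rw [fderiv_fun_const_smul hΨ]
  simp [mul_sub]

section Maxwell

variable {T : ℝ} {f₀ : R3 × R3 → ℝ} {E₀ B₀ : R3 → R3} {f : ℝ → R3 × R3 → ℝ} {E B : ℝ → R3 → R3}

/-- Test functions of the form θ(t) Ψ(x) separate time from space. The field terms pair L² with L²;
the current, which is only in L¹ at general times, is paired with the bounded Ψ. -/
theorem IsWeakSolution.ampere_weakODE (hsol : IsWeakSolution T f₀ E₀ B₀ f E B)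
    {Ψ : R3 → R3} (hΨ : ContDiff ℝ ∞ Ψ) (hc : HasCompactSupport Ψ) :
    WeakODE T (fun t => ∫ x, inner ℝ (E t x) (Ψ x))
      (fun t => (∫ x, inner ℝ (B t x) (curl Ψ x))
        - 4 * Real.pi * ∫ x, inner ℝ (currentDensity f t x) (Ψ x))
      (∫ x, inner ℝ (E₀ x) (Ψ x)) := by
  intro θ hθ
  have h := hsol.ampere _ (hθ.isTest_smul hΨ hc)
  have hd := hΨ.differentiable (by simp)
  obtain ⟨C, hC⟩ := hc.exists_bound_of_continuous hΨ.continuous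
  have e0 : ∫ x, inner ℝ (E₀ x) (θ 0 • Ψ x) = θ 0 * ∫ x, inner ℝ (E₀ x) (Ψ x) := by
    simp only [inner_smul_right]
    exact integral_const_mul _ _
  simp only [e0] at h
  rw [← h]
  refine integral_congr_ae ?_
  filter_upwards [hsol.E_L2.ae_memLp, hsol.B_L2.ae_memLp, hsol.f_L1.currentDensity.ae_memLp]
    with t h1 h2 h3
  have i1 : Integrable fun x => inner ℝ (E t x) (Ψ x) :=
    integrable_inner_of_memLp_two h1 (hΨ.continuous.memLp_of_hasCompactSupport hc)
  have i2 : Integrable fun x => inner ℝ (B t x) (curl Ψ x) :=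
    integrable_inner_of_memLp_two h2
      ((contDiff_curl hΨ).continuous.memLp_of_hasCompactSupport (hasCompactSupport_curl hc))
  have i3 : Integrable fun x => inner ℝ (currentDensity f t x) (Ψ x) :=
    integrable_inner_of_bounded (memLp_one_iff_integrable.1 h3)
      hΨ.continuous.aestronglyMeasurable hC
  have e : ∀ x, inner ℝ (E t x) (fderiv ℝ (fun z : ℝ × R3 => θ z.1 • Ψ z.2) (t, x) (1, 0))
      + inner ℝ (B t x) (curl (fun y => θ t • Ψ y) x)
      - 4 * Real.pi * inner ℝ (currentDensity f t x) (θ t • Ψ x)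
      = deriv θ t * inner ℝ (E t x) (Ψ x) + θ t * (inner ℝ (B t x) (curl Ψ x)
        - 4 * Real.pi * inner ℝ (currentDensity f t x) (Ψ x)) := by
    intro x
    rw [fderiv_smul_prod (hθ.smooth.differentiable (by simp) t) (hd x), curl_const_smul (hd x)]
    simp only [map_zero, smul_zero, add_zero, one_mul, inner_smul_right]
    ring
  simp only [e]
  have i23 : Integrable fun x => inner ℝ (B t x) (curl Ψ x)
      - 4 * Real.pi * inner ℝ (currentDensity f t x) (Ψ x) := i2.sub (i3.const_mul _)
  rw [integral_add (i1.const_mul _) (i23.const_mul _), integral_const_mul, integral_const_mul,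
    integral_sub i2 (i3.const_mul _), integral_const_mul]

theorem IsWeakSolution.faraday_weakODE (hsol : IsWeakSolution T f₀ E₀ B₀ f E B)
    {Ψ : R3 → R3} (hΨ : ContDiff ℝ ∞ Ψ) (hc : HasCompactSupport Ψ) :
    WeakODE T (fun t => ∫ x, inner ℝ (B t x) (Ψ x))
      (fun t => -∫ x, inner ℝ (E t x) (curl Ψ x)) (∫ x, inner ℝ (B₀ x) (Ψ x)) := by
  intro θ hθ
  have h := hsol.faraday _ (hθ.isTest_smul hΨ hc)
  have hd := hΨ.differentiable (by simp)
  have e0 : ∫ x, inner ℝ (B₀ x) (θ 0 • Ψ x) = θ 0 * ∫ x, inner ℝ (B₀ x) (Ψ x) := by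
    simp only [inner_smul_right]
    exact integral_const_mul _ _
  simp only [e0] at h
  rw [← h]
  refine integral_congr_ae ?_
  filter_upwards [hsol.E_L2.ae_memLp, hsol.B_L2.ae_memLp] with t h1 h2
  have i1 : Integrable fun x => inner ℝ (B t x) (Ψ x) :=
    integrable_inner_of_memLp_two h2 (hΨ.continuous.memLp_of_hasCompactSupport hc)
  have i2 : Integrable fun x => inner ℝ (E t x) (curl Ψ x) :=
    integrable_inner_of_memLp_two h1
      ((contDiff_curl hΨ).continuous.memLp_of_hasCompactSupport (hasCompactSupport_curl hc))
  have e : ∀ x, inner ℝ (B t x) (fderiv ℝ (fun z : ℝ × R3 => θ z.1 • Ψ z.2) (t, x) (1, 0))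
      - inner ℝ (E t x) (curl (fun y => θ t • Ψ y) x)
      = deriv θ t * inner ℝ (B t x) (Ψ x) - θ t * inner ℝ (E t x) (curl Ψ x) := by
    intro x
    rw [fderiv_smul_prod (hθ.smooth.differentiable (by simp) t) (hd x), curl_const_smul (hd x)]
    simp only [map_zero, smul_zero, add_zero, one_mul, inner_smul_right]
  simp only [e]
  rw [integral_sub (i1.const_mul _) (i2.const_mul _), integral_const_mul, integral_const_mul]
  ring

/-- The test field `x ↦ η(y - x) eᵢ`. -/
def kernelField (η : R3 → ℝ) (y : R3) (i : Fin 3) (x : R3) : R3 :=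
  η (y - x) • EuclideanSpace.single i 1

theorem contDiff_kernelField {η : R3 → ℝ} (hη : ContDiff ℝ ∞ η) (y : R3) (i : Fin 3) :
    ContDiff ℝ ∞ (kernelField η y i) :=
  (hη.comp (contDiff_const.sub contDiff_id)).smul contDiff_const

theorem hasCompactSupport_kernelField {η : R3 → ℝ} (hc : HasCompactSupport η) (y : R3)
    (i : Fin 3) : HasCompactSupport (kernelField η y i) := by
  have h1 : HasCompactSupport fun x => η (y - x) :=
    hc.comp_homeomorph (Homeomorph.subLeft y)
  exact h1.smul_right

theorem inner_kernelField (η : R3 → ℝ) (y : R3) (i : Fin 3) (a x : R3) :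
    inner ℝ a (kernelField η y i x) = η (y - x) * a i := by
  rw [kernelField, inner_smul_right, EuclideanSpace.inner_single_right]
  simp

theorem partialDeriv_kernelField {η : R3 → ℝ} (hη : ContDiff ℝ ∞ η) (y : R3) (i k m : Fin 3)
    (x : R3) :
    partialDeriv (kernelField η y i) k m x
      = -dkernel η k (y - x) * (if m = i then 1 else 0) := by
  have h1 : HasFDerivAt (fun x => y - x) (-ContinuousLinearMap.id ℝ R3) x :=
    (hasFDerivAt_id x).const_sub y
  have h2 := ((hη.differentiable (by simp) (y - x)).hasFDerivAt.comp x h1).smul_const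
    (EuclideanSpace.single i (1 : ℝ))
  have h3 : fderiv ℝ (kernelField η y i) x = _ := h2.fderiv
  rw [partialDeriv, h3, dkernel]
  simp only [ContinuousLinearMap.smulRight_apply, ContinuousLinearMap.comp_apply,
    neg_apply, ContinuousLinearMap.id_apply, map_neg]
  split_ifs with h <;> simp [h]

/-- The sign from the reflection x ↦ y - x combines with those of the curl, so that integration in x
gives the i-th component of the curl of the mollified field. -/
theorem inner_curl_kernelField {η : R3 → ℝ} (hη : ContDiff ℝ ∞ η) (y : R3) (i : Fin 3)
    (a x : R3) :
    inner ℝ a (curl (kernelField η y i) x)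
      = dkernel η (i + 1) (y - x) * a (i + 2) - dkernel η (i + 2) (y - x) * a (i + 1) := by
  rw [PiLp.inner_apply]
  simp only [curl_apply, partialDeriv_kernelField hη, Fin.sum_univ_three, RCLike.inner_apply,
    conj_trivial]
  fin_cases i <;> simp <;> ring

/-- Mollifying the equation at `y` amounts to testing it against the reflected kernel centred at
`y`. -/
theorem IsWeakSolution.ampere_conv (hsol : IsWeakSolution T f₀ E₀ B₀ f E B)
    (η : R3 → ℝ) (hη : ContDiff ℝ ∞ η) (hc : HasCompactSupport η) (i : Fin 3) (y : R3) :
    WeakODE T (fun t => conv η (fun x => E t x i) y)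
      (fun t => conv (dkernel η (i + 1)) (fun x => B t x (i + 2)) y
        - conv (dkernel η (i + 2)) (fun x => B t x (i + 1)) y
        - conv η (fun x => 4 * Real.pi * currentDensity f t x i) y)
      (conv η (fun x => E₀ x i) y) := by
  intro θ hθ
  have h := hsol.ampere_weakODE (contDiff_kernelField hη y i)
    (hasCompactSupport_kernelField hc y i) θ hθ
  simp only [inner_kernelField, inner_curl_kernelField hη] at h
  refine Eq.trans (integral_congr_ae ?_) h
  filter_upwards [hsol.B_L2.ae_memLp] with t ht
  have hcoord : ∀ k, LocallyIntegrable fun x => B t x k := fun k =>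
    (MemLp.locallyIntegrable (p := 2) ⟨(continuous_coord k).comp_aestronglyMeasurable ht.1,
      (eLpNorm_mono_enorm fun x => enorm_coord_le _ k).trans_lt ht.2⟩ (by norm_num))
  have sd : ∀ k, ContDiff ℝ ∞ (dkernel η k) := fun k => contDiff_fderiv_apply hη _
  have cd : ∀ k, HasCompactSupport (dkernel η k) := fun k => hasCompactSupport_fderiv_apply hc _
  rw [integral_sub (integrable_conv_integrand (sd _) (cd _) (hcoord _) y)
    (integrable_conv_integrand (sd _) (cd _) (hcoord _) y)]
  have e : conv η (fun x => 4 * Real.pi * currentDensity f t x i) y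
      = 4 * Real.pi * ∫ x, η (y - x) * currentDensity f t x i := by
    rw [← integral_const_mul, conv]
    congr 1 with x
    ring
  rw [e]
  rfl

theorem IsWeakSolution.faraday_conv (hsol : IsWeakSolution T f₀ E₀ B₀ f E B)
    (η : R3 → ℝ) (hη : ContDiff ℝ ∞ η) (hc : HasCompactSupport η) (i : Fin 3) (y : R3) :
    WeakODE T (fun t => conv η (fun x => B t x i) y)
      (fun t => conv (dkernel η (i + 2)) (fun x => E t x (i + 1)) y
        - conv (dkernel η (i + 1)) (fun x => E t x (i + 2)) y)
      (conv η (fun x => B₀ x i) y) := by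
  intro θ hθ
  have h := hsol.faraday_weakODE (contDiff_kernelField hη y i)
    (hasCompactSupport_kernelField hc y i) θ hθ
  simp only [inner_kernelField, inner_curl_kernelField hη] at h
  refine Eq.trans (integral_congr_ae ?_) h
  filter_upwards [hsol.E_L2.ae_memLp] with t ht
  have hcoord : ∀ k, LocallyIntegrable fun x => E t x k := fun k =>
    (MemLp.locallyIntegrable (p := 2) ⟨(continuous_coord k).comp_aestronglyMeasurable ht.1,
      (eLpNorm_mono_enorm fun x => enorm_coord_le _ k).trans_lt ht.2⟩ (by norm_num))
  have sd : ∀ k, ContDiff ℝ ∞ (dkernel η k) := fun k => contDiff_fderiv_apply hη _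
  have cd : ∀ k, HasCompactSupport (dkernel η k) := fun k => hasCompactSupport_fderiv_apply hc _
  rw [integral_sub (integrable_conv_integrand (sd _) (cd _) (hcoord _) y)
    (integrable_conv_integrand (sd _) (cd _) (hcoord _) y), neg_sub]
  rfl

end Maxwell

/-! ### Square integrability of the density -/

/-- The charge density as a function with values in `[0, ∞]`. -/
def absDensity (f : ℝ → R3 × R3 → ℝ) (t : ℝ) (x : R3) : ℝ≥0∞ := ∫⁻ p, ‖f t (x, p)‖ₑ

theorem add_sq_le_four_mul (a b : ℝ≥0∞) : (a + b) ^ 2 ≤ 4 * (a ^ 2 + b ^ 2) := by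
  rcases le_total a b with h | h
  · calc (a + b) ^ 2 ≤ (b + b) ^ 2 := by gcongr
      _ = 4 * b ^ 2 := by ring
      _ ≤ _ := by gcongr; exact le_add_self
  · calc (a + b) ^ 2 ≤ (a + a) ^ 2 := by gcongr
      _ = 4 * a ^ 2 := by ring
      _ ≤ _ := by gcongr; exact le_self_add

/-- A bound of the density by the sup norm of the distribution function, for small momenta, and
the moment, for large momenta. -/
theorem lintegral_absDensity_sq_le {l : ℝ} (hl : 0 < l) {g : R3 × R3 → ℝ} {M : ℝ≥0}
    (hm : AEStronglyMeasurable g) (hpos : ∀ᵐ z, 0 ≤ g z) (hM : ∀ᵐ z, ‖g z‖ₑ ≤ M) :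
    ∫⁻ x, (∫⁻ p, ‖g (x, p)‖ₑ) ^ 2
      ≤ 4 * ((M * volume (Metric.closedBall (0 : R3) 1)) * (∫⁻ z, ‖g z‖ₑ)
        + ∫⁻ x, (∫⁻ p, ENNReal.ofReal (‖p‖ ^ l * g (x, p))) ^ 2) := by
  set V := volume (Metric.closedBall (0 : R3) 1) with hV
  rw [Measure.volume_eq_prod] at hm hpos hM
  have hmx := hm.prodMk_left
  have hposx := Measure.ae_ae_of_ae_prod hpos
  have hMx := Measure.ae_ae_of_ae_prod hM
  have e1 : ∫⁻ z, ‖g z‖ₑ = ∫⁻ x, ∫⁻ p, ‖g (x, p)‖ₑ := by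
    rw [Measure.volume_eq_prod]
    exact lintegral_prod _ hm.enorm
  have hA : AEMeasurable (fun x : R3 => ∫⁻ p, ‖g (x, p)‖ₑ) volume :=
    hm.enorm.lintegral_prod_right'
  rw [e1, ← lintegral_const_mul'' _ hA, ← lintegral_add_left' (hA.const_mul _),
    ← lintegral_const_mul' _ _ (by simp)]
  refine lintegral_mono_ae ?_
  filter_upwards [hmx, hposx, hMx] with x h1 h2 h3
  -- Momentum space is split at |p| = 1; outside the unit ball the weight |p|^l is at least 1.
  have hsplit : ∫⁻ p, ‖g (x, p)‖ₑ
      ≤ (∫⁻ p in Metric.closedBall (0 : R3) 1, ‖g (x, p)‖ₑ)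
        + ∫⁻ p, ENNReal.ofReal (‖p‖ ^ l * g (x, p)) := by
    rw [← lintegral_add_compl _ (Metric.isClosed_closedBall (x := (0 : R3)) (ε := 1)).measurableSet]
    refine add_le_add le_rfl ?_
    refine le_trans ?_ (setLIntegral_le_lintegral (Metric.closedBall (0 : R3) 1)ᶜ _)
    refine lintegral_mono_ae ?_
    filter_upwards [ae_restrict_of_ae h2,
      ae_restrict_mem (Metric.isClosed_closedBall (x := (0 : R3)) (ε := 1)).measurableSet.compl]
      with p hp hp'
    rw [Real.enorm_eq_ofReal hp]
    refine ENNReal.ofReal_le_ofReal (le_mul_of_one_le_left hp ?_)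
    refine Real.one_le_rpow ?_ hl.le
    simpa using (not_le.1 (by simpa using hp')).le
  have hball : ∫⁻ p in Metric.closedBall (0 : R3) 1, ‖g (x, p)‖ₑ ≤ M * V := by
    calc ∫⁻ p in Metric.closedBall (0 : R3) 1, ‖g (x, p)‖ₑ
        ≤ ∫⁻ p in Metric.closedBall (0 : R3) 1, (M : ℝ≥0∞) := lintegral_mono_ae (ae_restrict_of_ae h3)
      _ = M * V := by rw [setLIntegral_const]
  refine (pow_le_pow_left' hsplit 2).trans ((add_sq_le_four_mul _ _).trans ?_)
  gcongr
  -- Of the two factors in the square of the small-momentum part, one is bounded by `M * V` and the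
  -- other by the full density, which is integrable in x.
  rw [sq]
  gcongr
  exact Measure.restrict_le_self

section Solution

variable {T : ℝ} {f₀ : R3 × R3 → ℝ} {E₀ B₀ : R3 → R3} {f : ℝ → R3 × R3 → ℝ} {E B : ℝ → R3 → R3}

theorem MemLinftyLp.ae_enorm_le {X : Type*} [MeasureSpace X] {I : Set ℝ} {u : ℝ → X → ℝ}
    (hu : MemLinftyLp I ⊤ u) :
    ∃ M : ℝ≥0, ∀ᵐ t ∂(volume.restrict I), ∀ᵐ x, ‖u t x‖ₑ ≤ M := by
  obtain ⟨M, hM⟩ := hu.2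
  refine ⟨M, ?_⟩
  filter_upwards [hM] with t ht
  rw [eLpNorm_exponent_top] at ht
  filter_upwards [enorm_ae_le_eLpNormEssSup (u t) volume] with x hx using hx.trans ht

/-- The bounds on f in L¹ and L^∞ are uniform in time, so only the moment decides at which times the
density is controlled in L². -/
theorem IsWeakSolution.absDensity_bound (hsol : IsWeakSolution T f₀ E₀ B₀ f E B) {l : ℝ}
    (hl : 0 < l) {S : Set ℝ} {C : ℝ≥0}
    (hS : ∀ᵐ t ∂(volume.restrict (Ico 0 T)), t ∈ S → ∫⁻ x, moment l f t x ^ 2 ≤ C) :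
    ∃ D : ℝ≥0, ∀ᵐ t ∂(volume.restrict (Ico 0 T)), t ∈ S → ∫⁻ x, absDensity f t x ^ 2 ≤ D := by
  obtain ⟨M, hM⟩ := hsol.f_Linfty.ae_enorm_le
  obtain ⟨C₁, hC₁⟩ := hsol.f_L1.lintegral_bound
  set V := volume (Metric.closedBall (0 : R3) 1) with hV
  have hVtop : V ≠ ⊤ := (isCompact_closedBall _ _).measure_lt_top.ne
  refine ⟨4 * ((M * V.toNNReal) * C₁ + C), ?_⟩
  filter_upwards [hS, hM, hC₁, hsol.f_nonneg, hsol.f_L1.1.prodMk_left] with t h1 h2 h3 h4 h5 ht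
  refine (lintegral_absDensity_sq_le hl h5 h4 h2).trans ?_
  push_cast
  rw [ENNReal.coe_toNNReal hVtop]
  gcongr
  · exact h3
  · exact h1 ht

theorem IsWeakSolution.isL2Field_current (hsol : IsWeakSolution T f₀ E₀ B₀ f E B)
    {S : Set ℝ} {D : ℝ≥0}
    (hS : ∀ᵐ t ∂(volume.restrict (Ico 0 T)), t ∈ S → ∫⁻ x, absDensity f t x ^ 2 ≤ D)
    (i : Fin 3) :
    IsL2Field (volume.restrict (Ico 0 T)) S
      (fun t x => 4 * Real.pi * currentDensity f t x i) := by
  refine ⟨((continuous_coord i).comp_aestronglyMeasurable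
    (aestronglyMeasurable_currentDensity hsol.f_L1.1)).const_mul _,
    ‖4 * Real.pi‖₊ ^ 2 * D, ?_⟩
  filter_upwards [hS] with t ht hts
  have : ∀ x, ‖4 * Real.pi * currentDensity f t x i‖ₑ ^ 2
      ≤ ‖4 * Real.pi‖ₑ ^ 2 * absDensity f t x ^ 2 := fun x => by
    rw [enorm_mul, mul_pow]
    gcongr
    exact (enorm_coord_le _ i).trans (enorm_currentDensity_le f t x)
  refine (lintegral_mono this).trans ?_
  rw [lintegral_const_mul' _ _ (ENNReal.pow_ne_top enorm_ne_top), ENNReal.coe_mul,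
    ENNReal.coe_pow]
  exact mul_le_mul_right (ht hts) _

/-- The balance of the electromagnetic energy. -/
theorem IsWeakSolution.field_energy (hsol : IsWeakSolution T f₀ E₀ B₀ f E B) (hT : 0 < T)
    (hE₀ : MemLp E₀ 2) (hB₀ : MemLp B₀ 2) {θ : ℝ → ℝ} (hθ : IsTimeTest T θ) {D : ℝ≥0}
    (hD : ∀ᵐ t ∂(volume.restrict (Ico 0 T)), t ∈ Function.support θ →
      ∫⁻ x, absDensity f t x ^ 2 ≤ D) :
    ∫ t in Ico 0 T, (deriv θ t * (∫ x, (‖E t x‖ ^ 2 + ‖B t x‖ ^ 2))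
        - 8 * Real.pi * (θ t * ∫ x, inner ℝ (currentDensity f t x) (E t x)))
      = -(θ 0 * ∫ x, (‖E₀ x‖ ^ 2 + ‖B₀ x‖ ^ 2)) := by
  have hcoord : ∀ {e : R3 → R3}, MemLp e 2 → ∀ i, MemLp (fun x => e x i) 2 := fun he i =>
    ⟨(continuous_coord i).comp_aestronglyMeasurable he.1,
      (eLpNorm_mono_enorm fun x => enorm_coord_le _ i).trans_lt he.2⟩
  have hsum : ∀ {e b : R3 → R3}, MemLp e 2 → MemLp b 2 →
      ∫ x, (‖e x‖ ^ 2 + ‖b x‖ ^ 2)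
        = ∑ i, ((∫ x, ‖e x i‖ ^ 2) + ∫ x, ‖b x i‖ ^ 2) := by
    intro e b he hb
    have hi : ∀ {e : R3 → R3}, MemLp e 2 → ∀ i, Integrable fun x => ‖e x i‖ ^ 2 := fun he i =>
      integrable_norm_sq_of_memLp_two (hcoord he i)
    rw [Finset.sum_add_distrib, ← integral_finsetSum _ fun i _ => hi he i,
      ← integral_finsetSum _ fun i _ => hi hb i,
      ← integral_add (integrable_finsetSum _ fun i _ => hi he i)
        (integrable_finsetSum _ fun i _ => hi hb i)]
    simp only [EuclideanSpace.norm_sq_eq]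
  have hJ := hsol.isL2Field_current hD
  have h := integral_maxwell_energy hT hθ
    (E := fun i t x => E t x i) (B := fun i t x => B t x i)
    (J := fun i t x => 4 * Real.pi * currentDensity f t x i)
    (E₀ := fun i x => E₀ x i) (B₀ := fun i x => B₀ x i)
    (isL2Field_coord hsol.E_L2) (isL2Field_coord hsol.B_L2) hJ ?_ (hcoord hE₀) (hcoord hB₀)
    hsol.ampere_conv hsol.faraday_conv
  · rw [hsum hE₀ hB₀, ← h]
    refine integral_congr_ae ?_
    filter_upwards [hsol.E_L2.ae_memLp, hsol.B_L2.ae_memLp,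
      ae_all_iff.2 fun i => (hJ i).ae_memLp] with t h1 h2 h3
    rw [hsum h1 h2]
    by_cases hθt : θ t = 0
    · simp [hθt]
    · have e : ∫ x, inner ℝ (currentDensity f t x) (E t x)
          = (4 * Real.pi)⁻¹ * ∑ i, ∫ x, E t x i * (4 * Real.pi * currentDensity f t x i) := by
        rw [← integral_finsetSum _ fun i _ =>
          integrable_mul_of_memLp_two (hcoord h1 i) (h3 i hθt), ← integral_const_mul]
        congr 1 with x
        rw [PiLp.inner_apply, Finset.mul_sum]
        refine Finset.sum_congr rfl fun i _ => ?_
        have := Real.pi_ne_zero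
        simp only [RCLike.inner_apply, conj_trivial]
        field_simp
      rw [e]
      have := Real.pi_ne_zero
      field_simp
      ring
  · intro i
    obtain ⟨C, hC⟩ := hsol.f_L1.currentDensity.lintegral_bound
    refine ⟨‖4 * Real.pi‖₊ * C, ?_⟩
    filter_upwards [hC] with t ht
    have : ∀ x, ‖4 * Real.pi * currentDensity f t x i‖ₑ
        ≤ ‖4 * Real.pi‖ₑ * ‖currentDensity f t x‖ₑ := fun x => by
      rw [enorm_mul]
      gcongr
      exact enorm_coord_le _ i
    refine (lintegral_mono this).trans ?_
    rw [lintegral_const_mul' _ _ enorm_ne_top, ENNReal.coe_mul]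
    exact mul_le_mul_right ht _

end Solution

/-! ### The Lorentz force -/

theorem norm_cross_le (a b : R3) : ‖cross a b‖ ≤ ‖a‖ * ‖b‖ := by
  refine le_of_sq_le_sq ?_ (by positivity)
  rw [mul_pow, EuclideanSpace.norm_sq_eq, EuclideanSpace.norm_sq_eq, EuclideanSpace.norm_sq_eq]
  simp only [Fin.sum_univ_three, Real.norm_eq_abs, sq_abs, cross, cross_apply]
  simp only [Fin.isValue, Matrix.cons_val_zero, Matrix.cons_val_one, Matrix.cons_val]
  -- Lagrange's identity |a|²|b|² - |a × b|² = (a·b)².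
  nlinarith [sq_nonneg (a 0 * b 0 + a 1 * b 1 + a 2 * b 2)]

theorem inner_self_cross (a b : R3) : inner ℝ a (cross a b) = 0 := by
  rw [PiLp.inner_apply]
  simp only [Fin.sum_univ_three, RCLike.inner_apply, conj_trivial, cross, cross_apply]
  simp only [Fin.isValue, Matrix.cons_val_zero, Matrix.cons_val_one, Matrix.cons_val]
  ring

theorem continuous_cross : Continuous fun q : R3 × R3 => cross q.1 q.2 := by
  have hc : ∀ i : Fin 3, Continuous fun q : R3 × R3 => q.1 i := fun i =>
    (continuous_coord i).comp continuous_fst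
  have hd : ∀ i : Fin 3, Continuous fun q : R3 × R3 => q.2 i := fun i =>
    (continuous_coord i).comp continuous_snd
  refine (PiLp.continuous_toLp 2 _).comp (continuous_pi fun i => ?_)
  simp only [cross_apply]
  fin_cases i <;> simp <;> fun_prop

theorem norm_lorentz_le (e b p : R3) : ‖lorentz e b p‖ ≤ ‖e‖ + ‖b‖ := by
  refine (norm_add_le _ _).trans (add_le_add le_rfl ((norm_cross_le _ _).trans ?_))
  exact mul_le_of_le_one_left (norm_nonneg _) (norm_velocity_le p)

/-- The magnetic part v × B is orthogonal to v, hence does no work. -/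
theorem inner_velocity_lorentz (e b p : R3) :
    inner ℝ (velocity p) (lorentz e b p) = inner ℝ (velocity p) e := by
  rw [lorentz, inner_add_right, inner_self_cross, add_zero]

theorem fderiv_kin (p b : R3) : fderiv ℝ kin p b = inner ℝ (velocity p) b := by
  have h1 : HasFDerivAt (fun p : R3 => 1 + ‖p‖ ^ 2) (2 • innerSL ℝ p) p :=
    (hasStrictFDerivAt_norm_sq p).hasFDerivAt.const_add 1
  have h2 := h1.sqrt (by positivity)
  have h3 : fderiv ℝ kin p = _ := h2.fderiv
  rw [h3, velocity, inner_smul_left, kin]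
  simp
  ring

/-- The phase space velocity `(v, K)` of the characteristics. -/
def drift (E B : ℝ → R3 → R3) (t : ℝ) (z : R3 × R3) : R3 × R3 :=
  (velocity z.2, lorentz (E t z.1) (B t z.1) z.2)

theorem aestronglyMeasurable_comp_position {F : Type*} [TopologicalSpace F] {ν : Measure ℝ}
    [SFinite ν] {u : ℝ → R3 → F}
    (hu : AEStronglyMeasurable (Function.uncurry u) (ν.prod volume)) :
    AEStronglyMeasurable (fun q : ℝ × (R3 × R3) => u q.1 q.2.1) (ν.prod volume) := by
  have h1 : AEStronglyMeasurable (fun q : (ℝ × R3) × R3 => Function.uncurry u q.1)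
      ((ν.prod volume).prod volume) := hu.comp_fst
  have h2 := (measurePreserving_prodAssoc ν (volume : Measure R3) (volume : Measure R3)).symm
  exact h1.comp_measurePreserving h2

theorem aestronglyMeasurable_drift {ν : Measure ℝ} [SFinite ν] {E B : ℝ → R3 → R3}
    (hE : AEStronglyMeasurable (Function.uncurry E) (ν.prod volume))
    (hB : AEStronglyMeasurable (Function.uncurry B) (ν.prod volume)) :
    AEStronglyMeasurable (fun q : ℝ × (R3 × R3) => drift E B q.1 q.2) (ν.prod volume) := by
  have hv : AEStronglyMeasurable (fun q : ℝ × (R3 × R3) => velocity q.2.2) (ν.prod volume) :=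
    (continuous_velocity.comp (continuous_snd.comp continuous_snd)).aestronglyMeasurable
  have hEp := aestronglyMeasurable_comp_position hE
  have hBp := aestronglyMeasurable_comp_position hB
  have hK : AEStronglyMeasurable (fun q : ℝ × (R3 × R3) => cross (velocity q.2.2) (B q.1 q.2.1))
      (ν.prod volume) :=
    Continuous.comp_aestronglyMeasurable (g := fun q : R3 × R3 => cross q.1 q.2)
      (f := fun q : ℝ × (R3 × R3) => (velocity q.2.2, B q.1 q.2.1)) continuous_cross
      (hv.prodMk hBp)
  have hL : AEStronglyMeasurable
      (fun q : ℝ × (R3 × R3) => E q.1 q.2.1 + cross (velocity q.2.2) (B q.1 q.2.1))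
      (ν.prod volume) := hEp.add hK
  simp only [drift, lorentz]
  exact hv.prodMk hL

theorem norm_drift_le (E B : ℝ → R3 → R3) (t : ℝ) (z : R3 × R3) :
    ‖drift E B t z‖ ≤ 1 + ‖E t z.1‖ + ‖B t z.1‖ := by
  have h1 := norm_velocity_le z.2
  have h2 := norm_lorentz_le (E t z.1) (B t z.1) z.2
  refine max_le ?_ ?_
  · exact h1.trans (by linarith [norm_nonneg (E t z.1), norm_nonneg (B t z.1)])
  · exact h2.trans (by linarith)

theorem enorm_le_one_add_sq {F : Type*} [NormedAddCommGroup F] (a : F) : ‖a‖ₑ ≤ 1 + ‖a‖ₑ ^ 2 := by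
  rcases le_total ‖a‖ₑ 1 with h | h
  · exact h.trans le_self_add
  · exact (le_self_pow h two_ne_zero).trans le_add_self

/-! ### The Vlasov equation tested against functions of phase space -/

section Vlasov

variable {T : ℝ} {f₀ : R3 × R3 → ℝ} {E₀ B₀ : R3 → R3} {f : ℝ → R3 × R3 → ℝ} {E B : ℝ → R3 → R3}

theorem IsWeakSolution.aestronglyMeasurable_fderiv_drift
    (hsol : IsWeakSolution T f₀ E₀ B₀ f E B) {Φ : R3 × R3 → ℝ} (hΦ : ContDiff ℝ ∞ Φ) :
    AEStronglyMeasurable (fun q : ℝ × (R3 × R3) => f q.1 q.2 * fderiv ℝ Φ q.2 (drift E B q.1 q.2))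
      ((volume.restrict (Ico 0 T)).prod volume) := by
  refine hsol.f_L1.1.mul ?_
  have h1 : AEStronglyMeasurable (fun q : ℝ × (R3 × R3) => fderiv ℝ Φ q.2)
      ((volume.restrict (Ico 0 T)).prod volume) :=
    ((hΦ.continuous_fderiv (by simp)).comp continuous_snd).aestronglyMeasurable
  have h2 : Continuous fun q : (R3 × R3 →L[ℝ] ℝ) × (R3 × R3) => q.1 q.2 :=
    isBoundedBilinearMap_apply.continuous
  exact h2.comp_aestronglyMeasurable
    (h1.prodMk (aestronglyMeasurable_drift hsol.E_L2.1 hsol.B_L2.1))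

/-- On the compact support of Φ it is enough that f is bounded and the fields are in L²; no
integrability of the density is involved. -/
theorem IsWeakSolution.integrable_fderiv_drift (hsol : IsWeakSolution T f₀ E₀ B₀ f E B)
    {Φ : R3 × R3 → ℝ} (hΦ : ContDiff ℝ ∞ Φ) (hc : HasCompactSupport Φ) :
    Integrable (fun q : ℝ × (R3 × R3) => f q.1 q.2 * fderiv ℝ Φ q.2 (drift E B q.1 q.2))
      ((volume.restrict (Ico 0 T)).prod volume) := by
  have hm := hsol.aestronglyMeasurable_fderiv_drift hΦ
  refine ⟨hm, ?_⟩
  obtain ⟨M, hM⟩ := hsol.f_Linfty.ae_enorm_le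
  obtain ⟨CE, hCE⟩ := hsol.E_L2.lintegral_sq_bound
  obtain ⟨CB, hCB⟩ := hsol.B_L2.lintegral_sq_bound
  have hΦ' : Continuous (fderiv ℝ Φ) := hΦ.continuous_fderiv (by simp)
  obtain ⟨C, hC⟩ := (hc.fderiv ℝ).exists_bound_of_continuous hΦ'
  obtain ⟨R, hR⟩ := (hc.fderiv ℝ).isCompact.isBounded.subset_closedBall 0
  set K : Set R3 := Metric.closedBall 0 R with hK
  have hKm : MeasurableSet K := Metric.isClosed_closedBall.measurableSet
  have hKtop : volume K ≠ ⊤ := (isCompact_closedBall _ _).measure_lt_top.ne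
  -- A product of balls, since the norm on the product space is the maximum norm; this permits
  -- Tonelli in x and p separately.
  have hKK : tsupport (fderiv ℝ Φ) ⊆ K ×ˢ K := by
    refine hR.trans ?_
    rw [hK, closedBall_prod_same]
    rfl
  have hbound : ∀ᵐ t ∂(volume.restrict (Ico 0 T)),
      ∫⁻ z, ‖f t z * fderiv ℝ Φ z (drift E B t z)‖ₑ
        ≤ M * C.toNNReal * (volume K * (3 * volume K + CE + CB)) := by
    filter_upwards [hM, hCE, hCB, hsol.E_L2.1.prodMk_left, hsol.B_L2.1.prodMk_left]
      with t h1 h2 h3 m2 m3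
    have mE : AEMeasurable (fun x => ‖E t x‖ₑ ^ 2) volume := m2.enorm.pow_const 2
    have mB : AEMeasurable (fun x => ‖B t x‖ₑ ^ 2) volume := m3.enorm.pow_const 2
    calc ∫⁻ z, ‖f t z * fderiv ℝ Φ z (drift E B t z)‖ₑ
        ≤ ∫⁻ z, (K ×ˢ K).indicator
            (fun z => M * C.toNNReal * (3 + ‖E t z.1‖ₑ ^ 2 + ‖B t z.1‖ₑ ^ 2)) z := by
          refine lintegral_mono_ae ?_
          filter_upwards [h1] with z hz
          by_cases hzK : z ∈ K ×ˢ K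
          · rw [indicator_of_mem hzK, enorm_mul, mul_assoc]
            refine mul_le_mul' hz ?_
            refine (ContinuousLinearMap.le_opENorm _ _).trans (mul_le_mul' ?_ ?_)
            · rw [← ofReal_norm]
              exact ENNReal.ofReal_le_ofReal (hC z)
            · have h4 : ‖drift E B t z‖ₑ ≤ 1 + ‖E t z.1‖ₑ + ‖B t z.1‖ₑ := by
                rw [← ofReal_norm, ← ofReal_norm, ← ofReal_norm, ← ENNReal.ofReal_one,
                  ← ENNReal.ofReal_add zero_le_one (norm_nonneg _),
                  ← ENNReal.ofReal_add (by positivity) (norm_nonneg _)]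
                exact ENNReal.ofReal_le_ofReal (norm_drift_le E B t z)
              refine h4.trans ?_
              calc 1 + ‖E t z.1‖ₑ + ‖B t z.1‖ₑ
                  ≤ 1 + (1 + ‖E t z.1‖ₑ ^ 2) + (1 + ‖B t z.1‖ₑ ^ 2) := by
                    gcongr <;> exact enorm_le_one_add_sq _
                _ = _ := by ring
          · rw [indicator_of_notMem hzK,
              image_eq_zero_of_notMem_tsupport (fun h => hzK (hKK h))]
            simp
      _ = ∫⁻ x in K, ∫⁻ p in K, M * C.toNNReal * (3 + ‖E t x‖ₑ ^ 2 + ‖B t x‖ₑ ^ 2) := by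
          rw [lintegral_indicator (hKm.prod hKm), Measure.volume_eq_prod, ← Measure.prod_restrict]
          refine lintegral_prod _ ?_
          have hfst : ∀ {h : R3 → ℝ≥0∞}, AEMeasurable h volume → AEMeasurable
              (fun z : R3 × R3 => h z.1) ((volume.restrict K).prod (volume.restrict K)) :=
            fun hh => hh.restrict.comp_quasiMeasurePreserving Measure.quasiMeasurePreserving_fst
          exact hfst (((mE.const_add 3).add mB).const_mul _)
      _ = M * C.toNNReal * (volume K
            * ∫⁻ x in K, (3 + ‖E t x‖ₑ ^ 2 + ‖B t x‖ₑ ^ 2)) := by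
          simp only [lintegral_const, Measure.restrict_apply_univ]
          rw [lintegral_mul_const' _ _ hKtop,
            lintegral_const_mul' _ _ (ENNReal.mul_ne_top (by simp) (by simp))]
          ring
      _ ≤ _ := by
          gcongr
          rw [lintegral_add_right' _ mB.restrict,
            lintegral_add_left' aemeasurable_const, setLIntegral_const]
          gcongr
          · exact (setLIntegral_le_lintegral _ _).trans h2
          · exact (setLIntegral_le_lintegral _ _).trans h3
  rw [HasFiniteIntegral, lintegral_prod _ hm.enorm]
  refine (lintegral_mono_ae hbound).trans_lt ?_
  rw [lintegral_const]
  refine ENNReal.mul_lt_top (ENNReal.mul_lt_top (ENNReal.mul_lt_top (by simp) (by simp))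
    (ENNReal.mul_lt_top hKtop.lt_top ?_)) (measure_lt_top _ _)
  exact ENNReal.add_lt_top.2 ⟨ENNReal.add_lt_top.2
    ⟨ENNReal.mul_lt_top (by simp) hKtop.lt_top, by simp⟩, by simp⟩

theorem IsWeakSolution.vlasov_weakODE (hsol : IsWeakSolution T f₀ E₀ B₀ f E B)
    {Φ : R3 × R3 → ℝ} (hΦ : ContDiff ℝ ∞ Φ) (hc : HasCompactSupport Φ) :
    WeakODE T (fun t => ∫ z, f t z * Φ z)
      (fun t => ∫ z, f t z * fderiv ℝ Φ z (drift E B t z)) (∫ z, f₀ z * Φ z) := by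
  intro θ hθ
  have h := hsol.vlasov _ (hθ.isTest_smul hΦ hc)
  obtain ⟨C, hC⟩ := hc.exists_bound_of_continuous hΦ.continuous
  have e0 : ∫ z, f₀ z * (θ 0 • Φ z) = θ 0 * ∫ z, f₀ z * Φ z := by
    rw [← integral_const_mul]
    congr 1 with z
    rw [smul_eq_mul]; ring
  simp only [e0] at h
  rw [← h]
  refine integral_congr_ae ?_
  filter_upwards [hsol.f_L1.ae_memLp, (hsol.integrable_fderiv_drift hΦ hc).prod_right_ae]
    with t h1 i2
  have i1 : Integrable fun z => f t z * Φ z :=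
    (memLp_one_iff_integrable.1 h1).mul_bdd hΦ.continuous.aestronglyMeasurable (ae_of_all _ hC)
  have e : ∀ z, f t z * fderiv ℝ (fun q : ℝ × (R3 × R3) => θ q.1 • Φ q.2) (t, z)
      (1, (velocity z.2, lorentz (E t z.1) (B t z.1) z.2))
      = deriv θ t * (f t z * Φ z) + θ t * (f t z * fderiv ℝ Φ z (drift E B t z)) := by
    intro z
    rw [fderiv_smul_prod (hθ.smooth.differentiable (by simp) t)
      (hΦ.differentiable (by simp) z), drift]
    simp only [one_mul, smul_eq_mul]
    ring
  simp only [e]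
  rw [integral_add (i1.const_mul _) (i2.const_mul _), integral_const_mul, integral_const_mul]

end Vlasov

/-! ### Truncations of the kinetic energy -/

/-- A bump function equal to one on the unit ball. -/
def unitBump : ContDiffBump (0 : R3) := ⟨1, 2, one_pos, one_lt_two⟩

/-- A cutoff equal to one on the ball of radius `n + 1`, supported in the ball of twice this
radius. -/
def cutoff (n : ℕ) (x : R3) : ℝ := unitBump (((n : ℝ) + 1)⁻¹ • x)

theorem contDiff_cutoff (n : ℕ) : ContDiff ℝ ∞ (cutoff n) :=
  unitBump.contDiff.comp (contDiff_const_smul _)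

theorem cutoff_nonneg (n : ℕ) (x : R3) : 0 ≤ cutoff n x := unitBump.nonneg

theorem cutoff_le_one (n : ℕ) (x : R3) : cutoff n x ≤ 1 := unitBump.le_one

theorem cutoff_eq_one {n : ℕ} {x : R3} (h : ‖x‖ ≤ n + 1) : cutoff n x = 1 := by
  refine unitBump.one_of_mem_closedBall ?_
  rw [mem_closedBall_zero_iff, norm_smul, norm_inv, Real.norm_of_nonneg (by positivity)]
  exact inv_mul_le_one_of_le₀ h (by positivity)

theorem cutoff_eq_zero {n : ℕ} {x : R3} (h : 2 * ((n : ℝ) + 1) ≤ ‖x‖) : cutoff n x = 0 := by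
  refine unitBump.zero_of_le_dist ?_
  rw [dist_zero_right, norm_smul, norm_inv, Real.norm_of_nonneg (by positivity), inv_mul_eq_div,
    le_div_iff₀ (by positivity)]
  exact h

/-- Scaling: the gradient of the dilated bump gains the inverse of the radius. This gain is what
offsets the growth of the kinetic energy. -/
theorem exists_fderiv_cutoff_bound :
    ∃ C : ℝ, 0 ≤ C ∧ ∀ (n : ℕ) (x v : R3),
      |fderiv ℝ (cutoff n) x v| ≤ C * ((n : ℝ) + 1)⁻¹ * ‖v‖ := by
  obtain ⟨C, hC⟩ := (unitBump.hasCompactSupport.fderiv ℝ).exists_bound_of_continuous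
    (unitBump.contDiff.continuous_fderiv (n := ∞) (by simp))
  refine ⟨C, (norm_nonneg _).trans (hC 0), fun n x v => ?_⟩
  have h1 : HasFDerivAt (fun x : R3 => ((n : ℝ) + 1)⁻¹ • x)
      (((n : ℝ) + 1)⁻¹ • ContinuousLinearMap.id ℝ R3) x :=
    (((n : ℝ) + 1)⁻¹ • ContinuousLinearMap.id ℝ R3).hasFDerivAt
  have h2 := (unitBump.contDiff (n := 1)).differentiable (by simp) (((n : ℝ) + 1)⁻¹ • x)
  have h3 : fderiv ℝ (cutoff n) x = _ := (h2.hasFDerivAt.comp x h1).fderiv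
  rw [h3]
  simp only [ContinuousLinearMap.comp_apply, smul_apply,
    ContinuousLinearMap.id_apply, map_smul, smul_eq_mul, abs_mul]
  rw [abs_of_nonneg (by positivity : (0 : ℝ) ≤ ((n : ℝ) + 1)⁻¹)]
  have := (ContinuousLinearMap.le_opNorm (fderiv ℝ unitBump (((n : ℝ) + 1)⁻¹ • x)) v).trans
    (mul_le_mul_of_nonneg_right (hC _) (norm_nonneg v))
  rw [Real.norm_eq_abs] at this
  calc _ ≤ ((n : ℝ) + 1)⁻¹ * (C * ‖v‖) := by gcongr
    _ = _ := by ring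

theorem fderiv_cutoff_eq_zero {n : ℕ} {x : R3} (h : 2 * ((n : ℝ) + 1) < ‖x‖) :
    fderiv ℝ (cutoff n) x = 0 := by
  have : cutoff n =ᶠ[𝓝 x] fun _ => 0 := by
    filter_upwards [continuous_norm.continuousAt.eventually (lt_mem_nhds h)] with y hy
    exact cutoff_eq_zero (le_of_lt hy)
  rw [this.fderiv_eq]
  simp

/-- The kinetic energy, cut off in position and momentum. -/
def kinTest (n : ℕ) (z : R3 × R3) : ℝ := cutoff n z.1 * (cutoff n z.2 * kin z.2)

theorem contDiff_kinTest (n : ℕ) : ContDiff ℝ ∞ (kinTest n) :=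
  ((contDiff_cutoff n).comp contDiff_fst).mul
    (((contDiff_cutoff n).comp contDiff_snd).mul (contDiff_kin.comp contDiff_snd))

theorem hasCompactSupport_kinTest (n : ℕ) : HasCompactSupport (kinTest n) := by
  refine HasCompactSupport.intro
    ((isCompact_closedBall (0 : R3) (2 * ((n : ℝ) + 1))).prod
      (isCompact_closedBall (0 : R3) (2 * ((n : ℝ) + 1)))) fun z hz => ?_
  rw [mem_prod, not_and_or, mem_closedBall_zero_iff, mem_closedBall_zero_iff, not_le, not_le] at hz
  rcases hz with h | h
  · rw [kinTest, cutoff_eq_zero h.le, zero_mul]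
  · rw [kinTest, cutoff_eq_zero h.le, zero_mul, mul_zero]

theorem kinTest_nonneg (n : ℕ) (z : R3 × R3) : 0 ≤ kinTest n z :=
  mul_nonneg (cutoff_nonneg n _) (mul_nonneg (cutoff_nonneg n _) (kin_pos _).le)

theorem kinTest_le (n : ℕ) (z : R3 × R3) : kinTest n z ≤ kin z.2 := by
  refine (mul_le_of_le_one_left ?_ (cutoff_le_one n _)).trans
    (mul_le_of_le_one_left (kin_pos _).le (cutoff_le_one n _))
  exact mul_nonneg (cutoff_nonneg n _) (kin_pos _).le

/-- Agreement on a neighbourhood, not only at the point, so that the derivatives agree as well once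
`n` is large. -/
theorem kinTest_eventuallyEq {n : ℕ} {z : R3 × R3} (h : ‖z‖ < n + 1) :
    kinTest n =ᶠ[𝓝 z] fun w => kin w.2 := by
  filter_upwards [continuous_norm.continuousAt.eventually (gt_mem_nhds h)] with w hw
  rw [kinTest, cutoff_eq_one ((norm_fst_le w).trans (le_of_lt hw)),
    cutoff_eq_one ((norm_snd_le w).trans (le_of_lt hw)), one_mul, one_mul]

theorem eventually_norm_lt_nat {F : Type*} [NormedAddCommGroup F] (z : F) :
    ∀ᶠ n : ℕ in atTop, ‖z‖ < n + 1 := by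
  filter_upwards [eventually_ge_atTop ⌈‖z‖⌉₊] with n hn
  have h1 : ‖z‖ ≤ n := (Nat.le_ceil _).trans (by exact_mod_cast hn)
  linarith

theorem tendsto_kinTest (z : R3 × R3) :
    Tendsto (fun n => kinTest n z) atTop (𝓝 (kin z.2)) := by
  refine tendsto_const_nhds.congr' ?_
  filter_upwards [eventually_norm_lt_nat z] with n hn
  exact (kinTest_eventuallyEq hn).eq_of_nhds.symm

theorem fderiv_kin_snd (z w : R3 × R3) :
    fderiv ℝ (fun w : R3 × R3 => kin w.2) z w = inner ℝ (velocity z.2) w.2 := by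
  have h1 : HasFDerivAt (fun w : R3 × R3 => kin w.2)
      ((fderiv ℝ kin z.2).comp (ContinuousLinearMap.snd ℝ R3 R3)) z :=
    HasFDerivAt.comp z (contDiff_kin.differentiable (by simp) z.2).hasFDerivAt hasFDerivAt_snd
  rw [h1.fderiv]
  simp [fderiv_kin]

theorem tendsto_fderiv_kinTest (E B : ℝ → R3 → R3) (t : ℝ) (z : R3 × R3) :
    Tendsto (fun n => fderiv ℝ (kinTest n) z (drift E B t z)) atTop
      (𝓝 (inner ℝ (velocity z.2) (E t z.1))) := by
  refine tendsto_const_nhds.congr' ?_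
  filter_upwards [eventually_norm_lt_nat z] with n hn
  rw [(kinTest_eventuallyEq hn).fderiv_eq, fderiv_kin_snd, drift, inner_velocity_lorentz]

theorem fderiv_kinTest (n : ℕ) (z w : R3 × R3) :
    fderiv ℝ (kinTest n) z w
      = fderiv ℝ (cutoff n) z.1 w.1 * (cutoff n z.2 * kin z.2)
        + cutoff n z.1 * (fderiv ℝ (cutoff n) z.2 w.2 * kin z.2
          + cutoff n z.2 * inner ℝ (velocity z.2) w.2) := by
  have hd := (contDiff_cutoff n).differentiable (by simp)
  have h1 : HasFDerivAt (fun w : R3 × R3 => cutoff n w.1)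
      ((fderiv ℝ (cutoff n) z.1).comp (ContinuousLinearMap.fst ℝ R3 R3)) z :=
    HasFDerivAt.comp (g := cutoff n) z (hd z.1).hasFDerivAt hasFDerivAt_fst
  have h2 : HasFDerivAt (fun w : R3 × R3 => cutoff n w.2)
      ((fderiv ℝ (cutoff n) z.2).comp (ContinuousLinearMap.snd ℝ R3 R3)) z :=
    HasFDerivAt.comp (g := cutoff n) z (hd z.2).hasFDerivAt hasFDerivAt_snd
  have h3 : HasFDerivAt (fun w : R3 × R3 => kin w.2)
      ((fderiv ℝ kin z.2).comp (ContinuousLinearMap.snd ℝ R3 R3)) z :=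
    HasFDerivAt.comp z (contDiff_kin.differentiable (by simp) z.2).hasFDerivAt hasFDerivAt_snd
  have h4 : fderiv ℝ (kinTest n) z = _ := (h1.mul (h2.mul h3)).fderiv
  rw [h4]
  simp [fderiv_kin]
  ring

/-- The derivative of the truncated kinetic energy along the characteristics, uniformly in the
truncation. -/
theorem exists_fderiv_kinTest_bound (E B : ℝ → R3 → R3) :
    ∃ C : ℝ, 0 ≤ C ∧ ∀ (n : ℕ) (t : ℝ) (z : R3 × R3),
      |fderiv ℝ (kinTest n) z (drift E B t z)| ≤ C * (kin z.2 + ‖E t z.1‖ + ‖B t z.1‖) := by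
  obtain ⟨C, hC0, hC⟩ := exists_fderiv_cutoff_bound
  refine ⟨3 * C + 1, by positivity, fun n t z => ?_⟩
  have hK := norm_lorentz_le (E t z.1) (B t z.1) z.2
  set e := ‖E t z.1‖ + ‖B t z.1‖ with he
  have he0 : 0 ≤ e := by positivity
  have hn : ((n : ℝ) + 1)⁻¹ ≤ 1 := inv_le_one_of_one_le₀ (by linarith [Nat.cast_nonneg (α := ℝ) n])
  have hkin := (kin_pos z.2).le
  have hc1 := cutoff_nonneg n z.1
  have hc1' := cutoff_le_one n z.1
  have hc2 := cutoff_nonneg n z.2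
  have hc2' := cutoff_le_one n z.2
  have b1 : |fderiv ℝ (cutoff n) z.1 (velocity z.2) * (cutoff n z.2 * kin z.2)| ≤ C * kin z.2 := by
    rw [abs_mul, abs_of_nonneg (mul_nonneg hc2 hkin)]
    have : |fderiv ℝ (cutoff n) z.1 (velocity z.2)| ≤ C := (hC n _ _).trans (by
      calc C * ((n : ℝ) + 1)⁻¹ * ‖velocity z.2‖ ≤ C * 1 * 1 := by
            gcongr
            exact norm_velocity_le _
        _ = C := by ring)
    gcongr
    exact mul_le_of_le_one_left hkin hc2'
  -- The critical term. The cutoff gradient is at most C/(n + 1) and lives where |p| ≤ 2(n + 1), and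
  -- there the energy is at most 1 + 2(n + 1) ≤ 3(n + 1).
  have b2 : |fderiv ℝ (cutoff n) z.2 (lorentz (E t z.1) (B t z.1) z.2) * kin z.2|
      ≤ 3 * C * e := by
    rcases le_or_gt ‖z.2‖ (2 * ((n : ℝ) + 1)) with h | h
    · rw [abs_mul, abs_of_nonneg hkin]
      calc _ ≤ (C * ((n : ℝ) + 1)⁻¹ * e) * (3 * ((n : ℝ) + 1)) := by
            gcongr
            · exact (hC n _ _).trans (by gcongr)
            · exact (kin_le z.2).trans (by linarith [Nat.cast_nonneg (α := ℝ) n])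
        _ = 3 * C * e := by field_simp
    · rw [fderiv_cutoff_eq_zero h]
      simp only [zero_apply, zero_mul, abs_zero]
      positivity
  have b3 : |cutoff n z.2 * inner ℝ (velocity z.2) (lorentz (E t z.1) (B t z.1) z.2)| ≤ e := by
    rw [abs_mul, abs_of_nonneg hc2]
    refine (mul_le_of_le_one_left (abs_nonneg _) hc2').trans ?_
    refine (abs_real_inner_le_norm _ _).trans ?_
    exact (mul_le_of_le_one_left (norm_nonneg _) (norm_velocity_le _)).trans hK
  rw [fderiv_kinTest, drift]
  simp only
  calc _ ≤ C * kin z.2 + (3 * C * e + e) := by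
        refine (abs_add_le _ _).trans (add_le_add b1 ?_)
        rw [abs_mul, abs_of_nonneg hc1]
        refine (mul_le_of_le_one_left (abs_nonneg _) hc1').trans ?_
        exact (abs_add_le _ _).trans (add_le_add b2 b3)
    _ ≤ (3 * C + 1) * (kin z.2 + e) := by nlinarith [mul_nonneg hC0 hkin]
    _ = _ := by rw [he]; ring

theorem MemL1kinLinfty.tendsto_integral_kinTest {f₀ : R3 × R3 → ℝ} (hf₀ : MemL1kinLinfty f₀) :
    Tendsto (fun n => ∫ z, f₀ z * kinTest n z) atTop (𝓝 (∫ z, kin z.2 * f₀ z)) := by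
  refine tendsto_integral_of_dominated_convergence (fun z => ‖kin z.2 * f₀ z‖)
    (fun n => hf₀.integrable.1.mul (contDiff_kinTest n).continuous.aestronglyMeasurable)
    hf₀.integrable_kin.norm ?_ ?_
  · refine fun n => ae_of_all _ fun z => ?_
    rw [norm_mul, norm_mul, mul_comm ‖kin z.2‖]
    gcongr
    rw [Real.norm_of_nonneg (kinTest_nonneg n _), Real.norm_of_nonneg (kin_pos _).le]
    exact kinTest_le n _
  · refine ae_of_all _ fun z => ?_
    rw [mul_comm (kin z.2)]
    exact (tendsto_kinTest z).const_mul _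

/-! ### The balance of the kinetic energy -/

section Kinetic

variable {T : ℝ} {f₀ : R3 × R3 → ℝ} {E₀ B₀ : R3 → R3} {f : ℝ → R3 × R3 → ℝ} {E B : ℝ → R3 → R3}

theorem IsWeakSolution.integrable_kin (hsol : IsWeakSolution T f₀ E₀ B₀ f E B) :
    Integrable (fun q : ℝ × (R3 × R3) => kin q.2.2 * f q.1 q.2)
      ((volume.restrict (Ico 0 T)).prod volume) := by
  have hm : AEStronglyMeasurable (fun q : ℝ × (R3 × R3) => kin q.2.2 * f q.1 q.2)
    ((volume.restrict (Ico 0 T)).prod volume) := hsol.f_kin.1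
  refine ⟨hm, ?_⟩
  obtain ⟨C, hC⟩ := hsol.f_kin.lintegral_bound
  rw [HasFiniteIntegral, lintegral_prod _ hm.enorm]
  refine (lintegral_mono_ae hC).trans_lt ?_
  rw [lintegral_const]
  exact ENNReal.mul_lt_top (by simp) (measure_lt_top _ _)

/-- Integration over p leaves the product of the density and |U|, both in L² at the times where θ
does not vanish. With U = E, B this provides the integrable majorants for the kinetic balance. -/
theorem IsWeakSolution.integrable_weight_field_density (hsol : IsWeakSolution T f₀ E₀ B₀ f E B)
    {U : ℝ → R3 → R3} (hU : MemLinftyLp (Ico 0 T) 2 U) {θ : ℝ → ℝ} (hθ : IsTimeTest T θ) {D : ℝ≥0}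
    (hD : ∀ᵐ t ∂(volume.restrict (Ico 0 T)), t ∈ Function.support θ →
      ∫⁻ x, absDensity f t x ^ 2 ≤ D) :
    Integrable (fun q : ℝ × (R3 × R3) => θ q.1 * (f q.1 q.2 * ‖U q.1 q.2.1‖))
      ((volume.restrict (Ico 0 T)).prod volume) := by
  have hm : AEStronglyMeasurable (fun q : ℝ × (R3 × R3) => θ q.1 * (f q.1 q.2 * ‖U q.1 q.2.1‖))
      ((volume.restrict (Ico 0 T)).prod volume) :=
    (hθ.continuous.comp continuous_fst).aestronglyMeasurable.mul
      (hsol.f_L1.1.mul (aestronglyMeasurable_comp_position hU.1).norm)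
  refine ⟨hm, ?_⟩
  obtain ⟨C, hC⟩ := hθ.exists_bound
  obtain ⟨CU, hCU⟩ := hU.lintegral_sq_bound
  have hbound : ∀ᵐ t ∂(volume.restrict (Ico 0 T)),
      ∫⁻ z, ‖θ t * (f t z * ‖U t z.1‖)‖ₑ ≤ C.toNNReal * (CU + D) := by
    filter_upwards [hCU, hD, hU.1.prodMk_left, hsol.f_L1.1.prodMk_left] with t h1 h2 m1 m2
    by_cases hθt : θ t = 0
    · simp [hθt]
    have m3 : AEMeasurable (fun z : R3 × R3 => ‖f t z‖ₑ * ‖U t z.1‖ₑ) (volume.prod volume) := by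
      rw [Measure.volume_eq_prod] at m2
      exact m2.enorm.mul (m1.enorm.comp_quasiMeasurePreserving Measure.quasiMeasurePreserving_fst)
    calc ∫⁻ z, ‖θ t * (f t z * ‖U t z.1‖)‖ₑ
        ≤ ∫⁻ z, C.toNNReal * (‖f t z‖ₑ * ‖U t z.1‖ₑ) := by
          refine lintegral_mono fun z => ?_
          rw [enorm_mul, enorm_mul, enorm_norm]
          gcongr
          rw [← ofReal_norm]
          exact ENNReal.ofReal_le_ofReal (hC t)
      _ = C.toNNReal * ∫⁻ x, ∫⁻ p, ‖f t (x, p)‖ₑ * ‖U t x‖ₑ := by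
          rw [lintegral_const_mul' _ _ (by simp), Measure.volume_eq_prod, lintegral_prod _ m3]
      _ = C.toNNReal * ∫⁻ x, absDensity f t x * ‖U t x‖ₑ := by
          congr 1
          refine lintegral_congr fun x => ?_
          rw [lintegral_mul_const' _ _ enorm_ne_top]
          rfl
      _ ≤ C.toNNReal * ∫⁻ x, (‖U t x‖ₑ ^ 2 + absDensity f t x ^ 2) := by
          gcongr with x
          rcases le_total (absDensity f t x) ‖U t x‖ₑ with h | h
          · exact (mul_le_mul_left h _).trans (by rw [sq ‖U t x‖ₑ]; exact le_self_add)
          · exact (mul_le_mul_right h _).trans (by rw [sq (absDensity f t x)]; exact le_add_self)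
      _ ≤ _ := by
          have m4 : AEMeasurable (fun x => ‖U t x‖ₑ ^ 2) volume := m1.enorm.pow_const 2
          rw [lintegral_add_left' m4]
          gcongr
          exact h2 hθt
  rw [HasFiniteIntegral, lintegral_prod _ hm.enorm]
  refine (lintegral_mono_ae hbound).trans_lt ?_
  rw [lintegral_const]
  exact ENNReal.mul_lt_top (ENNReal.mul_lt_top (by simp) (by simp)) (measure_lt_top _ _)

theorem integral_inner_currentDensity {θ : ℝ → ℝ} {t : ℝ} (h1 : Integrable (f t))
    (h2 : Integrable fun z : R3 × R3 => θ t * (f t z * inner ℝ (velocity z.2) (E t z.1))) :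
    ∫ z : R3 × R3, θ t * (f t z * inner ℝ (velocity z.2) (E t z.1))
      = θ t * ∫ x, inner ℝ (currentDensity f t x) (E t x) := by
  rw [Measure.volume_eq_prod] at h1 h2 ⊢
  rw [integral_prod _ h2, ← integral_const_mul]
  refine integral_congr_ae ?_
  filter_upwards [h1.prod_right_ae] with x hx
  rw [integral_const_mul]
  congr 1
  have i : Integrable fun p => f t (x, p) • velocity p :=
    hx.smul_bdd 1 continuous_velocity.aestronglyMeasurable (ae_of_all _ norm_velocity_le)
  rw [currentDensity, real_inner_comm, ← integral_inner i]
  congr 1 with p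
  rw [inner_smul_right, real_inner_comm]

/-- The balance of the kinetic energy. -/
theorem IsWeakSolution.kinetic_energy (hsol : IsWeakSolution T f₀ E₀ B₀ f E B)
    (hf₀ : MemL1kinLinfty f₀) {θ : ℝ → ℝ} (hθ : IsTimeTest T θ) {D : ℝ≥0}
    (hD : ∀ᵐ t ∂(volume.restrict (Ico 0 T)), t ∈ Function.support θ →
      ∫⁻ x, absDensity f t x ^ 2 ≤ D) :
    IntegrableOn (fun t => θ t * ∫ x, inner ℝ (currentDensity f t x) (E t x)) (Ico 0 T) ∧
    ∫ t in Ico 0 T, (deriv θ t * (∫ z, kin z.2 * f t z)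
        + θ t * ∫ x, inner ℝ (currentDensity f t x) (E t x))
      = -(θ 0 * ∫ z, kin z.2 * f₀ z) := by
  set ν := volume.restrict (Ico 0 T) with hν
  obtain ⟨C, hC0, hC⟩ := exists_fderiv_kinTest_bound E B
  obtain ⟨Cθ, hCθ⟩ := hθ.exists_bound
  obtain ⟨Cθ', hCθ'⟩ := hθ.exists_bound_deriv
  have ikin := hsol.integrable_kin
  have iE := (hsol.integrable_weight_field_density hsol.E_L2 hθ hD).norm
  have iB := (hsol.integrable_weight_field_density hsol.B_L2 hθ hD).norm
  have ik : Integrable (fun q : ℝ × (R3 × R3) => θ q.1 * (kin q.2.2 * f q.1 q.2)) (ν.prod volume) :=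
    ikin.bdd_mul (hθ.continuous.comp continuous_fst).aestronglyMeasurable
      (ae_of_all _ fun q => hCθ q.1)
  have ik' : Integrable (fun q : ℝ × (R3 × R3) => deriv θ q.1 * (kin q.2.2 * f q.1 q.2))
      (ν.prod volume) :=
    ikin.bdd_mul (hθ.continuous_deriv.comp continuous_fst).aestronglyMeasurable
      (ae_of_all _ fun q => hCθ' q.1)
  have mθ : AEStronglyMeasurable (fun q : ℝ × (R3 × R3) => θ q.1) (ν.prod volume) :=
    (hθ.continuous.comp continuous_fst).aestronglyMeasurable
  have mθ' : AEStronglyMeasurable (fun q : ℝ × (R3 × R3) => deriv θ q.1) (ν.prod volume) :=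
    (hθ.continuous_deriv.comp continuous_fst).aestronglyMeasurable
  have mJ : AEStronglyMeasurable
      (fun q : ℝ × (R3 × R3) => θ q.1 * (f q.1 q.2 * inner ℝ (velocity q.2.2) (E q.1 q.2.1)))
      (ν.prod volume) := by
    refine mθ.mul (hsol.f_L1.1.mul (AEStronglyMeasurable.inner ?_
      (aestronglyMeasurable_comp_position hsol.E_L2.1)))
    exact (continuous_velocity.comp (continuous_snd.comp continuous_snd)).aestronglyMeasurable
  have iJ : Integrable
      (fun q : ℝ × (R3 × R3) => θ q.1 * (f q.1 q.2 * inner ℝ (velocity q.2.2) (E q.1 q.2.1)))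
      (ν.prod volume) := by
    refine iE.mono' mJ (ae_of_all _ fun q => ?_)
    rw [norm_mul, norm_mul, norm_mul, norm_mul, norm_norm]
    gcongr
    exact (norm_inner_le_norm _ _).trans
      (mul_le_of_le_one_left (norm_nonneg _) (norm_velocity_le _))
  have hJ : ∀ᵐ t ∂ν, ∫ z : R3 × R3, θ t * (f t z * inner ℝ (velocity z.2) (E t z.1))
      = θ t * ∫ x, inner ℝ (currentDensity f t x) (E t x) := by
    filter_upwards [hsol.f_L1.ae_memLp, iJ.prod_right_ae] with t h1 h2
    exact integral_inner_currentDensity (memLp_one_iff_integrable.1 h1) h2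
  have iJt : IntegrableOn (fun t => θ t * ∫ x, inner ℝ (currentDensity f t x) (E t x))
      (Ico 0 T) := (integrable_congr hJ).1 iJ.integral_prod_left
  refine ⟨iJt, ?_⟩
  have iA : ∀ n, Integrable (fun q : ℝ × (R3 × R3) => deriv θ q.1 * (f q.1 q.2 * kinTest n q.2))
      (ν.prod volume) := by
    intro n
    refine ik'.norm.mono' (mθ'.mul (hsol.f_L1.1.mul
      ((contDiff_kinTest n).continuous.comp continuous_snd).aestronglyMeasurable))
      (ae_of_all _ fun q => ?_)
    rw [norm_mul, norm_mul, norm_mul, norm_mul, mul_comm ‖kin q.2.2‖]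
    gcongr
    rw [Real.norm_of_nonneg (kinTest_nonneg n _), Real.norm_of_nonneg (kin_pos _).le]
    exact kinTest_le n _
  have iG : ∀ n, Integrable
      (fun q : ℝ × (R3 × R3) => θ q.1 * (f q.1 q.2 * fderiv ℝ (kinTest n) q.2 (drift E B q.1 q.2)))
      (ν.prod volume) := fun n =>
    (hsol.integrable_fderiv_drift (contDiff_kinTest n) (hasCompactSupport_kinTest n)).bdd_mul mθ
      (ae_of_all _ fun q => hCθ q.1)
  -- The Vlasov equation tested with the truncated energy, written over the product of time and
  -- phase space so that dominated convergence applies to all variables at once.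
  have hid : ∀ n, (∫ q, deriv θ q.1 * (f q.1 q.2 * kinTest n q.2) ∂(ν.prod volume))
      + (∫ q, θ q.1 * (f q.1 q.2 * fderiv ℝ (kinTest n) q.2 (drift E B q.1 q.2)) ∂(ν.prod volume))
      = -(θ 0 * ∫ z, f₀ z * kinTest n z) := by
    intro n
    rw [← hsol.vlasov_weakODE (contDiff_kinTest n) (hasCompactSupport_kinTest n) θ hθ,
      integral_prod _ (iA n), integral_prod _ (iG n),
      ← integral_add (iA n).integral_prod_left (iG n).integral_prod_left]
    simp only [integral_const_mul]
    rfl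
  have lim1 : Tendsto (fun n => ∫ q, deriv θ q.1 * (f q.1 q.2 * kinTest n q.2) ∂(ν.prod volume))
      atTop (𝓝 (∫ q, deriv θ q.1 * (kin q.2.2 * f q.1 q.2) ∂(ν.prod volume))) := by
    refine tendsto_integral_of_dominated_convergence
      (fun q => ‖deriv θ q.1 * (kin q.2.2 * f q.1 q.2)‖) (fun n => (iA n).1) ik'.norm ?_ ?_
    · refine fun n => ae_of_all _ fun q => ?_
      rw [norm_mul, norm_mul, norm_mul, norm_mul, mul_comm ‖kin q.2.2‖]
      gcongr
      rw [Real.norm_of_nonneg (kinTest_nonneg n _), Real.norm_of_nonneg (kin_pos _).le]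
      exact kinTest_le n _
    · refine ae_of_all _ fun q => Tendsto.const_mul _ ?_
      rw [mul_comm (kin q.2.2)]
      exact (tendsto_kinTest q.2).const_mul _
  -- In the limit only the electric power v·E remains; the majorant consists of θ times the kinetic
  -- energy density, f|E| and f|B|.
  have lim2 : Tendsto (fun n => ∫ q, θ q.1 * (f q.1 q.2
        * fderiv ℝ (kinTest n) q.2 (drift E B q.1 q.2)) ∂(ν.prod volume)) atTop
      (𝓝 (∫ q, θ q.1 * (f q.1 q.2 * inner ℝ (velocity q.2.2) (E q.1 q.2.1))
        ∂(ν.prod volume))) := by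
    refine tendsto_integral_of_dominated_convergence
      (fun q => C * (‖θ q.1 * (kin q.2.2 * f q.1 q.2)‖ + ‖θ q.1 * (f q.1 q.2 * ‖E q.1 q.2.1‖)‖
        + ‖θ q.1 * (f q.1 q.2 * ‖B q.1 q.2.1‖)‖)) (fun n => (iG n).1)
      (((ik.norm.add iE).add iB).const_mul C) ?_ ?_
    · refine fun n => ae_of_all _ fun q => ?_
      simp only [norm_mul, norm_norm, Real.norm_of_nonneg (kin_pos _).le]
      calc _ ≤ ‖θ q.1‖ * (‖f q.1 q.2‖ * (C * (kin q.2.2 + ‖E q.1 q.2.1‖ + ‖B q.1 q.2.1‖))) := by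
            gcongr
            exact hC n q.1 q.2
        _ = _ := by ring
    · exact ae_of_all _ fun q =>
        Tendsto.const_mul _ ((tendsto_fderiv_kinTest E B q.1 q.2).const_mul _)
  have hlim := tendsto_nhds_unique (lim1.add lim2)
    ((Tendsto.const_mul (θ 0) hf₀.tendsto_integral_kinTest).neg.congr fun n => (hid n).symm)
  rw [← hlim, integral_prod _ ik', integral_prod _ iJ, integral_congr_ae hJ,
    ← integral_add ik'.integral_prod_left iJt]
  simp only [integral_const_mul]

end Kinetic

/-! ### The total energy -/

theorem integrable_prod_of_ae_lintegral_le {X F : Type*} [MeasureSpace X]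
    [SFinite (volume : Measure X)] [NormedAddCommGroup F] {ν : Measure ℝ} [IsFiniteMeasure ν]
    {u : ℝ → X → F} (hm : AEStronglyMeasurable (Function.uncurry u) (ν.prod volume)) {C : ℝ≥0}
    (hC : ∀ᵐ t ∂ν, ∫⁻ x, ‖u t x‖ₑ ≤ C) : Integrable (Function.uncurry u) (ν.prod volume) := by
  refine ⟨hm, ?_⟩
  rw [HasFiniteIntegral, lintegral_prod _ hm.enorm]
  refine (lintegral_mono_ae hC).trans_lt ?_
  rw [lintegral_const]
  exact ENNReal.mul_lt_top ENNReal.coe_lt_top (measure_lt_top _ _)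

theorem WeakODE.add {T : ℝ} {u v g h : ℝ → ℝ} {u₀ v₀ : ℝ} (hu : WeakODE T u g u₀)
    (hv : WeakODE T v h v₀) (iu : IntegrableOn u (Ico 0 T)) (ig : IntegrableOn g (Ico 0 T))
    (iv : IntegrableOn v (Ico 0 T)) (ih : IntegrableOn h (Ico 0 T)) :
    WeakODE T (fun t => u t + v t) (fun t => g t + h t) (u₀ + v₀) := by
  intro θ hθ
  obtain ⟨C, hC⟩ := hθ.exists_bound
  obtain ⟨C', hC'⟩ := hθ.exists_bound_deriv
  have key : ∀ {u g : ℝ → ℝ}, IntegrableOn u (Ico 0 T) → IntegrableOn g (Ico 0 T) →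
      IntegrableOn (fun t => deriv θ t * u t + θ t * g t) (Ico 0 T) := fun iu ig =>
    (iu.bdd_mul hθ.continuous_deriv.aestronglyMeasurable (ae_of_all _ hC')).add
      (ig.bdd_mul hθ.continuous.aestronglyMeasurable (ae_of_all _ hC))
  rw [mul_add, neg_add, ← hu θ hθ, ← hv θ hθ, ← integral_add (key iu ig) (key iv ih)]
  congr 1 with t
  ring

theorem WeakODE.const_mul {T : ℝ} {u g : ℝ → ℝ} {u₀ : ℝ} (hu : WeakODE T u g u₀) (c : ℝ) :
    WeakODE T (fun t => c * u t) (fun t => c * g t) (c * u₀) := by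
  intro θ hθ
  have e : -(θ 0 * (c * u₀)) = c * -(θ 0 * u₀) := by ring
  rw [e, ← hu θ hθ, ← integral_const_mul]
  congr 1 with t
  ring

theorem integrableOn_integral_inner {T : ℝ} {U : ℝ → R3 → R3} (hU : MemLinftyLp (Ico 0 T) 2 U)
    {Ψ : R3 → R3} (hΨ : Continuous Ψ) (hc : HasCompactSupport Ψ) :
    IntegrableOn (fun t => ∫ x, inner ℝ (U t x) (Ψ x)) (Ico 0 T) := by
  obtain ⟨C, hC⟩ := hU.lintegral_sq_bound
  have hΨ2 : ∫⁻ x, ‖Ψ x‖ₑ ^ 2 < ⊤ := lintegral_sq_lt_top (hΨ.memLp_of_hasCompactSupport hc)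
  refine (integrable_prod_of_ae_lintegral_le (u := fun t x => inner ℝ (U t x) (Ψ x))
    (C := C + (∫⁻ x, ‖Ψ x‖ₑ ^ 2).toNNReal) ?_ ?_).integral_prod_left
  · exact hU.1.inner (hΨ.comp continuous_snd).aestronglyMeasurable
  · filter_upwards [hC, hU.1.prodMk_left] with t ht hm
    have hm2 : AEMeasurable (fun x => ‖U t x‖ₑ ^ 2) volume := hm.enorm.pow_const 2
    rw [ENNReal.coe_add, ENNReal.coe_toNNReal hΨ2.ne]
    refine le_trans ?_ (add_le_add_left ht _)
    rw [← lintegral_add_left' hm2]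
    refine lintegral_mono fun x => ?_
    have hi : ‖inner ℝ (U t x) (Ψ x)‖ₑ ≤ ‖U t x‖ₑ * ‖Ψ x‖ₑ := by
      rw [← ofReal_norm, ← ofReal_norm, ← ofReal_norm, ← ENNReal.ofReal_mul (norm_nonneg _)]
      exact ENNReal.ofReal_le_ofReal (norm_inner_le_norm _ _)
    refine hi.trans ?_
    rcases le_total ‖U t x‖ₑ ‖Ψ x‖ₑ with h | h
    · exact (mul_le_mul_left h _).trans (by rw [sq ‖Ψ x‖ₑ]; exact le_add_self)
    · exact (mul_le_mul_right h _).trans (by rw [sq ‖U t x‖ₑ]; exact le_self_add)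

theorem integrableOn_integral_inner_of_L1 {T : ℝ} {U : ℝ → R3 → R3}
    (hU : MemLinftyLp (Ico 0 T) 1 U)
    {Ψ : R3 → R3} (hΨ : Continuous Ψ) (hc : HasCompactSupport Ψ) :
    IntegrableOn (fun t => ∫ x, inner ℝ (U t x) (Ψ x)) (Ico 0 T) := by
  obtain ⟨C, hC⟩ := hc.exists_bound_of_continuous hΨ
  obtain ⟨D, hD⟩ := hU.lintegral_bound
  have i : Integrable (Function.uncurry U) ((volume.restrict (Ico 0 T)).prod volume) :=
    integrable_prod_of_ae_lintegral_le hU.1 hD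
  exact (integrable_inner_of_bounded i (hΨ.comp continuous_snd).aestronglyMeasurable
    (fun z => hC z.2)).integral_prod_left

section Energy

variable {T : ℝ} {f₀ : R3 × R3 → ℝ} {E₀ B₀ : R3 → R3} {f : ℝ → R3 × R3 → ℝ} {E B : ℝ → R3 → R3}

theorem IsWeakSolution.integrableOn_kinetic (hsol : IsWeakSolution T f₀ E₀ B₀ f E B) :
    IntegrableOn (fun t => ∫ z, kin z.2 * f t z) (Ico 0 T) :=
  hsol.integrable_kin.integral_prod_left

theorem IsWeakSolution.integrableOn_field (hsol : IsWeakSolution T f₀ E₀ B₀ f E B) :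
    IntegrableOn (fun t => ∫ x, (‖E t x‖ ^ 2 + ‖B t x‖ ^ 2)) (Ico 0 T) := by
  have key : ∀ {U : ℝ → R3 → R3}, MemLinftyLp (Ico 0 T) 2 U →
      Integrable (fun q : ℝ × R3 => ‖U q.1 q.2‖ ^ 2)
        ((volume.restrict (Ico 0 T)).prod volume) := by
    intro U hU
    obtain ⟨C, hC⟩ := hU.lintegral_sq_bound
    refine integrable_prod_of_ae_lintegral_le (u := fun t x => ‖U t x‖ ^ 2) (C := C)
      (hU.1.norm.pow 2) ?_
    filter_upwards [hC] with t ht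
    simpa using ht
  exact ((key hsol.E_L2).add (key hsol.B_L2)).integral_prod_left

theorem IsWeakSolution.integrableOn_totalEnergy (hsol : IsWeakSolution T f₀ E₀ B₀ f E B) :
    IntegrableOn (fun t => totalEnergy (f t) (E t) (B t)) (Ico 0 T) :=
  hsol.integrableOn_kinetic.add (hsol.integrableOn_field.const_mul _)

/-- The energy is conserved, in the sense of distributions, on the times at which the density is
square integrable. -/
theorem IsWeakSolution.integral_deriv_mul_totalEnergy (hsol : IsWeakSolution T f₀ E₀ B₀ f E B)
    (hT : 0 < T) (hf₀ : MemL1kinLinfty f₀) (hE₀ : MemLp E₀ 2) (hB₀ : MemLp B₀ 2)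
    {θ : ℝ → ℝ} (hθ : IsTimeTest T θ) {D : ℝ≥0}
    (hD : ∀ᵐ t ∂(volume.restrict (Ico 0 T)), t ∈ Function.support θ →
      ∫⁻ x, absDensity f t x ^ 2 ≤ D) :
    ∫ t in Ico 0 T, deriv θ t * totalEnergy (f t) (E t) (B t)
      = -(θ 0 * totalEnergy f₀ E₀ B₀) := by
  obtain ⟨C', hC'⟩ := hθ.exists_bound_deriv
  obtain ⟨iJ, hkin⟩ := hsol.kinetic_energy hf₀ hθ hD
  have hfield := hsol.field_energy hT hE₀ hB₀ hθ hD
  have mθ' := hθ.continuous_deriv.aestronglyMeasurable (μ := volume.restrict (Ico 0 T))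
  have i1 : IntegrableOn (fun t => deriv θ t * (∫ z, kin z.2 * f t z)
      + θ t * ∫ x, inner ℝ (currentDensity f t x) (E t x)) (Ico 0 T) :=
    (hsol.integrableOn_kinetic.bdd_mul mθ' (ae_of_all _ hC')).add iJ
  have i2 : IntegrableOn (fun t => deriv θ t * (∫ x, (‖E t x‖ ^ 2 + ‖B t x‖ ^ 2))
      - 8 * Real.pi * (θ t * ∫ x, inner ℝ (currentDensity f t x) (E t x))) (Ico 0 T) :=
    (hsol.integrableOn_field.bdd_mul mθ' (ae_of_all _ hC')).sub (iJ.const_mul _)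
  have e : -(θ 0 * totalEnergy f₀ E₀ B₀) = -(θ 0 * ∫ z, kin z.2 * f₀ z)
      + 1 / (8 * Real.pi) * -(θ 0 * ∫ x, (‖E₀ x‖ ^ 2 + ‖B₀ x‖ ^ 2)) := by
    rw [totalEnergy]; ring
  -- After division of the field balance by 8π the work terms ∫ j·E cancel.
  rw [e, ← hkin, ← hfield, ← integral_const_mul, ← integral_add i1 (i2.const_mul _)]
  congr 1 with t
  have := Real.pi_ne_zero
  rw [totalEnergy]
  field_simp
  ring

/-! ### Lower semicontinuity of the energy at the initial time -/

theorem IsWeakSolution.ae_integral_mul_kinTest_le (hsol : IsWeakSolution T f₀ E₀ B₀ f E B)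
    (n : ℕ) :
    ∀ᵐ t ∂(volume.restrict (Ico 0 T)), ∫ z, f t z * kinTest n z ≤ ∫ z, kin z.2 * f t z := by
  filter_upwards [hsol.f_nonneg, hsol.f_kin.ae_memLp, hsol.f_L1.ae_memLp] with t h1 h2 h3
  have i2 := memLp_one_iff_integrable.1 h2
  refine integral_mono_ae ?_ i2 ?_
  · refine i2.norm.mono' (h3.1.mul (contDiff_kinTest n).continuous.aestronglyMeasurable)
      (ae_of_all _ fun z => ?_)
    rw [norm_mul, norm_mul, mul_comm ‖kin z.2‖]
    gcongr
    rw [Real.norm_of_nonneg (kinTest_nonneg n _), Real.norm_of_nonneg (kin_pos _).le]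
    exact kinTest_le n _
  · filter_upwards [h1] with z hz
    rw [mul_comm (kin z.2)]
    exact mul_le_mul_of_nonneg_left (kinTest_le n z) hz

/-- With the last square dropped, this bounds the quadratic field energy below by a functional
affine in `a`; with it kept, it measures the error at the initial time. -/
theorem two_mul_integral_inner {X F : Type*} [MeasurableSpace X] {μ : Measure X}
    [NormedAddCommGroup F] [InnerProductSpace ℝ F] {a b : X → F} (ha : MemLp a 2 μ)
    (hb : MemLp b 2 μ) :
    2 * ∫ x, inner ℝ (a x) (b x) ∂μ
      = (∫ x, ‖a x‖ ^ 2 ∂μ) + (∫ x, ‖b x‖ ^ 2 ∂μ) - ∫ x, ‖(a - b) x‖ ^ 2 ∂μ := by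
  have ia := integrable_norm_sq_of_memLp_two ha
  have ib := integrable_norm_sq_of_memLp_two hb
  have iab := integrable_norm_sq_of_memLp_two (ha.sub hb)
  have iab' : Integrable (fun x => ‖a x‖ ^ 2 + ‖b x‖ ^ 2) μ := ia.add ib
  rw [← integral_add ia ib, ← integral_sub iab' iab, ← integral_const_mul]
  congr 1 with x
  rw [Pi.sub_apply, norm_sub_sq_real]
  ring

/-- Weak lower semicontinuity of the energy at the initial time, for regular competitors. -/
theorem IsWeakSolution.initial_energy_le_of_test (hsol : IsWeakSolution T f₀ E₀ B₀ f E B)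
    (hT : 0 < T) (hE₀ : MemLp E₀ 2) (hB₀ : MemLp B₀ 2) {c : ℝ}
    (hc : ∀ᵐ t ∂(volume.restrict (Ico 0 T)), totalEnergy (f t) (E t) (B t) ≤ c) (n : ℕ)
    {Ψ Ξ : R3 → R3} (sΨ : ContDiff ℝ ∞ Ψ) (cΨ : HasCompactSupport Ψ) (sΞ : ContDiff ℝ ∞ Ξ)
    (cΞ : HasCompactSupport Ξ) :
    (∫ z, f₀ z * kinTest n z) + 1 / (8 * Real.pi) * (∫ x, (‖E₀ x‖ ^ 2 + ‖B₀ x‖ ^ 2))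
      ≤ c + 1 / (8 * Real.pi)
        * ((∫ x, ‖(E₀ - Ψ) x‖ ^ 2) + ∫ x, ‖(B₀ - Ξ) x‖ ^ 2) := by
  have LΨ : MemLp Ψ 2 := sΨ.continuous.memLp_of_hasCompactSupport cΨ
  have LΞ : MemLp Ξ 2 := sΞ.continuous.memLp_of_hasCompactSupport cΞ
  have hpi : 0 < 1 / (8 * Real.pi) := by positivity
  have sk := contDiff_kinTest n
  have ck := hasCompactSupport_kinTest n
  obtain ⟨Ck, hCk⟩ := ck.exists_bound_of_continuous sk.continuous
  have iKu : IntegrableOn (fun t => ∫ z, f t z * kinTest n z) (Ico 0 T) := by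
    obtain ⟨C, hC⟩ := hsol.f_L1.lintegral_bound
    exact ((integrable_prod_of_ae_lintegral_le hsol.f_L1.1 hC).mul_bdd
      (sk.continuous.comp continuous_snd).aestronglyMeasurable
      (ae_of_all _ fun q => hCk q.2)).integral_prod_left
  have iKg := (hsol.integrable_fderiv_drift sk ck).integral_prod_left
  have iEu := integrableOn_integral_inner hsol.E_L2 sΨ.continuous cΨ
  have iEg : IntegrableOn (fun t => (∫ x, inner ℝ (B t x) (curl Ψ x))
      - 4 * Real.pi * ∫ x, inner ℝ (currentDensity f t x) (Ψ x)) (Ico 0 T) :=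
    (integrableOn_integral_inner hsol.B_L2 (contDiff_curl sΨ).continuous
      (hasCompactSupport_curl cΨ)).sub ((integrableOn_integral_inner_of_L1
        hsol.f_L1.currentDensity sΨ.continuous cΨ).const_mul _)
  have iBu := integrableOn_integral_inner hsol.B_L2 sΞ.continuous cΞ
  have iBg : IntegrableOn (fun t => -∫ x, inner ℝ (E t x) (curl Ξ x)) (Ico 0 T) :=
    (integrableOn_integral_inner hsol.E_L2 (contDiff_curl sΞ).continuous
      (hasCompactSupport_curl cΞ)).neg
  -- The functional ∫ f `kinTest n` + (2/8π)(⟨E, Ψ⟩ + ⟨B, Ξ⟩) is linear in the solution, so its weak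
  -- equation carries its initial value.
  have H := (hsol.vlasov_weakODE sk ck).add
    (((hsol.ampere_weakODE sΨ cΨ).add (hsol.faraday_weakODE sΞ cΞ) iEu iEg iBu iBg).const_mul
      (1 / (8 * Real.pi) * 2)) iKu iKg ((iEu.add iBu).const_mul _) ((iEg.add iBg).const_mul _)
  -- At almost every time the functional is at most the energy plus the norms of Ψ and Ξ, as the
  -- squares ‖E - Ψ‖² and ‖B - Ξ‖² are nonnegative.
  have hle := H.initial_le hT (iKu.add ((iEu.add iBu).const_mul _))
    (iKg.add ((iEg.add iBg).const_mul _))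
    (c := c + 1 / (8 * Real.pi) * ((∫ x, ‖Ψ x‖ ^ 2) + ∫ x, ‖Ξ x‖ ^ 2)) (by
      filter_upwards [hc, hsol.ae_integral_mul_kinTest_le n, hsol.E_L2.ae_memLp,
        hsol.B_L2.ae_memLp] with t h1 h2 h3 h4
      have e1 := two_mul_integral_inner h3 LΨ
      have e2 := two_mul_integral_inner h4 LΞ
      have p1 : 0 ≤ ∫ x, ‖(E t - Ψ) x‖ ^ 2 := integral_nonneg fun x => by positivity
      have p2 : 0 ≤ ∫ x, ‖(B t - Ξ) x‖ ^ 2 := integral_nonneg fun x => by positivity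
      rw [totalEnergy, integral_add (integrable_norm_sq_of_memLp_two h3)
        (integrable_norm_sq_of_memLp_two h4)] at h1
      have p3 : 1 / (8 * Real.pi) * 2
          * ((∫ x, inner ℝ (E t x) (Ψ x)) + ∫ x, inner ℝ (B t x) (Ξ x))
          ≤ 1 / (8 * Real.pi) * ((∫ x, ‖E t x‖ ^ 2) + ∫ x, ‖B t x‖ ^ 2)
            + 1 / (8 * Real.pi) * ((∫ x, ‖Ψ x‖ ^ 2) + ∫ x, ‖Ξ x‖ ^ 2) := by
        rw [← mul_add, mul_assoc]
        refine mul_le_mul_of_nonneg_left ?_ hpi.le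
        linarith
      simp only [Pi.add_apply]
      linarith)
  have e1 := two_mul_integral_inner hE₀ LΨ
  have e2 := two_mul_integral_inner hB₀ LΞ
  rw [integral_add (integrable_norm_sq_of_memLp_two hE₀) (integrable_norm_sq_of_memLp_two hB₀)]
  have e3 : 1 / (8 * Real.pi) * 2
      * ((∫ x, inner ℝ (E₀ x) (Ψ x)) + ∫ x, inner ℝ (B₀ x) (Ξ x))
      = 1 / (8 * Real.pi) * ((∫ x, ‖E₀ x‖ ^ 2) + ∫ x, ‖B₀ x‖ ^ 2)
        + 1 / (8 * Real.pi) * ((∫ x, ‖Ψ x‖ ^ 2) + ∫ x, ‖Ξ x‖ ^ 2)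
        - 1 / (8 * Real.pi) * ((∫ x, ‖(E₀ - Ψ) x‖ ^ 2) + ∫ x, ‖(B₀ - Ξ) x‖ ^ 2) := by
    rw [← mul_add, ← mul_sub, mul_assoc]
    congr 1
    linarith
  linarith

theorem exists_smooth_integral_sq_le {e : R3 → R3} (he : MemLp e 2) {ε : ℝ} (hε : 0 < ε) :
    ∃ Ψ : R3 → R3, ContDiff ℝ ∞ Ψ ∧ HasCompactSupport Ψ ∧ ∫ x, ‖(e - Ψ) x‖ ^ 2 ≤ ε := by
  obtain ⟨Ψ, h1, h2, h3⟩ := MemLp.exist_eLpNorm_sub_le (by norm_num) (by norm_num) he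
    (Real.sqrt_pos.2 hε)
  refine ⟨Ψ, h2, h1, ?_⟩
  rw [integral_norm_sq_eq _ (he.1.sub h2.continuous.aestronglyMeasurable), ← eLpNorm_two_sq,
    ENNReal.toReal_pow]
  have := ENNReal.toReal_mono ENNReal.ofReal_ne_top h3
  rw [ENNReal.toReal_ofReal (Real.sqrt_nonneg _)] at this
  calc _ ≤ Real.sqrt ε ^ 2 := by gcongr
    _ = ε := Real.sq_sqrt hε.le

/-- The initial energy is at most any almost everywhere upper bound of the energy. -/
theorem IsWeakSolution.initial_energy_le (hsol : IsWeakSolution T f₀ E₀ B₀ f E B)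
    (hT : 0 < T) (hf₀ : MemL1kinLinfty f₀) (hE₀ : MemLp E₀ 2) (hB₀ : MemLp B₀ 2) {c : ℝ}
    (hc : ∀ᵐ t ∂(volume.restrict (Ico 0 T)), totalEnergy (f t) (E t) (B t) ≤ c) :
    totalEnergy f₀ E₀ B₀ ≤ c := by
  refine le_of_forall_pos_le_add fun ε hε => ?_
  obtain ⟨Ψ, sΨ, cΨ, hΨ⟩ := exists_smooth_integral_sq_le hE₀
    -- Two errors of size 4πε, divided by 8π, add up to ε.
    (show 0 < 4 * Real.pi * ε by positivity)
  obtain ⟨Ξ, sΞ, cΞ, hΞ⟩ := exists_smooth_integral_sq_le hB₀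
    (show 0 < 4 * Real.pi * ε by positivity)
  refine le_of_tendsto (hf₀.tendsto_integral_kinTest.add_const _) (Eventually.of_forall fun n =>
    (hsol.initial_energy_le_of_test hT hE₀ hB₀ hc n sΨ cΨ sΞ cΞ).trans ?_)
  gcongr
  rw [one_div, inv_mul_le_iff₀ (by positivity)]
  linarith

theorem ae_moment_bound {l a b : ℝ} {f : ℝ → R3 × R3 → ℝ}
    (h : MemLinftyLp (Icc a b) 2 (moment l f)) {S : Set ℝ} (hS : S ∩ Ico 0 T ⊆ Icc a b) :
    ∃ C : ℝ≥0, ∀ᵐ t ∂(volume.restrict (Ico 0 T)), t ∈ S → ∫⁻ x, moment l f t x ^ 2 ≤ C := by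
  obtain ⟨C, hC⟩ := h.lintegral_sq_bound
  refine ⟨C, ?_⟩
  rw [ae_restrict_iff' measurableSet_Icc] at hC
  rw [ae_restrict_iff' measurableSet_Ico]
  filter_upwards [hC] with t ht h1 h2
  simpa using ht (hS ⟨h2, h1⟩)

end Energy

end RVM
end

/-! ### Conservation of the energy -/

theorem theorem1 (T : ℝ) (hT : 0 < T) (l : ℝ) (hl : 0 < l)
    (f₀ : RVM.R3 × RVM.R3 → ℝ) (E₀ B₀ : RVM.R3 → RVM.R3)
    (hf₀ : RVM.MemL1kinLinfty f₀) (hE₀ : MemLp E₀ 2) (hB₀ : MemLp B₀ 2)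
    (f : ℝ → RVM.R3 × RVM.R3 → ℝ) (E B : ℝ → RVM.R3 → RVM.R3)
    (hsol : RVM.IsWeakSolution T f₀ E₀ B₀ f E B)
    (hE : ∀ i : Fin 3, RVM.MemL1locBVloc T fun t x => E t x i)
    (hB : ∀ i : Fin 3, RVM.MemL1locBVloc T fun t x => B t x i)
    (hmoment : RVM.MemLinftylocLp T 2 (RVM.moment l f)) :
    (∃ c : ℝ, RVM.totalEnergy f₀ E₀ B₀ ≤ c ∧
      ∀ᵐ t ∂(volume.restrict (Ico 0 T)), RVM.totalEnergy (f t) (E t) (B t) = c) ∧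
    ((RVM.MemLinftylocLpFromZero T 2 (RVM.moment l f) ∨
        ∀ᵐ t ∂(volume.restrict (Ico 0 T)),
          RVM.totalEnergy (f t) (E t) (B t) ≤ RVM.totalEnergy f₀ E₀ B₀) →
      ∀ᵐ t ∂(volume.restrict (Ico 0 T)),
        RVM.totalEnergy (f t) (E t) (B t) = RVM.totalEnergy f₀ E₀ B₀) := by
  obtain ⟨c, hc⟩ := RVM.exists_ae_eq_const_of_integral_deriv_mul hT
    hsol.integrableOn_totalEnergy fun θ hθ hsupp => by
      -- The support of θ lies in some [a, b] with 0 < a and b < T, where the local moment bound is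
      -- available.
      obtain ⟨a, ha, ha'⟩ := RVM.exists_gt_forall_mem_ge hθ.compact.isCompact
        (fun t ht => (hsupp ht).1)
      obtain ⟨b, hb, hb'⟩ := RVM.exists_lt_forall_mem_le hθ.compact.isCompact hθ.supp
      obtain ⟨C, hC⟩ := RVM.ae_moment_bound (T := T) (S := Function.support θ) (hmoment a b ha hb)
        fun t ht => ⟨ha' t (subset_tsupport _ ht.1), hb' t (subset_tsupport _ ht.1)⟩
      obtain ⟨D, hD⟩ := hsol.absDensity_bound hl hC
      have h0 : θ 0 = 0 := by
        by_contra hne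
        exact lt_irrefl 0 (hsupp (subset_tsupport _ hne)).1
      rw [hsol.integral_deriv_mul_totalEnergy hT hf₀ hE₀ hB₀ hθ hD, h0, zero_mul, neg_zero]
  have hle : RVM.totalEnergy f₀ E₀ B₀ ≤ c :=
    hsol.initial_energy_le hT hf₀ hE₀ hB₀ (hc.mono fun t ht => ht.le)
  refine ⟨⟨c, hle, hc⟩, ?_⟩
  rintro (hzero | hbound)
  -- With the moment bound valid from t = 0 on, θ need not vanish at 0, and the boundary term
  -- identifies the constant.
  · refine RVM.ae_eq_of_integral_deriv_mul hT hsol.integrableOn_totalEnergy fun θ hθ => ?_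
    obtain ⟨b, hb, hb'⟩ := RVM.exists_lt_forall_mem_le hθ.compact.isCompact hθ.supp
    obtain ⟨C, hC⟩ := RVM.ae_moment_bound (T := T) (S := Function.support θ) (hzero b hb)
      fun t ht => ⟨ht.2.1, hb' t (subset_tsupport _ ht.1)⟩
    obtain ⟨D, hD⟩ := hsol.absDensity_bound hl hC
    exact hsol.integral_deriv_mul_totalEnergy hT hf₀ hE₀ hB₀ hθ hD
  · filter_upwards [hc, hbound] with t h1 h2
    exact le_antisymm h2 (hle.trans h1.ge)
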